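/- Let $\Phi$ be a finite irreducible reduced crystallographic root system in a real vector space $V$, with simple roots $\alpha_1,\dots,\alpha_r$, coroots $\alpha^\vee$, Weyl group $W$ with length function $\ell$ and longest element $w_\circ$. Write $\langle x,\alpha^\vee\rangle$ for the pairing, $s_\alpha$ for the reflection in $\alpha$, $H_{\alpha,k}=\{x\in V:\langle x,\alpha^\vee\rangle=k\}$, $s_{\alpha,k}(x)=s_\alpha(x)+k\alpha$, and $|\alpha|$ for the positive one of $\pm\alpha$. Write $u\gtrdot w$ if $u=ws_\beta$ for a positive root $\beta$ and $\ell(u)=\ell(w)+1$. Let $A_\circ=\{x:0<\langle x,\alpha^\vee\rangle<1\text{ for all }\alpha>0\}$ be the fundamental alcove, $\theta^\vee$ the highest coroot, $\alpha_0=-\theta$, and let $s_0=s_{\alpha_0,-1}$, $s_i=s_{\alpha_i,0}$ $(1\le i\le r)$ be the generators of the affine Weyl group; let $\bar s_i=s_{\alpha_i}$ be their linear parts. Let $\lambda$ be a dominant weight, $W_\lambda$ its stabilizer in $W$, and $w_\circ^\lambda$ the longest element of $W_\lambda$. A $\lambda$-chain is a sequence of positive roots obtained from a reduced decomposition $v_{-\lambda}=s_{i_1}\cdots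 s_{i_m}$ of the affine Weyl group element with $v_{-\lambda}(A_\circ)=A_\circ-\lambda$ as $\beta_k=\bar s_{i_1}\cdots\bar s_{i_{k-1}}(\alpha_{i_k})$. Fix a $\lambda$-chain $\Gamma=(\beta_i)_{i\in I}$ with index set $I=\{\bar 1<\cdots<\bar q<1<\cdots<n\}$ such that $l_i^\emptyset:=\#\{j<i:\beta_j=\beta_i\}$ is $0$ if and only if $i\in\bar I:=\{\bar1,\dots,\bar q\}$. For a sequence of roots $\Gamma=(\beta_i)_{i\in I}$ let $r_i=s_{\beta_i}$ and $\widehat r_i=s_{\beta_i,-l_i^\emptyset}$. A subset $J=\{j_1<\cdots<j_s\}\subseteq I$ is admissible, $J\in\mathcal A(\Gamma)$, if $1\lessdot r_{j_1}\lessdot r_{j_1}r_{j_2}\lessdot\cdots\lessdot r_{j_1}\cdots r_{j_s}=:w(J)$. Put $\mu(J)=-\widehat r_{j_1}\cdots\widehat r_{j_s}(-\lambda)$. For $i\in I$ let $j_1<\dots<j_t$ be the elements of $J$ smaller than $i$, put $\gamma_i=r_{j_1}\cdots r_{j_t}(\beta_i)$, and define $l_i$ by $\widehat r_{j_1}\cdots\widehat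 r_{j_t}(H_{\beta_i,-l_i^\emptyset})=H_{-|\gamma_i|,l_i}$. For a simple root $\alpha_p$ let $I(J,p)=\{i\in I:\gamma_i=\pm\alpha_p\}$ and let $M(J,p)$ be the maximum of $\langle\mu(J),\alpha_p^\vee\rangle$ and the $l_i$, $i\in I(J,p)$. - $F_p$ is defined on $J$ iff $M(J,p)>0$; then $F_p(J)=(J\setminus\{m\})\cup\{k\}$, where $m$ is the least $i\in I(J,p)$ with $l_i=M(J,p)$ ($m=\infty$ if there is none) and $k$ is the predecessor of $m$ in $I(J,p)\cup\{\infty\}$. - $E_p$ is defined on $J$ iff $M(J,p)>\langle\mu(J),\alpha_p^\vee\rangle$; then $E_p(J)=(J\setminus\{k\})\cup(\{m\}\setminus\{\infty\})$, where $k$ is the largest $i\in I(J,p)$ with $l_i=M(J,p)$ and $m$ is the successor of $k$ in $I(J,p)\cup\{\infty\}$. Let $\Gamma^{\rm rev}=(\beta'_i)_{i\in I}$ with $\beta_i'=\beta_i$ for $i\in\bar I$ and $\beta'_i=w_\circ^\lambda(\beta_{n+1-i})$ for $1\le i\le n$, and let $r_i'=s_{\beta_i'}$. For $J\in\mathcal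 A(\Gamma)$ let $J^{\rm rev}=\{\bar k_1<\cdots<\bar k_b\}\cup\{n+1-j: j\in J\setminus\bar I\}$, where $\{\bar k_1<\cdots<\bar k_b\}\subseteq\bar I$ is the subset such that $1\lessdot r'_{\bar k_1}\lessdot\cdots\lessdot r'_{\bar k_1}\cdots r'_{\bar k_b}=w_\circ w(J)w_\circ^\lambda$. Theorem. Let $\alpha_p$ be a simple root. Then $-w_\circ(\alpha_p)$ is a simple root $\alpha_{p^*}$, and for every $J\in\mathcal A(\Gamma)$: the subset $\{\bar k_1<\cdots<\bar k_b\}$ above exists and is unique, and $J^{\rm rev}\in\mathcal A(\Gamma^{\rm rev})$; $F_p$ is defined on $J$ if and only if $E_{p^*}$ is defined on $J^{\rm rev}$; and in that case $F_p(J)\in\mathcal A(\Gamma)$ and $$(F_p(J))^{\rm rev}=E_{p^*}(J^{\rm rev}).$$ -/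

import Mathlib

namespace AlcoveModel

noncomputable section

/-- The product `f j₁ * f j₂ * ⋯ * f jₛ` over a finite set `J = {j₁ < j₂ < ⋯ < jₛ}`. -/
def ordProd {I G : Type*} [LinearOrder I] [Monoid G] (f : I → G) (J : Finset I) : G :=
  ((J.sort (· ≤ ·)).map f).prod

variable {ι V N : Type*} [AddCommGroup V] [Module ℝ V] [AddCommGroup N] [Module ℝ N]
  {P : RootPairing ι ℝ V N}

/-! ### The Weyl group -/

/-- The reflection `s_α`, for the root `α` with index `i`, as an element of the Weyl group. -/
abbrev refl (P : RootPairing ι ℝ V N) (i : ι) : P.weylGroup :=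
  RootPairing.weylGroup.ofIdx P i

/-- The index of the root `w(α)`, where `i` is the index of `α`. -/
abbrev act (w : P.weylGroup) (i : ι) : ι := P.weylGroupToPerm w i

theorem root_act (w : P.weylGroup) (i : ι) : P.root (act w i) = w • P.root i :=
  (P.weylGroup_apply_root w i).symm

/-- The index of the root `-α`, where `i` is the index of `α`. -/
abbrev negIdx (P : RootPairing ι ℝ V N) (i : ι) : ι := P.reflectionPerm i i

theorem root_negIdx (i : ι) : P.root (negIdx P i) = -P.root i := by
  simp

/-- The index of `|α|`: this is `α` if `α` is positive, and `-α` otherwise. -/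
def absIdx (b : P.Base) (i : ι) : ι :=
  open scoped Classical in if b.IsPos i then i else negIdx P i

/-- The length `ℓ(w)`: the least length of an expression of `w` as a product of simple
reflections. -/
def len (b : P.Base) (w : P.weylGroup) : ℕ :=
  sInf {k | ∃ l : List b.support, l.length = k ∧ (l.map fun i => refl P (i : ι)).prod = w}

/-- `u` covers `w` in the Bruhat order: `u = w s_β` with `β` a positive root, `ℓ(u) = ℓ(w) + 1`. -/
def Covers (b : P.Base) (u w : P.weylGroup) : Prop :=
  (∃ i, b.IsPos i ∧ u = w * refl P i) ∧ len b u = len b w + 1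

theorem finite_weylGroup [Finite ι] [P.IsRootSystem] : Finite P.weylGroup := by
  refine Finite.of_injective (fun w : P.weylGroup => P.weylGroupToPerm w) ?_
  intro g h hgh
  apply Subtype.ext
  apply RootPairing.Equiv.weightHom_injective P
  apply LinearEquiv.toLinearMap_injective
  have hs : Submodule.span ℝ (Set.range P.root) = ⊤ :=
    RootPairing.IsRootSystem.span_root_eq_top
  refine LinearMap.ext_on_range hs ?_
  intro i
  have h1 : g • P.root i = h • P.root i := by
    rw [← root_act, ← root_act]
    exact congrArg (fun e : ι ≃ ι => P.root (e i)) hgh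
  exact h1

theorem exists_longest [Finite ι] [P.IsRootSystem] (b : P.Base) (H : Subgroup P.weylGroup) :
    ∃ w : P.weylGroup, w ∈ H ∧ ∀ u ∈ H, len b u ≤ len b w := by
  have := finite_weylGroup (P := P)
  obtain ⟨w, hw⟩ := Finite.exists_max (fun u : H => len b (u : P.weylGroup))
  exact ⟨w, w.2, fun u hu => hw ⟨u, hu⟩⟩

/-- The element of maximal length of a subgroup of the Weyl group (it is unique for the
subgroups used below, namely the whole Weyl group and stabilizers of dominant weights). -/
def longest [Finite ι] [P.IsRootSystem] (b : P.Base) (H : Subgroup P.weylGroup) : P.weylGroup :=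
  (exists_longest b H).choose

/-- The longest element `w_∘` of the Weyl group. -/
def w0 [Finite ι] [P.IsRootSystem] (b : P.Base) : P.weylGroup := longest b ⊤

/-- The longest element `w_∘^λ` of the stabilizer `W_λ` of `λ` in the Weyl group. -/
def w0Stab [Finite ι] [P.IsRootSystem] (b : P.Base) (lam : V) : P.weylGroup :=
  longest b (MulAction.stabilizer P.weylGroup lam)

/-- The index `p*` of the root `-w_∘(α_p)`. -/
def star [Finite ι] [P.IsRootSystem] (b : P.Base) (p : ι) : ι := negIdx P (act (w0 b) p)

theorem root_star [Finite ι] [P.IsRootSystem] (b : P.Base) (p : ι) :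
    P.root (star b p) = -(w0 b • P.root p) := by
  rw [star, root_negIdx, root_act]

/-- `λ` is a dominant (integral) weight. -/
def IsDominantWeight (b : P.Base) (lam : V) : Prop :=
  (∀ i, ∃ z : ℤ, P.coroot' i lam = z) ∧ ∀ i, b.IsPos i → 0 ≤ P.coroot' i lam

/-! ### The affine Weyl group and `λ`-chains -/

/-- The hyperplane `H_{α,k} = {x | ⟨x, α^∨⟩ = k}`. -/
def hyperplane (P : RootPairing ι ℝ V N) (i : ι) (k : ℝ) : Set V := {x | P.coroot' i x = k}

/-- The affine reflection `s_{α,k} : x ↦ s_α(x) + k α`. -/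
def affRefl (P : RootPairing ι ℝ V N) (i : ι) (k : ℤ) : V ≃ᵃ[ℝ] V :=
  (P.reflection i).toAffineEquiv.trans (AffineEquiv.constVAdd ℝ V (k • P.root i))

theorem affRefl_apply (i : ι) (k : ℤ) (x : V) :
    affRefl P i k x = x - (P.coroot' i x - k) • P.root i := by
  simp only [affRefl, AffineEquiv.trans_apply, LinearEquiv.coe_toAffineEquiv,
    AffineEquiv.constVAdd_apply, vadd_eq_add, RootPairing.reflection_apply, sub_smul,
    Int.cast_smul_eq_zsmul]
  abel

/-- The fundamental alcove `A_∘`. -/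
def fundAlcove (b : P.Base) : Set V :=
  {x | ∀ i, b.IsPos i → 0 < P.coroot' i x ∧ P.coroot' i x < 1}

theorem exists_highestCoroot [Finite ι] [P.IsRootSystem] [P.IsIrreducible] (b : P.Base) :
    ∃ t : ι, ∀ i, b.flip.height i ≤ b.flip.height t := by
  have : Nontrivial V := RootPairing.IsIrreducible.nontrivial P
  have : Nonempty ι := by
    by_contra h
    rw [not_nonempty_iff] at h
    have hs : Submodule.span ℝ (Set.range P.root) = ⊤ :=
      RootPairing.IsRootSystem.span_root_eq_top
    rw [Set.range_eq_empty, Submodule.span_empty] at hs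
    exact bot_ne_top hs
  exact Finite.exists_max _

/-- The index of the root `θ` whose coroot `θ^∨` is the highest coroot. -/
def theta [Finite ι] [P.IsRootSystem] [P.IsIrreducible] (b : P.Base) : ι :=
  (exists_highestCoroot b).choose

section LambdaChain

variable [Finite ι] [P.IsRootSystem] [P.IsIrreducible]

/-- The indices of the roots `α₀ = -θ` (for `none`) and `α₁, …, α_r` (for `some`). -/
def genRoot (b : P.Base) : Option b.support → ι
  | none => negIdx P (theta b)
  | some i => i

/-- The Coxeter generators `s₀ = s_{α₀,-1}` and `s_i = s_{α_i,0}`, `i = 1, …, r`, of the affine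
Weyl group. -/
def affGen (b : P.Base) : Option b.support → (V ≃ᵃ[ℝ] V)
  | none => affRefl P (genRoot b none) (-1)
  | some i => affRefl P i 0

/-- The product `s_{t(1)} ⋯ s_{t(m)}` of generators of the affine Weyl group. -/
def affWord (b : P.Base) {I : Type*} [LinearOrder I] [Fintype I] (t : I → Option b.support) :
    V ≃ᵃ[ℝ] V :=
  ordProd (fun k => affGen b (t k)) Finset.univ

/-- `β` is a `λ`-chain of roots: a sequence of positive roots (indexed by a finite totally ordered
set `I`) determined by a reduced decomposition `s_{t(1)} ⋯ s_{t(m)}` of the element `v_{-λ}` of the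
affine Weyl group with `v_{-λ}(A_∘) = A_∘ - λ`, through
`β_k = s̄_{t(1)} ⋯ s̄_{t(k-1)} (α_{t(k)})`. -/
def IsLambdaChain (b : P.Base) (lam : V) {I : Type*} [LinearOrder I] [Fintype I]
    (β : I → ι) : Prop :=
  (∀ k, b.IsPos (β k)) ∧
  ∃ t : I → Option b.support,
    affWord b t '' fundAlcove b = (fun x => x - lam) '' fundAlcove b ∧
    (∀ l : List (Option b.support),
      (l.map (affGen b)).prod = affWord b t → Fintype.card I ≤ l.length) ∧
    ∀ k, β k = act (ordProd (fun j => refl P (genRoot b (t j))) (Finset.univ.filter (· < k)))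
      (genRoot b (t k))

end LambdaChain

/-! ### Admissible subsets, walls of galleries, and root operators -/

section Chain

variable {I : Type*} [LinearOrder I]

/-- The element `w(J) = r_{j₁} ⋯ r_{jₛ}` of the Weyl group, where `r_j = s_{β_j}`. -/
def wOf (P : RootPairing ι ℝ V N) (β : I → ι) (J : Finset I) : P.weylGroup :=
  ordProd (fun j => refl P (β j)) J

/-- `J = {j₁ < ⋯ < jₛ}` is admissible: `1 ⋖ r_{j₁} ⋖ r_{j₁} r_{j₂} ⋖ ⋯ ⋖ r_{j₁} ⋯ r_{jₛ}`. -/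
def IsAdmissible (b : P.Base) (β : I → ι) (J : Finset I) : Prop :=
  ∀ j ∈ J, Covers b (wOf P β (J.filter (· ≤ j))) (wOf P β (J.filter (· < j)))

/-- The root `γ_i = r_{j₁} ⋯ r_{jₜ}(β_i)` of the folded chain of roots `Γ(J)`, where
`j₁ < ⋯ < jₜ` are the folding positions before `i`. -/
def foldedRoot (P : RootPairing ι ℝ V N) (β : I → ι) (J : Finset I) (i : I) : ι :=
  act (wOf P β (J.filter (· < i))) (β i)

variable [Fintype I]

/-- `l_i^∅ = #{j < i | β_j = β_i}`. -/
def lEmpty (β : I → ι) (i : I) : ℕ :=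
  open scoped Classical in (Finset.univ.filter fun j => j < i ∧ β j = β i).card

/-- The affine reflection `r̂_i = s_{β_i, -l_i^∅}` in the wall of the face `F_i` of the unfolded
gallery. -/
def rHat (P : RootPairing ι ℝ V N) (β : I → ι) (i : I) : V ≃ᵃ[ℝ] V :=
  affRefl P (β i) (-(lEmpty β i : ℤ))

/-- The composition `r̂_{j₁} ⋯ r̂_{jₛ}`. -/
def wHatOf (P : RootPairing ι ℝ V N) (β : I → ι) (J : Finset I) : V ≃ᵃ[ℝ] V :=
  ordProd (rHat P β) J

/-- The weight `μ(J) = -r̂_{j₁} ⋯ r̂_{jₛ}(-λ)`. -/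
def weight (P : RootPairing ι ℝ V N) (β : I → ι) (lam : V) (J : Finset I) : V :=
  -(wHatOf P β J (-lam))

/-- The affine hyperplane that contains the face `F_i` of the gallery `γ(J)`. Folding at the
positions in `J` moves the wall `H_{β_i, -l_i^∅}` of the unfolded gallery by `r̂_{j₁} ⋯ r̂_{jₜ}`,
where `j₁ < ⋯ < jₜ` are the folding positions before `i`. -/
def wall (P : RootPairing ι ℝ V N) (β : I → ι) (J : Finset I) (i : I) : Set V :=
  (wHatOf P β (J.filter (· < i))) '' hyperplane P (β i) (-(lEmpty β i : ℝ))

/-- The number `l_i` such that the face `F_i` of `γ(J)` lies in the hyperplane `H_{-|γ_i|, l_i}`.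
It is the value of `⟨·, -|γ_i|^∨⟩` at the image of the point `-(l_i^∅ / 2) β_i` of
`H_{β_i, -l_i^∅}`; see `wall_eq`. -/
def level (b : P.Base) (β : I → ι) (J : Finset I) (i : I) : ℝ :=
  -P.coroot' (absIdx b (foldedRoot P β J i))
    (wHatOf P β (J.filter (· < i)) (-((lEmpty β i : ℝ) / 2) • P.root (β i)))

/-- `I(J, p) = {i | γ_i = ± α_p}`. -/
def idxSet (P : RootPairing ι ℝ V N) (β : I → ι) (J : Finset I) (p : ι) : Finset I :=
  open scoped Classical in Finset.univ.filter fun i =>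
    P.root (foldedRoot P β J i) = P.root p ∨ P.root (foldedRoot P β J i) = -P.root p

/-- `l_∞^p = ⟨μ(J), α_p^∨⟩`. -/
def levelInf (P : RootPairing ι ℝ V N) (β : I → ι) (lam : V) (J : Finset I) (p : ι) : ℝ :=
  P.coroot' p (weight P β lam J)

/-- `M(J, p)`: the maximum of the `l_i`, `i ∈ I(J, p)`, and `l_∞^p`. -/
def maxLevel (b : P.Base) (β : I → ι) (lam : V) (J : Finset I) (p : ι) : ℝ :=
  (insert (levelInf P β lam J p) ((idxSet P β J p).image (level b β J))).max'
    (Finset.insert_nonempty _ _)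

/-- The set `{i ∈ I(J, p) | l_i = M(J, p)}`. -/
def topSet (b : P.Base) (β : I → ι) (lam : V) (J : Finset I) (p : ι) : Finset I :=
  (idxSet P β J p).filter fun i => level b β J i = maxLevel b β lam J p

/-- `F_p` is defined on `J`. -/
def FDefined (b : P.Base) (β : I → ι) (lam : V) (p : ι) (J : Finset I) : Prop :=
  0 < maxLevel b β lam J p

/-- `i = m_F(J, p)`, the first element of `{i ∈ I(J, p) | l_i = M(J, p)}`. If this set is
empty, then `m_F(J, p) = ∞`, and no `i` has the property. -/
def IsMF (b : P.Base) (β : I → ι) (lam : V) (p : ι) (J : Finset I) (i : I) : Prop :=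
  IsLeast (topSet b β lam J p : Set I) i

/-- `i = k_F(J, p)`, the predecessor of `m_F(J, p)` in `I(J, p) ∪ {∞}`. -/
def IsKF (b : P.Base) (β : I → ι) (lam : V) (p : ι) (J : Finset I) (i : I) : Prop :=
  IsGreatest {k | k ∈ idxSet P β J p ∧ ∀ m, IsMF b β lam p J m → k < m} i

/-- `F_p(J) = (J \ {m_F}) ∪ {k_F}`; meaningful if `FDefined` holds. -/
def opF (b : P.Base) (β : I → ι) (lam : V) (p : ι) (J : Finset I) : Finset I :=
  open scoped Classical in
  Finset.univ.filter fun i => (i ∈ J ∧ ¬ IsMF b β lam p J i) ∨ IsKF b β lam p J i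

/-- `E_p` is defined on `J`. -/
def EDefined (b : P.Base) (β : I → ι) (lam : V) (p : ι) (J : Finset I) : Prop :=
  P.coroot' p (weight P β lam J) < maxLevel b β lam J p

/-- `i = k_E(J, p)`, the last element of `{i ∈ I(J, p) | l_i = M(J, p)}`. -/
def IsKE (b : P.Base) (β : I → ι) (lam : V) (p : ι) (J : Finset I) (i : I) : Prop :=
  IsGreatest (topSet b β lam J p : Set I) i

/-- `i = m_E(J, p)`, the successor of `k_E(J, p)` in `I(J, p) ∪ {∞}`. If the successor is `∞`,
no `i` has the property. -/
def IsME (b : P.Base) (β : I → ι) (lam : V) (p : ι) (J : Finset I) (i : I) : Prop :=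
  IsLeast {m | m ∈ idxSet P β J p ∧ ∀ k, IsKE b β lam p J k → k < m} i

/-- `E_p(J) = (J \ {k_E}) ∪ ({m_E} \ {∞})`; meaningful if `EDefined` holds. -/
def opE (b : P.Base) (β : I → ι) (lam : V) (p : ι) (J : Finset I) : Finset I :=
  open scoped Classical in
  Finset.univ.filter fun i => (i ∈ J ∧ ¬ IsKE b β lam p J i) ∨ IsME b β lam p J i

end Chain

/-! ### Reversal

The index set `{1̄ < ⋯ < q̄ < 1 < ⋯ < n}` is the ordered disjoint union `Fin q ⊕ₗ Fin n`. -/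

section Reversal

variable [Finite ι] [P.IsRootSystem] {q n : ℕ}

/-- The subset of `{1̄ < ⋯ < q̄}` given by `K`. -/
def barSet (K : Finset (Fin q)) : Finset (Fin q ⊕ₗ Fin n) :=
  open scoped Classical in K.image fun a => Sum.inlₗ a

/-- The sequence `Γ^rev`: the roots with index in `{1̄ < ⋯ < q̄}` are kept, and `β_i`, for
`i = 1, …, n`, is replaced by `w_∘^λ(β_{n+1-i})`. -/
def revChain (b : P.Base) (lam : V) (β : Fin q ⊕ₗ Fin n → ι) : Fin q ⊕ₗ Fin n → ι :=
  fun i => Sum.elim (fun a => β (Sum.inlₗ a))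
    (fun j => act (w0Stab b lam) (β (Sum.inrₗ j.rev))) (ofLex i)

/-- `K = {k̄₁ < ⋯ < k̄_b}` gives a saturated increasing chain
`1 ⋖ r'_{k̄₁} ⋖ ⋯ ⋖ r'_{k̄₁} ⋯ r'_{k̄_b} = w_∘ w(J) w_∘^λ` in the Bruhat order. -/
def IsRevInitial (b : P.Base) (lam : V) (β : Fin q ⊕ₗ Fin n → ι)
    (J : Finset (Fin q ⊕ₗ Fin n)) (K : Finset (Fin q)) : Prop :=
  IsAdmissible b (revChain b lam β) (barSet K) ∧
    wOf P (revChain b lam β) (barSet K) = w0 b * wOf P β J * w0Stab b lam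

/-- The set `K` with `IsRevInitial b lam β J K`. -/
def revInitial (b : P.Base) (lam : V) (β : Fin q ⊕ₗ Fin n → ι)
    (J : Finset (Fin q ⊕ₗ Fin n)) : Finset (Fin q) :=
  Classical.epsilon (IsRevInitial b lam β J)

/-- `J^rev = {k̄₁ < ⋯ < k̄_b} ∪ {n + 1 - j | j ∈ J ∩ {1, …, n}}`. -/
def revSet (b : P.Base) (lam : V) (β : Fin q ⊕ₗ Fin n → ι)
    (J : Finset (Fin q ⊕ₗ Fin n)) : Finset (Fin q ⊕ₗ Fin n) :=
  open scoped Classical in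
  barSet (revInitial b lam β J) ∪
    (Finset.univ.filter fun j : Fin n => Sum.inrₗ j.rev ∈ J).image fun j => Sum.inrₗ j

end Reversal

/-! ### The number `l_i` describes the wall -/

section Wall

theorem coroot'_affRefl_sub (i j : ι) (k : ℤ) (x y : V) :
    P.coroot' (P.reflectionPerm i j) (affRefl P i k x)
      - P.coroot' (P.reflectionPerm i j) (affRefl P i k y) = P.coroot' j x - P.coroot' j y := by
  have h : affRefl P i k x - affRefl P i k y = P.reflection i (x - y) := by
    simp only [affRefl_apply, RootPairing.reflection_apply, map_sub]
    module
  rw [← map_sub, h, ← map_sub, RootPairing.coroot'_reflectionPerm]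
  simp

theorem coroot'_prod_sub {I : Type*} (β : I → ι) (k : I → ℤ) (j : ι) (x y : V) (L : List I) :
    P.coroot' (act (L.map fun a => refl P (β a)).prod j)
        ((L.map fun a => affRefl P (β a) (k a)).prod x)
      - P.coroot' (act (L.map fun a => refl P (β a)).prod j)
        ((L.map fun a => affRefl P (β a) (k a)).prod y) = P.coroot' j x - P.coroot' j y := by
  induction L with
  | nil => simp [act, map_one]
  | cons a L ih =>
    rw [List.map_cons, List.prod_cons, List.map_cons, List.prod_cons, ← ih, act, map_mul]
    exact coroot'_affRefl_sub (P := P) (β a) _ (k a) _ _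

theorem coroot'_negIdx (i : ι) (x : V) : P.coroot' (negIdx P i) x = -P.coroot' i x := by
  rw [negIdx, RootPairing.coroot'_reflectionPerm]
  simp [RootPairing.reflection_apply]
  ring

theorem wall_eq {I : Type*} [LinearOrder I] [Fintype I] (b : P.Base) (β : I → ι) (J : Finset I) (i : I) :
    wall P β J i =
      {x | -P.coroot' (absIdx b (foldedRoot P β J i)) x = level b β J i} := by
  have key : ∀ x y : V,
      P.coroot' (foldedRoot P β J i) (wHatOf P β (J.filter (· < i)) x)
        - P.coroot' (foldedRoot P β J i) (wHatOf P β (J.filter (· < i)) y)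
        = P.coroot' (β i) x - P.coroot' (β i) y := fun x y =>
    coroot'_prod_sub β (fun a => -(lEmpty β a : ℤ)) (β i) x y _
  have hpt : P.coroot' (β i) (-((lEmpty β i : ℝ) / 2) • P.root (β i)) = -(lEmpty β i : ℝ) := by
    rw [map_smul, RootPairing.root_coroot'_eq_pairing, RootPairing.pairing_same, smul_eq_mul]
    ring
  have habs : ∀ x y : V, P.coroot' (absIdx b (foldedRoot P β J i)) x
      = P.coroot' (absIdx b (foldedRoot P β J i)) y ↔
      P.coroot' (foldedRoot P β J i) x = P.coroot' (foldedRoot P β J i) y := by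
    intro x y
    unfold absIdx
    split_ifs
    · exact Iff.rfl
    · rw [coroot'_negIdx, coroot'_negIdx, neg_inj]
  ext x
  simp only [wall, hyperplane, level, Set.mem_image, Set.mem_ofPred_eq, neg_inj]
  rw [habs]
  constructor
  · rintro ⟨y, hy, rfl⟩
    rw [← sub_eq_zero, key, hpt, hy, sub_self]
  · intro hx
    obtain ⟨y, rfl⟩ := (wHatOf P β (J.filter (· < i))).surjective x
    refine ⟨y, ?_, rfl⟩
    rw [← sub_eq_zero, key, hpt, sub_eq_zero] at hx
    exact hx

end Wall

end

end AlcoveModel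

/-!
Reversing the gallery of a `λ`-chain exchanges the root operators `F_p` and `E_{p*}`.

A `λ`-chain is used only through three properties (`IsGallery`): its roots are positive, the
reflection in each wall exchanges the two alcoves adjacent to it, and the root `δ > 0` occurs
`⟨λ, δ^∨⟩` times (`IsLambdaChain.isGallery`). They are expressed by the address of an alcove, the
function that sends a root `δ` to the integer `k` such that `δ^∨` takes values between `k` and
`k + 1` on the alcove; in this form they pass from `Γ` to `Γ^rev`
(`IsGallery.isGallery_revChain`). For a simple root `α_p` and an admissible subset `J`, the gallery
`γ(J)` crosses the hyperplanes orthogonal to `α_p`, or is folded at them; its height over the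
origin and the direction in which it is heading form a walk on the line (`SignedWalk`,
`IsGallery.signedWalk`). A fold always turns the walk from up to down, since the length in the
Weyl group increases along `J`; and by the lifting property of the Bruhat order (`act_eq_of_lifting`)
the folds at other hyperplanes never turn it from up to down. The numbers `l_i` are the levels of
this walk. Hence around the first and the last time at which the maximal level is attained the walk
has a prescribed shape (`SignedWalk.first_max`, `SignedWalk.last_max`), which shows where folds may
be added, moved or removed (`IsGallery.isAdmissible_insert`, `IsGallery.isAdmissible_insert_insert`,
`IsGallery.isAdmissible_of_insert`).

The roots of the initial segment of the chain are the positive roots that are not orthogonal to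
`λ`, once each, and their walls pass through the origin, so that they have level `0`. For every `w`
of minimal length in `w W_λ`, there is exactly one saturated chain from `1` to `w` in the Bruhat
order whose labels increase along the initial segment (`IsGallery.existsUnique_initial`): if `s_p`
decreases the length of `w`, then removing the last fold at a hyperplane orthogonal to `α_p` is a
bijection from the chains that lead to `w` to those that lead to `s_p w`. The element
`w_∘ w(J) w_∘^λ` is of minimal length in its coset, so that `J^rev` is well defined.

Outside of the initial segment, the alcoves of `γ(J^rev)` are the images under `z ↦ -w_∘(z + μ(J))`
of those of `γ(J)`, in reverse order (`IsGallery.coroot'_wHatOf_cut_revSet`). Hence the walls in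
this part that are orthogonal to `α_p` correspond to those orthogonal to `α_{p*}`, and all levels,
as well as the maximal level if it is positive, are shifted by `-⟨μ(J), α_p^∨⟩`
(`IsGallery.level_revSet`, `IsGallery.maxLevel_revSet`). So the first wall of maximal level and its
predecessor become the last wall of maximal level and its successor. There remains the initial
segment. If `F_p` moves a fold, then `w(J)` is not changed, and neither is the initial part of
`J^rev`. If `F_p` adds a fold, then it replaces `w(J)` by `s_p w(J)`. In this case the last wall of
maximal level of `γ(J^rev)` lies in the initial segment; removing the fold there gives a saturated
chain which leads to `w_∘ s_p w(J) w_∘^λ` (`IsGallery.isAdmissible_barSet_erase`), and this chain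
is the initial part of `F_p(J)^rev` by uniqueness.
-/

namespace AlcoveModel

set_option linter.unusedSectionVars false

/-! ### The action of the Weyl group on roots and coroots -/

section

variable {ι V N : Type*} [AddCommGroup V] [Module ℝ V] [AddCommGroup N] [Module ℝ N]
  {P : RootPairing ι ℝ V N}

theorem act_mul (u v : P.weylGroup) (i : ι) : act (u * v) i = act u (act v i) := by
  simp [act]

theorem act_one (i : ι) : act (1 : P.weylGroup) i = i := by
  simp [act]

theorem act_refl (i j : ι) : act (refl P i) j = P.reflectionPerm i j := by
  simp [act, refl]
  rfl

theorem act_inv_act (w : P.weylGroup) (i : ι) : act w⁻¹ (act w i) = i := by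
  rw [← act_mul, inv_mul_cancel, act_one]

theorem act_act_inv (w : P.weylGroup) (i : ι) : act w (act w⁻¹ i) = i := by
  rw [← act_mul, mul_inv_cancel, act_one]

theorem act_inj {w : P.weylGroup} {i j : ι} : act w i = act w j ↔ i = j :=
  (P.weylGroupToPerm w).injective.eq_iff

theorem refl_mul_self (i : ι) : refl P i * refl P i = 1 := by
  rw [mul_eq_one_iff_inv_eq]
  apply Subtype.ext
  exact RootPairing.Equiv.reflection_inv P i

theorem refl_inv (i : ι) : (refl P i)⁻¹ = refl P i :=
  inv_eq_of_mul_eq_one_right (refl_mul_self i)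

theorem mul_refl_mul_refl (w : P.weylGroup) (i : ι) : w * refl P i * refl P i = w := by
  rw [mul_assoc, refl_mul_self, mul_one]

theorem refl_mul_refl_mul (w : P.weylGroup) (i : ι) : refl P i * (refl P i * w) = w := by
  rw [← mul_assoc, refl_mul_self, one_mul]

theorem refl_smul (i : ι) (x : V) : refl P i • x = x - P.coroot' i x • P.root i := by
  rw [RootPairing.weylGroup.ofIdx_smul, ← RootPairing.reflection_apply]
  simp

theorem negIdx_negIdx (i : ι) : negIdx P (negIdx P i) = i := by
  apply P.root.injective
  rw [root_negIdx, root_negIdx, neg_neg]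

theorem negIdx_inj {i j : ι} : negIdx P i = negIdx P j ↔ i = j :=
  ⟨fun h => by rw [← negIdx_negIdx (P := P) i, h, negIdx_negIdx], fun h => h ▸ rfl⟩

theorem act_negIdx (w : P.weylGroup) (i : ι) : act w (negIdx P i) = negIdx P (act w i) := by
  apply P.root.injective
  rw [root_act, root_negIdx, root_negIdx, root_act, smul_neg]

theorem act_refl_self (i : ι) : act (refl P i) i = negIdx P i :=
  act_refl i i

theorem coroot'_act (w : P.weylGroup) (i : ι) (x : V) :
    P.coroot' (act w i) (w • x) = P.coroot' i x := by
  obtain ⟨w, hw⟩ := w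
  revert i x
  induction hw using RootPairing.weylGroup.induction with
  | mem k =>
    intro i x
    change P.coroot' (act (refl P k) i) (refl P k • x) = _
    rw [act_refl, refl_smul, ← RootPairing.reflection_apply, RootPairing.coroot'_reflectionPerm]
    simp
  | one =>
    intro i x
    change P.coroot' (act (1 : P.weylGroup) i) ((1 : P.weylGroup) • x) = _
    rw [act_one, one_smul]
  | mul u v hu hv hu' hv' =>
    intro i x
    change P.coroot' (act (⟨u, hu⟩ * ⟨v, hv⟩ : P.weylGroup) i)
      ((⟨u, hu⟩ * ⟨v, hv⟩ : P.weylGroup) • x) = _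
    rw [act_mul, mul_smul, hu', hv']

theorem coroot'_smul (w : P.weylGroup) (i : ι) (x : V) :
    P.coroot' i (w • x) = P.coroot' (act w⁻¹ i) x := by
  rw [← coroot'_act w (act w⁻¹ i), act_act_inv]

theorem coroot'_act_root_act (w : P.weylGroup) (i j : ι) :
    P.coroot' (act w i) (P.root (act w j)) = P.coroot' i (P.root j) := by
  rw [root_act, coroot'_act]

theorem coroot'_reflectionPerm_apply (i j : ι) (x : V) :
    P.coroot' (P.reflectionPerm i j) x
      = P.coroot' j x - P.coroot' i x * P.coroot' j (P.root i) := by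
  rw [RootPairing.coroot'_reflectionPerm, LinearMap.comp_apply, LinearEquiv.coe_coe,
    RootPairing.reflection_apply, map_sub, map_smul, smul_eq_mul]

theorem coroot'_root_self (i : ι) : P.coroot' i (P.root i) = 2 := by
  rw [RootPairing.root_coroot'_eq_pairing, RootPairing.pairing_same]

section RootSystem

variable [P.IsRootSystem]

/-- The Weyl group acts faithfully on the roots. -/
theorem eq_of_act_eq {u v : P.weylGroup} (h : ∀ i, act u i = act v i) : u = v := by
  apply Subtype.ext
  apply RootPairing.Equiv.weightHom_injective P
  apply LinearEquiv.toLinearMap_injective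
  refine LinearMap.ext_on_range (RootPairing.IsRootSystem.span_root_eq_top (P := P)) fun i => ?_
  change u • P.root i = v • P.root i
  rw [← root_act, ← root_act, h]

theorem refl_act (w : P.weylGroup) (i : ι) : refl P (act w i) = w * refl P i * w⁻¹ := by
  refine eq_of_act_eq fun j => ?_
  apply P.root.injective
  obtain ⟨j, rfl⟩ : ∃ k, act w k = j := ⟨act w⁻¹ j, act_act_inv w j⟩
  have h1 : P.root (act (refl P (act w i)) (act w j))
      = w • P.root j - P.coroot' i (P.root j) • w • P.root i := by
    rw [root_act, refl_smul, coroot'_act_root_act, root_act, root_act]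
  have h2 : P.root (act w (act (refl P i) j))
      = w • P.root j - w • (P.coroot' i (P.root j) • P.root i) := by
    rw [root_act w (act _ j), root_act _ j, refl_smul, smul_sub]
  rw [act_mul, act_inv_act, act_mul, h1, h2]
  congr 1
  exact (smul_comm w _ (P.root i)).symm

theorem refl_act_mul (w : P.weylGroup) (i : ι) : refl P (act w i) * w = w * refl P i := by
  rw [refl_act, inv_mul_cancel_right]

theorem refl_negIdx (i : ι) : refl P (negIdx P i) = refl P i := by
  rw [← act_refl_self, refl_act, refl_inv, mul_refl_mul_refl]

end RootSystem

/-! ### Positive roots -/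

theorem isPos_negIdx (b : P.Base) (i : ι) : b.IsPos (negIdx P i) ↔ ¬ b.IsPos i :=
  RootPairing.Base.IsPos.neg_iff_not b i

theorem isPos_act_negIdx (b : P.Base) (w : P.weylGroup) (i : ι) :
    b.IsPos (act w (negIdx P i)) ↔ ¬ b.IsPos (act w i) := by
  rw [act_negIdx, isPos_negIdx]

theorem absIdx_eq_of_eq_or (b : P.Base) {i p : ι} (hp : b.IsPos p)
    (h : i = p ∨ i = negIdx P p) : absIdx b i = p := by
  unfold absIdx
  rcases h with rfl | rfl
  · rw [if_pos hp]
  · rw [if_neg (by rw [isPos_negIdx]; simpa using hp), negIdx_negIdx]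

section Finite

variable [Finite ι] [P.IsCrystallographic] [P.IsReduced]

theorem isPos_act_refl {b : P.Base} {i p : ι} (hi : b.IsPos i) (hp : p ∈ b.support)
    (hip : i ≠ p) : b.IsPos (act (refl P p) i) := by
  rw [act_refl]
  exact hi.reflectionPerm hp hip

theorem isPos_act_refl_iff {b : P.Base} {i p : ι} (hp : p ∈ b.support)
    (h1 : i ≠ p) (h2 : i ≠ negIdx P p) : b.IsPos (act (refl P p) i) ↔ b.IsPos i := by
  constructor
  · intro h
    by_contra h'
    rw [← isPos_negIdx] at h'
    have := isPos_act_refl h' hp (fun h => h2 (by rw [← h, negIdx_negIdx]))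
    rw [isPos_act_negIdx] at this
    exact this h
  · exact fun h => isPos_act_refl h hp h1

/-- A root is positive if and only if its coroot is positive. -/
theorem isPos_flip_iff (b : P.Base) (i : ι) : b.flip.IsPos i ↔ b.IsPos i := by
  have hf : ∀ k, P.flip.reflectionPerm k = P.reflectionPerm k := fun k => rfl
  have hneg : ∀ k, b.flip.IsPos (P.reflectionPerm k k) ↔ ¬ b.flip.IsPos k := fun k =>
    RootPairing.Base.IsPos.neg_iff_not b.flip k
  induction i using b.induction_reflect with
  | h₀ i hi =>
    replace hi : b.flip.IsPos i ↔ b.IsPos i := hi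
    rw [hneg, hi, ← isPos_negIdx]
  | h₁ i hi =>
    exact iff_of_true (RootPairing.Base.isPos_of_mem_support (b := b.flip) hi)
      (RootPairing.Base.isPos_of_mem_support hi)
  | h₂ i j hi hj =>
    replace hi : b.flip.IsPos i ↔ b.IsPos i := hi
    have hj1 : b.IsPos j := RootPairing.Base.isPos_of_mem_support hj
    have hj2 : b.flip.IsPos j := RootPairing.Base.isPos_of_mem_support (b := b.flip) hj
    by_cases h1 : i = j
    · subst h1
      rw [hneg, hi, ← isPos_negIdx]
    by_cases h2 : i = negIdx P j
    · subst h2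
      rw [P.reflectionPerm_self]
      exact iff_of_true hj2 hj1
    have h3 := isPos_act_refl_iff (b := b) hj h1 h2
    have h4 := isPos_act_refl_iff (P := P.flip) (b := b.flip) (i := i) hj h1 h2
    rw [act_refl] at h3 h4
    rw [h3, ← hi]
    exact h4

end Finite

end

/-! ### The length function -/

section

variable {ι V N : Type*} [AddCommGroup V] [Module ℝ V] [AddCommGroup N] [Module ℝ N]
  {P : RootPairing ι ℝ V N}

/-- The product of a word in the simple reflections. -/
noncomputable def wordProd (b : P.Base) (L : List b.support) : P.weylGroup :=
  (L.map fun i : b.support => refl P (i : ι)).prod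

theorem wordProd_cons (b : P.Base) (a : b.support) (L : List b.support) :
    wordProd b (a :: L) = refl P (a : ι) * wordProd b L := by
  simp [wordProd]

theorem wordProd_append (b : P.Base) (L L' : List b.support) :
    wordProd b (L ++ L') = wordProd b L * wordProd b L' := by
  simp [wordProd]

theorem wordProd_singleton (b : P.Base) (a : b.support) :
    wordProd b [a] = refl P (a : ι) := by
  simp [wordProd]

theorem wordProd_nil (b : P.Base) : wordProd b [] = 1 := by
  simp [wordProd]

theorem len_eq_sInf (b : P.Base) (w : P.weylGroup) :
    len b w = sInf {k | ∃ l : List b.support, l.length = k ∧ wordProd b l = w} := by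
  -- the list of indices in the definition of `len` is coerced by means of a monadic bind
  have h : ∀ l : List b.support, (l >>= fun a => pure (a : ι)) = l.map fun a : b.support => (a : ι) :=
    fun l => by simp [List.bind_eq_flatMap]
  unfold len wordProd
  congr 1
  ext k
  refine exists_congr fun l => and_congr_right fun _ => ?_
  rw [h l, List.map_map]
  rfl

theorem len_le (b : P.Base) (L : List b.support) : len b (wordProd b L) ≤ L.length := by
  rw [len_eq_sInf]
  exact Nat.sInf_le ⟨L, rfl, rfl⟩

theorem len_one (b : P.Base) : len b 1 = 0 := by
  have := len_le b []
  rw [wordProd_nil] at this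
  simpa using this

/-- The inversions of `w`: the positive roots that `w` makes negative. -/
def inversions (b : P.Base) (w : P.weylGroup) : Set ι :=
  {i | b.IsPos i ∧ ¬ b.IsPos (act w i)}

variable [Finite ι] [P.IsRootSystem] [P.IsCrystallographic] [P.IsReduced]

theorem exists_wordProd_eq (b : P.Base) (w : P.weylGroup) :
    ∃ L : List b.support, wordProd b L = w := by
  have hrefl : ∀ i, ∃ L : List b.support, wordProd b L = refl P i := by
    intro i
    induction i using b.induction_reflect with
    | h₀ i hi =>
      obtain ⟨L, hL⟩ := hi
      exact ⟨L, by rw [hL]; exact (refl_negIdx i).symm⟩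
    | h₁ i hi => exact ⟨[⟨i, hi⟩], by rw [wordProd_singleton]⟩
    | h₂ i j hi hj =>
      obtain ⟨L, hL⟩ := hi
      refine ⟨⟨j, hj⟩ :: (L ++ [⟨j, hj⟩]), ?_⟩
      rw [wordProd_cons, wordProd_append, wordProd_singleton, hL, ← act_refl, refl_act,
        refl_inv, mul_assoc]
  obtain ⟨w, hw⟩ := w
  induction hw using RootPairing.weylGroup.induction with
  | mem k => exact hrefl k
  | one => exact ⟨[], wordProd_nil b⟩
  | mul u v hu hv hu' hv' =>
    obtain ⟨L, hL⟩ := hu'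
    obtain ⟨L', hL'⟩ := hv'
    exact ⟨L ++ L', by rw [wordProd_append, hL, hL']; rfl⟩

theorem exists_reduced (b : P.Base) (w : P.weylGroup) :
    ∃ L : List b.support, L.length = len b w ∧ wordProd b L = w := by
  obtain ⟨L, hL⟩ := exists_wordProd_eq b w
  rw [len_eq_sInf]
  exact Nat.sInf_mem (s := {k | ∃ l : List b.support, l.length = k ∧ wordProd b l = w})
    ⟨_, L, rfl, hL⟩

/-- The strong exchange condition. -/
theorem exists_wordProd_mul_refl (b : P.Base) {i : ι} (hi : b.IsPos i) (L : List b.support)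
    (h : ¬ b.IsPos (act (wordProd b L) i)) :
    ∃ L' : List b.support, L'.length < L.length ∧ wordProd b L' = wordProd b L * refl P i := by
  induction L with
  | nil =>
    rw [wordProd_nil, act_one] at h
    exact absurd hi h
  | cons a L ih =>
    by_cases h' : b.IsPos (act (wordProd b L) i)
    · -- the first letter makes the root negative, so the root is the simple root of this letter
      refine ⟨L, by simp, ?_⟩
      rw [wordProd_cons, act_mul] at h
      have h1 : act (wordProd b L) i = a := by
        by_contra hne
        exact h (isPos_act_refl h' a.2 hne)
      rw [wordProd_cons, mul_assoc, ← refl_act_mul, h1, refl_mul_refl_mul]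
    · obtain ⟨L', hL', hp⟩ := ih h'
      exact ⟨a :: L', by simpa using hL', by rw [wordProd_cons, hp, wordProd_cons, mul_assoc]⟩

theorem len_mul_refl_lt {b : P.Base} {w : P.weylGroup} {i : ι} (hi : b.IsPos i)
    (h : ¬ b.IsPos (act w i)) : len b (w * refl P i) < len b w := by
  obtain ⟨L, hL, rfl⟩ := exists_reduced b w
  obtain ⟨L', hL', hp⟩ := exists_wordProd_mul_refl b hi L h
  rw [← hp, ← hL]
  exact (len_le b L').trans_lt hL'

theorem lt_len_mul_refl {b : P.Base} {w : P.weylGroup} {i : ι} (hi : b.IsPos i)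
    (h : b.IsPos (act w i)) : len b w < len b (w * refl P i) := by
  have := len_mul_refl_lt (w := w * refl P i) hi
    (by rw [act_mul, act_refl_self, isPos_act_negIdx, not_not]; exact h)
  rwa [mul_refl_mul_refl] at this

theorem isPos_act_of_lt {b : P.Base} {w : P.weylGroup} {i : ι} (hi : b.IsPos i)
    (h : len b w < len b (w * refl P i)) : b.IsPos (act w i) := by
  by_contra h'
  exact absurd (len_mul_refl_lt hi h') (by omega)

theorem inversions_mul_refl {b : P.Base} {w : P.weylGroup} {p : ι} (hp : p ∈ b.support)
    (h : b.IsPos (act w p)) :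
    (inversions b (w * refl P p)).ncard = (inversions b w).ncard + 1 := by
  have hpp : b.IsPos p := RootPairing.Base.isPos_of_mem_support hp
  have key : inversions b (w * refl P p) = insert p (act (refl P p) '' inversions b w) := by
    ext i
    simp only [inversions, Set.mem_ofPred_eq, Set.mem_insert_iff, Set.mem_image]
    constructor
    · rintro ⟨h1, h2⟩
      refine or_iff_not_imp_left.2 fun hne => ⟨act (refl P p) i, ⟨isPos_act_refl h1 hp hne, ?_⟩, ?_⟩
      · rwa [act_mul] at h2
      · rw [← act_mul, refl_mul_self, act_one]
    · rintro (rfl | ⟨j, ⟨h1, h2⟩, rfl⟩)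
      · exact ⟨hpp, by rw [act_mul, act_refl_self, isPos_act_negIdx, not_not]; exact h⟩
      · refine ⟨isPos_act_refl h1 hp ?_, ?_⟩
        · rintro rfl
          exact h2 h
        · rwa [← act_mul, mul_refl_mul_refl]
  rw [key, Set.ncard_insert_of_notMem, Set.ncard_image_of_injective _ (P.weylGroupToPerm _).injective]
  rintro ⟨j, ⟨h1, -⟩, h2⟩
  rw [← act_inj (w := refl P p), ← act_mul, refl_mul_self, act_one, act_refl_self] at h2
  rw [h2, isPos_negIdx] at h1
  exact h1 hpp

/-- The length of `w` is its number of inversions. -/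
theorem len_eq_ncard_inversions (b : P.Base) (w : P.weylGroup) :
    len b w = (inversions b w).ncard := by
  generalize hn : len b w = n
  induction n generalizing w with
  | zero =>
    obtain ⟨L, hL, rfl⟩ := exists_reduced b w
    rw [hn, List.length_eq_zero_iff] at hL
    subst hL
    have : inversions b (wordProd b []) = ∅ := by
      ext i
      simp [inversions, wordProd_nil, act_one]
    rw [this, Set.ncard_empty]
  | succ n ih =>
    obtain ⟨L, hL, hw⟩ := exists_reduced b w
    rcases List.eq_nil_or_concat L with rfl | ⟨L', a, rfl⟩
    · simp [hn] at hL
    rw [List.concat_eq_append, wordProd_append, wordProd_singleton] at hw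
    have ha : b.IsPos (a : ι) := RootPairing.Base.isPos_of_mem_support a.2
    have h1 : len b (wordProd b L') ≤ n := by
      have := len_le b L'
      simp at hL
      omega
    have h2 : b.IsPos (act (wordProd b L') a) := by
      apply isPos_act_of_lt ha
      rw [hw, hn]
      omega
    have h3 : len b (wordProd b L') = n := by
      have h4 : len b w ≤ len b (wordProd b L') + 1 := by
        obtain ⟨M, hM, hM'⟩ := exists_reduced b (wordProd b L')
        have := len_le b (M ++ [a])
        rw [wordProd_append, wordProd_singleton, hM', hw] at this
        simpa [hM] using this
      omega
    rw [← hw, inversions_mul_refl a.2 h2, ← ih _ h3]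

theorem len_mul_refl_of_isPos {b : P.Base} {w : P.weylGroup} {p : ι} (hp : p ∈ b.support)
    (h : b.IsPos (act w p)) : len b (w * refl P p) = len b w + 1 := by
  rw [len_eq_ncard_inversions, len_eq_ncard_inversions, inversions_mul_refl hp h]

theorem len_inv (b : P.Base) (w : P.weylGroup) : len b w⁻¹ = len b w := by
  have key : ∀ u : P.weylGroup, len b u⁻¹ ≤ len b u := by
    intro u
    obtain ⟨L, hL, rfl⟩ := exists_reduced b u
    rw [← hL]
    have : (wordProd b L)⁻¹ = wordProd b L.reverse := by
      rw [wordProd, wordProd, List.prod_inv_reverse, List.map_reverse, List.map_map]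
      congr 3
      funext i
      exact refl_inv _
    rw [this]
    simpa using len_le b L.reverse
  refine le_antisymm (key w) ?_
  simpa using key w⁻¹

theorem len_refl_mul_of_isPos {b : P.Base} {w : P.weylGroup} {p : ι} (hp : p ∈ b.support)
    (h : b.IsPos (act w⁻¹ p)) : len b (refl P p * w) = len b w + 1 := by
  rw [← len_inv, mul_inv_rev, refl_inv, len_mul_refl_of_isPos hp h, len_inv]

theorem len_refl_mul_of_not_isPos {b : P.Base} {w : P.weylGroup} {p : ι} (hp : p ∈ b.support)
    (h : ¬ b.IsPos (act w⁻¹ p)) : len b (refl P p * w) + 1 = len b w := by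
  have := len_refl_mul_of_isPos (w := refl P p * w) hp
    (by rw [mul_inv_rev, refl_inv, act_mul, act_refl_self, isPos_act_negIdx]; exact h)
  rw [refl_mul_refl_mul] at this
  exact this.symm

theorem eq_one_of_len_eq_zero {b : P.Base} {w : P.weylGroup} (h : len b w = 0) : w = 1 := by
  obtain ⟨L, hL, rfl⟩ := exists_reduced b w
  rw [h, List.length_eq_zero_iff] at hL
  rw [hL, wordProd_nil]

theorem eq_one_of_forall_isPos {b : P.Base} {w : P.weylGroup}
    (h : ∀ i, b.IsPos i → b.IsPos (act w i)) : w = 1 := by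
  apply eq_one_of_len_eq_zero (b := b)
  rw [len_eq_ncard_inversions]
  have : inversions b w = ∅ := by
    ext i
    simp only [inversions, Set.mem_ofPred_eq, Set.mem_empty_iff_false, iff_false, not_and, not_not]
    exact h i
  rw [this, Set.ncard_empty]

theorem exists_simple_of_ne_one (b : P.Base) {w : P.weylGroup} (h : w ≠ 1) :
    ∃ p ∈ b.support, ¬ b.IsPos (act w⁻¹ p) := by
  obtain ⟨L, hL, hw⟩ := exists_reduced b w
  cases L with
  | nil => exact absurd (by rw [← hw, wordProd_nil]) h
  | cons a L =>
    refine ⟨a, a.2, fun hpos => ?_⟩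
    have h1 := len_refl_mul_of_isPos a.2 hpos
    rw [← hw, wordProd_cons, refl_mul_refl_mul] at h1
    have h2 := len_le b L
    rw [wordProd_cons] at hw
    rw [hw] at h1
    simp at hL
    omega

theorem mem_support_of_len_refl {b : P.Base} {i : ι} (hi : b.IsPos i)
    (h : len b (refl P i) = 1) : i ∈ b.support := by
  obtain ⟨L, hL, hw⟩ := exists_reduced b (refl P i)
  rw [h] at hL
  obtain ⟨a, rfl⟩ := List.length_eq_one_iff.1 hL
  rw [wordProd_singleton] at hw
  by_contra hne
  have h1 := isPos_act_refl hi a.2 (fun h => hne (h ▸ a.2))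
  rw [hw, act_refl_self, isPos_negIdx] at h1
  exact h1 hi

/-- The lifting property: if `x ⋖ x s_i` in the Bruhat order, and if `s_p` increases the length
of `x` and decreases that of `x s_i` from the left, then `x s_i = s_p x`. -/
theorem act_eq_of_lifting {b : P.Base} {x : P.weylGroup} {i p : ι} (hp : p ∈ b.support)
    (hi : b.IsPos i) (hlen : len b (x * refl P i) = len b x + 1)
    (h1 : b.IsPos (act x⁻¹ p)) (h2 : ¬ b.IsPos (act (x * refl P i)⁻¹ p)) : act x i = p := by
  by_contra hne
  have hx : b.IsPos (act x i) := isPos_act_of_lt hi (by omega)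
  have h3 : b.IsPos (act (refl P p * (x * refl P i)) i) := by
    apply isPos_act_of_lt hi
    rw [mul_assoc, mul_refl_mul_refl, len_refl_mul_of_isPos hp h1]
    have := len_refl_mul_of_not_isPos hp h2
    omega
  rw [act_mul, act_mul, act_refl_self, act_negIdx, isPos_act_negIdx] at h3
  exact h3 (isPos_act_refl hx hp hne)

/-! ### Parabolic subgroups and longest elements -/

omit [P.IsReduced] [P.IsCrystallographic] in
theorem longest_mem (b : P.Base) (H : Subgroup P.weylGroup) : longest b H ∈ H :=
  (exists_longest b H).choose_spec.1

omit [P.IsReduced] [P.IsCrystallographic] in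
theorem len_le_len_longest (b : P.Base) {H : Subgroup P.weylGroup} {u : P.weylGroup}
    (hu : u ∈ H) : len b u ≤ len b (longest b H) :=
  (exists_longest b H).choose_spec.2 u hu

theorem not_isPos_act_longest {b : P.Base} {H : Subgroup P.weylGroup} {i : ι} (hi : b.IsPos i)
    (hH : refl P i ∈ H) : ¬ b.IsPos (act (longest b H) i) := by
  intro h
  have h1 := lt_len_mul_refl hi h
  have h2 := len_le_len_longest b (mul_mem (longest_mem b H) hH)
  omega

theorem isPos_act_w0 (b : P.Base) (i : ι) : b.IsPos (act (w0 b) i) ↔ ¬ b.IsPos i := by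
  have key : ∀ j, b.IsPos j → ¬ b.IsPos (act (w0 b) j) := fun j hj =>
    not_isPos_act_longest hj (Subgroup.mem_top _)
  refine ⟨fun h h' => key i h' h, fun h => ?_⟩
  have := key _ ((isPos_negIdx b i).2 h)
  rwa [isPos_act_negIdx, not_not] at this

theorem w0_mul_self (b : P.Base) : w0 b * w0 b = 1 := by
  apply eq_one_of_forall_isPos (b := b)
  intro i hi
  rwa [act_mul, isPos_act_w0, isPos_act_w0, not_not]

theorem w0_inv (b : P.Base) : (w0 b)⁻¹ = w0 b :=
  inv_eq_of_mul_eq_one_right (w0_mul_self b)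

theorem len_w0_mul (b : P.Base) (x : P.weylGroup) :
    len b (w0 b * x) + len b x = {i | b.IsPos i}.ncard := by
  rw [len_eq_ncard_inversions, len_eq_ncard_inversions, ← Set.ncard_union_eq]
  · congr 1
    ext i
    simp only [inversions, act_mul, isPos_act_w0, Set.mem_union, Set.mem_ofPred_eq]
    tauto
  · rw [Set.disjoint_left]
    intro i
    simp only [inversions, act_mul, isPos_act_w0, Set.mem_ofPred_eq]
    tauto

theorem star_mem_support (b : P.Base) {p : ι} (hp : p ∈ b.support) : star b p ∈ b.support := by
  have hpp : b.IsPos p := RootPairing.Base.isPos_of_mem_support hp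
  have h0 : b.IsPos (star b p) := by
    rw [star, isPos_negIdx, isPos_act_w0, not_not]
    exact hpp
  refine mem_support_of_len_refl h0 ?_
  have h1 : refl P (star b p) = w0 b * (refl P p * w0 b) := by
    rw [star, refl_negIdx, refl_act, w0_inv, mul_assoc]
  have h2 := len_refl_mul_of_not_isPos (w := w0 b) hp
    (by rw [w0_inv, isPos_act_w0, not_not]; exact hpp)
  have h3 := len_w0_mul b (refl P p * w0 b)
  have h4 := len_w0_mul b 1
  rw [mul_one, len_one] at h4
  rw [h1]
  omega

theorem isPos_star (b : P.Base) {p : ι} (hp : p ∈ b.support) : b.IsPos (star b p) :=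
  RootPairing.Base.isPos_of_mem_support (star_mem_support b hp)

section Dominant

variable {b : P.Base} {lam : V} (hlam : IsDominantWeight b lam)

omit [Finite ι] [P.IsRootSystem] [P.IsCrystallographic] [P.IsReduced] in
include hlam in
theorem isPos_of_coroot'_pos {i : ι} (h : 0 < P.coroot' i lam) : b.IsPos i := by
  by_contra h'
  rw [← isPos_negIdx] at h'
  have := hlam.2 _ h'
  rw [coroot'_negIdx] at this
  linarith

omit [P.IsCrystallographic] [P.IsReduced] in
variable (b lam) in
theorem w0Stab_smul : w0Stab b lam • lam = lam :=
  MulAction.mem_stabilizer_iff.1 (longest_mem b (MulAction.stabilizer P.weylGroup lam))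

omit [P.IsCrystallographic] [P.IsReduced] in
variable (b lam) in
theorem coroot'_act_w0Stab (i : ι) : P.coroot' (act (w0Stab b lam) i) lam = P.coroot' i lam := by
  have := coroot'_act (w0Stab b lam) i lam
  rwa [w0Stab_smul] at this

theorem not_isPos_act_w0Stab {i : ι} (hi : b.IsPos i) (h : P.coroot' i lam = 0) :
    ¬ b.IsPos (act (w0Stab b lam) i) := by
  refine not_isPos_act_longest hi ?_
  rw [MulAction.mem_stabilizer_iff, refl_smul, h, zero_smul, sub_zero]

include hlam in
/-- The inversions of `w_∘^λ` are the positive roots orthogonal to `λ`. -/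
theorem isPos_act_w0Stab_iff {i : ι} :
    b.IsPos (act (w0Stab b lam) i) ↔ (b.IsPos i ↔ P.coroot' i lam ≠ 0) := by
  have key : ∀ j, b.IsPos j → (b.IsPos (act (w0Stab b lam) j) ↔ P.coroot' j lam ≠ 0) := by
    intro j hj
    refine ⟨fun h h' => not_isPos_act_w0Stab hj h' h, fun h => ?_⟩
    apply isPos_of_coroot'_pos hlam
    rw [coroot'_act_w0Stab]
    exact lt_of_le_of_ne (hlam.2 j hj) h.symm
  by_cases h : b.IsPos i
  · simp only [h, true_iff]
    exact key i h
  · have := key _ ((isPos_negIdx b i).2 h)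
    rw [isPos_act_negIdx, coroot'_negIdx, neg_ne_zero] at this
    tauto

include hlam in
theorem w0Stab_mul_self : w0Stab b lam * w0Stab b lam = 1 := by
  apply eq_one_of_forall_isPos (b := b)
  intro i hi
  rw [act_mul, isPos_act_w0Stab_iff hlam, isPos_act_w0Stab_iff hlam, coroot'_act_w0Stab]
  tauto

include hlam in
theorem w0Stab_inv : (w0Stab b lam)⁻¹ = w0Stab b lam :=
  inv_eq_of_mul_eq_one_right (w0Stab_mul_self hlam)

include hlam in
theorem act_w0Stab_act (i : ι) : act (w0Stab b lam) (act (w0Stab b lam) i) = i := by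
  rw [← act_mul, w0Stab_mul_self hlam, act_one]

omit hlam in
variable (b lam) in
/-- `x` is the element of minimal length of its coset `x W_λ`: it keeps positive the positive
roots orthogonal to `λ`. -/
def IsMinCoset (x : P.weylGroup) : Prop :=
  ∀ i, b.IsPos i → P.coroot' i lam = 0 → b.IsPos (act x i)

omit [Finite ι] [P.IsRootSystem] [P.IsCrystallographic] [P.IsReduced] in
variable (b lam) in
theorem isMinCoset_one : IsMinCoset b lam 1 := fun i hi _ => by rwa [act_one]

include hlam in
/-- It suffices to test minimality in the coset on the simple roots. -/
theorem isMinCoset_of_simple {x : P.weylGroup}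
    (h : ∀ i ∈ b.support, P.coroot' i lam = 0 → b.IsPos (act x i)) : IsMinCoset b lam x := by
  intro i hi
  rw [← isPos_flip_iff] at hi
  suffices b.flip.IsPos i ∧ (P.coroot' i lam = 0 → b.flip.IsPos (act x i)) by
    simpa only [isPos_flip_iff] using this.2
  have hadd : ∀ i j k : ι, P.flip.root k = P.flip.root i + P.flip.root j → ∀ v : V,
      P.coroot' k v = P.coroot' i v + P.coroot' j v := by
    intro i j k hk v
    change P.coroot k = P.coroot i + P.coroot j at hk
    rw [RootPairing.coroot', hk]
    simp
  refine hi.induction_on_add (p := fun i => b.flip.IsPos i ∧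
    (P.coroot' i lam = 0 → b.flip.IsPos (act x i))) ?_ ?_
  · intro i hi
    refine ⟨RootPairing.Base.isPos_of_mem_support (b := b.flip) hi, ?_⟩
    rw [isPos_flip_iff]
    exact h i hi
  · intro i j k hk hi hj
    have hj' : b.flip.IsPos j := RootPairing.Base.isPos_of_mem_support (b := b.flip) hj
    refine ⟨hi.1.add hj' hk, fun h0 => ?_⟩
    rw [hadd i j k hk] at h0
    have h1 := hlam.2 i ((isPos_flip_iff b i).1 hi.1)
    have h2 := hlam.2 j ((isPos_flip_iff b j).1 hj')
    have h3 : b.flip.IsPos (act x j) := by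
      rw [isPos_flip_iff]
      exact h j hj (by linarith)
    refine (hi.2 (by linarith)).add h3 ?_
    change P.coroot (act x k) = P.coroot (act x i) + P.coroot (act x j)
    have hinj : Function.Injective P.toLinearMap.flip := P.flip.toPerfPair.injective
    apply hinj
    rw [map_add]
    refine LinearMap.ext fun v => ?_
    have h4 := hadd i j k hk (x⁻¹ • v)
    rw [coroot'_smul, coroot'_smul, coroot'_smul, inv_inv] at h4
    simpa using h4

include hlam in
/-- A Bruhat cover `x ⋖ x s_i` with `i` not orthogonal to `λ` preserves minimality in the
coset of `W_λ`. -/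
theorem IsMinCoset.mul_refl {x : P.weylGroup} (hx : IsMinCoset b lam x) {i : ι} (hi : b.IsPos i)
    (hlen : len b (x * refl P i) = len b x + 1) (h0 : P.coroot' i lam ≠ 0) :
    IsMinCoset b lam (x * refl P i) := by
  refine isMinCoset_of_simple hlam fun k hk hk0 => ?_
  by_contra hneg
  have hxi : b.IsPos (act x i) := isPos_act_of_lt hi (by omega)
  have h1 : x⁻¹ * refl P (act x i) = (x * refl P i)⁻¹ := by
    rw [refl_act, mul_inv_rev, refl_inv]
    group
  have h2 := act_eq_of_lifting (x := x⁻¹) hk hxi (by rw [h1, len_inv, len_inv, hlen])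
    (by rw [inv_inv]; exact hx k (RootPairing.Base.isPos_of_mem_support hk) hk0)
    (by rw [h1, inv_inv]; exact hneg)
  rw [act_inv_act] at h2
  exact h0 (h2 ▸ hk0)

omit hlam in
theorem IsMinCoset.refl_mul {x : P.weylGroup} (hx : IsMinCoset b lam x) {p : ι}
    (hp : p ∈ b.support)
    (h : ∀ i, b.IsPos i → P.coroot' i lam = 0 → act x i ≠ p) :
    IsMinCoset b lam (refl P p * x) := by
  intro i hi h0
  rw [act_mul]
  exact isPos_act_refl (hx i hi h0) hp (h i hi h0)

include hlam in
theorem IsMinCoset.len_w0_mul_mul_w0Stab {x : P.weylGroup} (hx : IsMinCoset b lam x) :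
    len b (w0 b * x * w0Stab b lam) + len b x
      = {i | b.IsPos i ∧ P.coroot' i lam ≠ 0}.ncard := by
  rw [len_eq_ncard_inversions, len_eq_ncard_inversions,
    ← Set.ncard_image_of_injective (inversions b (w0 b * x * w0Stab b lam))
      (P.weylGroupToPerm (w0Stab b lam)).injective, ← Set.ncard_union_eq]
  · congr 1
    ext i
    simp only [Set.mem_union, Set.mem_image, inversions, Set.mem_ofPred_eq]
    constructor
    · rintro (⟨j, ⟨h1, h2⟩, rfl⟩ | ⟨h1, h2⟩)
      · change b.IsPos (act (w0Stab b lam) j) ∧ P.coroot' (act (w0Stab b lam) j) lam ≠ 0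
        rw [coroot'_act_w0Stab]
        rw [act_mul, act_mul, isPos_act_w0, not_not] at h2
        have h3 : P.coroot' j lam ≠ 0 := by
          intro h0
          have h4 : b.IsPos (act (w0Stab b lam) (negIdx P j)) := by
            rw [isPos_act_negIdx]
            exact not_isPos_act_w0Stab h1 h0
          have h5 := hx _ h4 (by rw [coroot'_act_w0Stab, coroot'_negIdx, h0, neg_zero])
          rw [act_negIdx, isPos_act_negIdx] at h5
          exact h5 h2
        exact ⟨(isPos_act_w0Stab_iff hlam).2 (iff_of_true h1 h3), h3⟩
      · exact ⟨h1, fun h0 => h2 (hx i h1 h0)⟩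
    · rintro ⟨h1, h2⟩
      by_cases h3 : b.IsPos (act x i)
      · refine Or.inl ⟨act (w0Stab b lam) i, ⟨?_, ?_⟩, act_w0Stab_act hlam i⟩
        · exact (isPos_act_w0Stab_iff hlam).2 (iff_of_true h1 h2)
        · rw [act_mul, act_mul, act_w0Stab_act hlam, isPos_act_w0, not_not]
          exact h3
      · exact Or.inr ⟨h1, h3⟩
  · rw [Set.disjoint_left]
    rintro i ⟨j, ⟨h1, h2⟩, rfl⟩ ⟨h3, h4⟩
    rw [act_mul, act_mul, isPos_act_w0, not_not] at h2
    exact h4 h2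

include hlam in
theorem IsMinCoset.w0_mul_mul_w0Stab {x : P.weylGroup} (hx : IsMinCoset b lam x) :
    IsMinCoset b lam (w0 b * x * w0Stab b lam) := by
  intro i hi h0
  rw [act_mul, act_mul, isPos_act_w0]
  have h4 : b.IsPos (act (w0Stab b lam) (negIdx P i)) := by
    rw [isPos_act_negIdx]
    exact not_isPos_act_w0Stab hi h0
  have h5 := hx _ h4 (by rw [coroot'_act_w0Stab, coroot'_negIdx, h0, neg_zero])
  rwa [act_negIdx, isPos_act_negIdx] at h5

end Dominant

end

/-! ### Ordered products and initial segments -/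

section

section OrdProd

variable {I : Type*} [LinearOrder I] {G : Type*} [Monoid G]

theorem ordProd_empty (f : I → G) : ordProd f ∅ = 1 := by
  simp [ordProd]

theorem ordProd_insert (f : I → G) {a : I} {s : Finset I} (h : ∀ x ∈ s, x < a) :
    ordProd f (insert a s) = ordProd f s * f a := by
  have hsort : (insert a s).sort (· ≤ ·) = s.sort (· ≤ ·) ++ [a] := by
    apply List.Perm.eq_of_pairwise (le := (· ≤ ·))
    · exact fun x y _ _ h1 h2 => le_antisymm h1 h2
    · exact Finset.pairwise_sort _ _
    · rw [List.pairwise_append]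
      refine ⟨Finset.pairwise_sort _ _, by simp, ?_⟩
      intro x hx y hy
      rw [Finset.mem_sort] at hx
      rw [List.mem_singleton] at hy
      exact hy ▸ (h x hx).le
    · rw [List.perm_ext_iff_of_nodup]
      · intro x
        simp [or_comm]
      · exact Finset.sort_nodup _ _
      · rw [List.nodup_append]
        refine ⟨Finset.sort_nodup _ _, by simp, ?_⟩
        intro x hx y hy
        rw [Finset.mem_sort] at hx
        rw [List.mem_singleton] at hy
        exact hy ▸ (h x hx).ne
  simp [ordProd, hsort]

theorem ordProd_congr {f g : I → G} {s : Finset I} (h : ∀ x ∈ s, f x = g x) :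
    ordProd f s = ordProd g s := by
  unfold ordProd
  congr 1
  exact List.map_congr_left fun x hx => h x ((Finset.mem_sort _).1 hx)

end OrdProd

section Rank

variable {I : Type*} [LinearOrder I] [Fintype I]

/-- The number of elements smaller than `i`. -/
def rank (i : I) : ℕ := (Finset.univ.filter (· < i)).card

theorem rank_strictMono : StrictMono (rank : I → ℕ) := by
  intro i j hij
  apply Finset.card_lt_card
  rw [Finset.ssubset_iff_of_subset]
  · exact ⟨i, by simp [hij], by simp⟩
  · intro x hx
    simp only [Finset.mem_filter, Finset.mem_univ, true_and] at hx ⊢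
    exact hx.trans hij

theorem rank_lt_iff {i j : I} : rank i < rank j ↔ i < j := rank_strictMono.lt_iff_lt

theorem rank_inj {i j : I} : rank i = rank j ↔ i = j := rank_strictMono.injective.eq_iff

theorem rank_lt_card (i : I) : rank i < Fintype.card I := by
  rw [← Finset.card_univ]
  apply Finset.card_lt_card
  rw [Finset.ssubset_iff_of_subset (Finset.filter_subset _ _)]
  exact ⟨i, by simp, by simp⟩

theorem exists_rank_eq {m : ℕ} (hm : m < Fintype.card I) : ∃ i : I, rank i = m := by
  have h : Finset.univ.image (rank : I → ℕ) = Finset.range (Fintype.card I) := by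
    apply Finset.eq_of_subset_of_card_le
    · intro x hx
      rw [Finset.mem_image] at hx
      obtain ⟨i, -, rfl⟩ := hx
      exact Finset.mem_range.2 (rank_lt_card i)
    · rw [Finset.card_image_of_injective _ rank_strictMono.injective, Finset.card_range,
        Finset.card_univ]
  have : m ∈ Finset.univ.image (rank : I → ℕ) := by
    rw [h]
    exact Finset.mem_range.2 hm
  rw [Finset.mem_image] at this
  obtain ⟨i, -, hi⟩ := this
  exact ⟨i, hi⟩

/-- The elements of `J` among the first `m` elements of the index set. -/
def cut (J : Finset I) (m : ℕ) : Finset I := J.filter (rank · < m)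

theorem mem_cut {J : Finset I} {m : ℕ} {i : I} : i ∈ cut J m ↔ i ∈ J ∧ rank i < m := by
  simp [cut]

theorem cut_zero (J : Finset I) : cut J 0 = ∅ := by
  simp [cut]

theorem cut_rank (J : Finset I) (i : I) : cut J (rank i) = J.filter (· < i) := by
  ext x
  simp [mem_cut, rank_lt_iff]

theorem cut_rank_succ (J : Finset I) (i : I) : cut J (rank i + 1) = J.filter (· ≤ i) := by
  ext x
  simp [mem_cut, rank_strictMono.le_iff_le]

theorem cut_of_card_le (J : Finset I) {m : ℕ} (hm : Fintype.card I ≤ m) : cut J m = J := by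
  ext x
  simpa [mem_cut] using fun _ => (rank_lt_card x).trans_le hm

theorem cut_succ_of_mem {J : Finset I} {i : I} (hi : i ∈ J) :
    cut J (rank i + 1) = insert i (cut J (rank i)) := by
  ext x
  rw [Finset.mem_insert, mem_cut, mem_cut, Nat.lt_succ_iff_lt_or_eq, rank_inj]
  constructor
  · rintro ⟨h, h' | h'⟩
    · exact Or.inr ⟨h, h'⟩
    · exact Or.inl h'
  · rintro (rfl | ⟨h, h'⟩)
    · exact ⟨hi, Or.inr rfl⟩
    · exact ⟨h, Or.inl h'⟩

theorem cut_succ_of_notMem {J : Finset I} {i : I} (hi : i ∉ J) :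
    cut J (rank i + 1) = cut J (rank i) := by
  ext x
  rw [mem_cut, mem_cut, Nat.lt_succ_iff_lt_or_eq, rank_inj]
  constructor
  · rintro ⟨h, h' | h'⟩
    · exact ⟨h, h'⟩
    · exact absurd (h' ▸ h) hi
  · rintro ⟨h, h'⟩
    exact ⟨h, Or.inl h'⟩

variable {G : Type*} [Monoid G]

theorem ordProd_cut_succ_of_mem (f : I → G) {J : Finset I} {i : I} (hi : i ∈ J) :
    ordProd f (cut J (rank i + 1)) = ordProd f (cut J (rank i)) * f i := by
  rw [cut_succ_of_mem hi, ordProd_insert]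
  intro x hx
  exact rank_lt_iff.1 (mem_cut.1 hx).2

theorem ordProd_cut_succ_of_notMem (f : I → G) {J : Finset I} {i : I} (hi : i ∉ J) :
    ordProd f (cut J (rank i + 1)) = ordProd f (cut J (rank i)) := by
  rw [cut_succ_of_notMem hi]

end Rank

/-! ### The positions of the alcoves along a gallery -/

variable {ι V N : Type*} [AddCommGroup V] [Module ℝ V] [AddCommGroup N] [Module ℝ N]
  {P : RootPairing ι ℝ V N} {I : Type*}

open scoped Classical in
/-- The number of occurrences of the root `δ` among the members of the sequence `β` with index
in `s`. -/
noncomputable def cnt (β : I → ι) (s : Finset I) (δ : ι) : ℕ := (s.filter fun i => β i = δ).card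

/-- The address of the alcove reached from the fundamental alcove by crossing walls orthogonal to
the positive roots `β i`, `i ∈ s`, each of them in the direction of `-β i`: on this alcove the
coroot of `δ` takes its values between `addr b β s δ` and `addr b β s δ + 1`. -/
noncomputable def addr (b : P.Base) (β : I → ι) (s : Finset I) (δ : ι) : ℤ :=
  open scoped Classical in if b.IsPos δ then -(cnt β s δ : ℤ) else cnt β s (negIdx P δ) - 1

theorem cnt_empty (β : I → ι) (δ : ι) : cnt β ∅ δ = 0 := by
  simp [cnt]

open scoped Classical in
theorem cnt_insert [DecidableEq I] (β : I → ι) {s : Finset I} {i : I} (hi : i ∉ s) (δ : ι) :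
    cnt β (insert i s) δ = cnt β s δ + if β i = δ then 1 else 0 := by
  unfold cnt
  rw [Finset.filter_insert]
  split_ifs
  · rw [Finset.card_insert_of_notMem (by simp [hi])]
  · rfl

theorem addr_of_isPos {b : P.Base} {δ : ι} (h : b.IsPos δ) (β : I → ι) (s : Finset I) :
    addr b β s δ = -(cnt β s δ : ℤ) := by
  rw [addr, if_pos h]

theorem addr_of_not_isPos {b : P.Base} {δ : ι} (h : ¬ b.IsPos δ) (β : I → ι) (s : Finset I) :
    addr b β s δ = cnt β s (negIdx P δ) - 1 := by
  rw [addr, if_neg h]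

theorem addr_negIdx (b : P.Base) (β : I → ι) (s : Finset I) (δ : ι) :
    addr b β s (negIdx P δ) = -1 - addr b β s δ := by
  by_cases h : b.IsPos δ
  · rw [addr_of_isPos h, addr_of_not_isPos (by rwa [isPos_negIdx, not_not]), negIdx_negIdx]
    ring
  · rw [addr_of_not_isPos h, addr_of_isPos (by rwa [isPos_negIdx])]
    ring

open scoped Classical in
theorem addr_insert [DecidableEq I] {b : P.Base} {β : I → ι} {s : Finset I} {i : I} (hi : i ∉ s)
    (hpos : b.IsPos (β i)) (δ : ι) :
    addr b β (insert i s) δ = addr b β s δ - (if δ = β i then 1 else 0)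
      + (if δ = negIdx P (β i) then 1 else 0) := by
  by_cases h : b.IsPos δ
  · have h1 : δ ≠ negIdx P (β i) := by
      rintro rfl
      rw [isPos_negIdx] at h
      exact h hpos
    rw [addr_of_isPos h, addr_of_isPos h, cnt_insert β hi, if_neg h1]
    simp only [eq_comm (a := β i)]
    split_ifs <;> push_cast <;> ring
  · have h1 : δ ≠ β i := by
      rintro rfl
      exact h hpos
    have h2 : β i = negIdx P δ ↔ δ = negIdx P (β i) := by
      rw [← negIdx_inj (P := P), negIdx_negIdx, eq_comm]
    rw [addr_of_not_isPos h, addr_of_not_isPos h, cnt_insert β hi, if_neg h1]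
    simp only [h2]
    split_ifs <;> push_cast <;> ring

variable [LinearOrder I] [Fintype I]

theorem cnt_cut_rank (β : I → ι) (i : I) : cnt β (cut Finset.univ (rank i)) (β i) = lEmpty β i := by
  rw [cut_rank, cnt, lEmpty, Finset.filter_filter]

/-- The combinatorial properties of a `λ`-chain that are used below: its members are positive,
the reflection in the wall with index `i` exchanges the two alcoves adjacent to this wall, and
the gallery leads from the fundamental alcove to its translate by `-λ`. -/
structure IsGallery (b : P.Base) (lam : V) (β : I → ι) : Prop where
  isPos : ∀ i, b.IsPos (β i)
  step : ∀ i δ, (addr b β (cut Finset.univ (rank i + 1)) δ : ℝ)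
    = addr b β (cut Finset.univ (rank i)) (act (refl P (β i)) δ)
      - lEmpty β i * P.coroot' δ (P.root (β i))
  total : ∀ δ, b.IsPos δ → (cnt β Finset.univ δ : ℝ) = P.coroot' δ lam

section LambdaChain

variable [Finite ι] [P.IsRootSystem] [P.IsCrystallographic] [P.IsReduced] [P.IsIrreducible]

theorem coroot'_eq_height_mul (b : P.Base) {x : V} {c : ℝ}
    (h : ∀ i ∈ b.support, P.coroot' i x = c) (i : ι) :
    P.coroot' i x = b.flip.height i * c := by
  obtain ⟨f, -, -, hf⟩ := b.flip.exists_root_eq_sum_int i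
  rw [RootPairing.Base.height_eq_sum hf]
  change P.coroot i = ∑ j ∈ b.support, f j • P.coroot j at hf
  change _ = ((∑ j ∈ b.support, f j : ℤ) : ℝ) * c
  have : P.coroot' i x = ∑ j ∈ b.support, f j • P.coroot' j x := by
    simp only [RootPairing.coroot', hf, map_sum, map_zsmul, LinearMap.coe_sum, Finset.sum_apply,
      LinearMap.smul_apply]
  rw [this, Int.cast_sum, Finset.sum_mul]
  exact Finset.sum_congr rfl fun j hj => by rw [h j hj, zsmul_eq_mul]

theorem height_theta_le (b : P.Base) (i : ι) : b.flip.height i ≤ b.flip.height (theta b) :=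
  (exists_highestCoroot b).choose_spec i

theorem fundAlcove_nonempty (b : P.Base) : (fundAlcove b).Nonempty := by
  let c : ℝ := 1 / (b.flip.height (theta b) + 1)
  let f : N →ₗ[ℝ] ℝ := b.toCoweightBasis.constr ℝ fun _ => c
  obtain ⟨x, hx⟩ := P.toPerfPair.surjective f
  have hx' : ∀ n, P.toLinearMap x n = f n := fun n => by rw [← hx]; rfl
  have hsimple : ∀ i ∈ b.support, P.coroot' i x = c := by
    intro i hi
    change P.toLinearMap x (P.coroot i) = c
    rw [hx', ← RootPairing.Base.toCoweightBasis_apply b ⟨i, hi⟩]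
    exact b.toCoweightBasis.constr_basis ℝ _ _
  refine ⟨x, fun i hi => ?_⟩
  rw [coroot'_eq_height_mul b hsimple]
  rw [← isPos_flip_iff, RootPairing.Base.isPos_iff] at hi
  have h1 : (0 : ℝ) < b.flip.height i := by exact_mod_cast hi
  have h2 : (b.flip.height i : ℝ) ≤ b.flip.height (theta b) := by
    exact_mod_cast height_theta_le b i
  have h3 : (0 : ℝ) < b.flip.height (theta b) + 1 := by linarith
  constructor
  · positivity
  · rw [mul_one_div, div_lt_one h3]
    linarith

theorem isPos_theta (b : P.Base) : b.IsPos (theta b) := by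
  rw [← isPos_flip_iff, RootPairing.Base.isPos_iff]
  have h1 := height_theta_le b (negIdx P (theta b))
  have h2 : b.flip.height (negIdx P (theta b)) = -b.flip.height (theta b) :=
    b.flip.height_reflectionPerm_self (theta b)
  have h3 := b.flip.height_ne_zero (theta b)
  omega

end LambdaChain

end

/-! ### Chains of roots as galleries -/

section

variable {ι V N : Type*} [AddCommGroup V] [Module ℝ V] [AddCommGroup N] [Module ℝ N]
  {P : RootPairing ι ℝ V N} {I : Type*}

theorem coroot'_ordProd_sub [LinearOrder I] (r : I → ι) (k : I → ℤ) (j : ι) (x y : V) (J : Finset I) :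
    P.coroot' (act (ordProd (fun a => refl P (r a)) J) j)
        (ordProd (fun a => affRefl P (r a) (k a)) J x)
      - P.coroot' (act (ordProd (fun a => refl P (r a)) J) j)
        (ordProd (fun a => affRefl P (r a) (k a)) J y) = P.coroot' j x - P.coroot' j y :=
  coroot'_prod_sub r k j x y _

section LambdaChain

variable [Finite ι] [P.IsRootSystem] [P.IsCrystallographic] [P.IsReduced] [P.IsIrreducible]

theorem coroot_height_act_refl (b : P.Base) {i j : ι} {z : ℤ}
    (h : P.coroot' j (P.root i) = z) :
    b.flip.height (act (refl P i) j) = b.flip.height j - z * b.flip.height i := by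
  have h1 : P.flip.root (act (refl P i) j) = P.flip.root j + (-z) • P.flip.root i := by
    change P.coroot (act (refl P i) j) = P.coroot j + (-z) • P.coroot i
    rw [act_refl, ← P.reflectionPerm_coroot i j]
    change P.coroot j - (P.coroot' j (P.root i)) • P.coroot i = _
    rw [h, neg_smul, Int.cast_smul_eq_zsmul, sub_eq_add_neg]
  rw [b.flip.height_add_zsmul h1, smul_eq_mul]
  ring

theorem neg_height_theta_le (b : P.Base) (i : ι) :
    -b.flip.height (theta b) ≤ b.flip.height i := by
  have h1 := height_theta_le b (negIdx P i)
  have h2 : b.flip.height (negIdx P i) = -b.flip.height i := b.flip.height_reflectionPerm_self i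
  omega

theorem coroot'_root_eq_pairingIn (i j : ι) :
    P.coroot' j (P.root i) = ((P.pairingIn ℤ i j : ℤ) : ℝ) := by
  rw [RootPairing.root_coroot'_eq_pairing, ← P.algebraMap_pairingIn ℤ]
  simp

/-- `θ` is a dominant short root: its pairing with a positive coroot other than `θ^∨` is
`0` or `1`. -/
theorem pairingIn_theta (b : P.Base) {i : ι} (hi : b.IsPos i) (hne : i ≠ theta b) :
    P.pairingIn ℤ (theta b) i = 0 ∨ P.pairingIn ℤ (theta b) i = 1 := by
  have hti := coroot_height_act_refl b (coroot'_root_eq_pairingIn (P := P) (theta b) i)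
  have hit := coroot_height_act_refl b (coroot'_root_eq_pairingIn (P := P) i (theta b))
  have h1 : 0 < b.flip.height i := (isPos_flip_iff b i).2 hi
  have h2 : 0 < b.flip.height (theta b) := (isPos_flip_iff b _).2 (isPos_theta b)
  have h3 := height_theta_le b i
  have h4 := height_theta_le b (act (refl P i) (theta b))
  have h5 := neg_height_theta_le b (act (refl P (theta b)) i)
  have h6 := b.flip.height_ne_zero (act (refl P i) (theta b))
  -- heights of coroots do not exceed that of `θ^∨`; this excludes from the list of possible
  -- pairings of two roots all those with other values
  have h7 : 0 ≤ P.pairingIn ℤ i (theta b) := by nlinarith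
  have h8 := P.pairingIn_pairingIn_mem_set_of_isCrystal_of_isRed' (i := theta b) (j := i)
    (fun h => hne (P.root.injective h).symm) (fun h => by
      rw [RootPairing.root_eq_neg_iff] at h
      have := isPos_theta b
      rw [h] at this
      exact (isPos_negIdx b i).1 this hi)
  simp only [Set.mem_insert_iff, Set.mem_singleton_iff, Prod.mk.injEq] at h8
  rcases h8 with h | h | h | h | h | h | h | h | h | h | h
  all_goals first
    | exact Or.inl h.1
    | exact Or.inr h.1
    | (exfalso; omega)
    | (exfalso; rw [h.1] at hti; rw [h.2] at hit; apply h6; omega)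

/-- The level `k` of the affine reflection `s_{α,k}` that is the given generator. -/
def genLevel (b : P.Base) : Option b.support → ℤ
  | none => -1
  | some _ => 0

theorem affGen_eq (b : P.Base) (t : Option b.support) :
    affGen b t = affRefl P (genRoot b t) (genLevel b t) := by
  cases t <;> rfl

open scoped Classical in
theorem addr_empty (b : P.Base) (β : I → ι) (δ : ι) :
    addr b β ∅ δ = if b.IsPos δ then 0 else -1 := by
  simp [addr, cnt_empty]

theorem genLevel_eq (b : P.Base) (β : I → ι) (t : Option b.support) :
    genLevel b t = addr b β ∅ (genRoot b t) := by
  rw [addr_empty]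
  cases t with
  | none =>
    rw [genRoot, if_neg (by rw [isPos_negIdx, not_not]; exact isPos_theta b)]
    rfl
  | some i =>
    rw [genRoot, if_pos (RootPairing.Base.isPos_of_mem_support i.2)]
    rfl

open scoped Classical in
/-- A generator of the affine Weyl group exchanges the fundamental alcove with the adjacent
alcove beyond its wall. -/
theorem addr_act_genRoot (b : P.Base) (β : I → ι) (t : Option b.support) (δ : ι) :
    (addr b β ∅ δ : ℝ) - addr b β ∅ (act (refl P (genRoot b t)) δ)
      - genLevel b t * P.coroot' δ (P.root (genRoot b t))
      = (if δ = genRoot b t then 1 else 0) - (if δ = negIdx P (genRoot b t) then 1 else 0) := by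
  -- the identity is odd in `δ`, so that `δ` may be assumed positive
  wlog hδ : b.IsPos δ generalizing δ
  · have h := this (negIdx P δ) ((isPos_negIdx b δ).2 hδ)
    have h1 : negIdx P δ = genRoot b t ↔ δ = negIdx P (genRoot b t) := by
      rw [← negIdx_inj (P := P), negIdx_negIdx]
    rw [addr_negIdx, act_negIdx, addr_negIdx, coroot'_negIdx] at h
    simp only [h1, negIdx_inj] at h
    push_cast at h
    linarith
  cases t with
  | some p =>
    have hp : b.IsPos (p : ι) := RootPairing.Base.isPos_of_mem_support p.2
    have h1 : δ ≠ negIdx P p := by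
      rintro rfl
      exact (isPos_negIdx b _).1 hδ hp
    have e : genRoot b (some p) = p := rfl
    rw [e, if_neg h1, addr_empty, addr_empty, if_pos hδ]
    simp only [genLevel]
    by_cases h2 : δ = p
    · subst h2
      rw [act_refl_self, if_neg (by rw [isPos_negIdx, not_not]; exact hδ)]
      simp
    · rw [if_pos (isPos_act_refl hδ p.2 h2), if_neg h2]
      simp
  | none =>
    have h1 : δ ≠ negIdx P (theta b) := by
      rintro rfl
      exact (isPos_negIdx b _).1 hδ (isPos_theta b)
    have e : genRoot b none = negIdx P (theta b) := rfl
    rw [e, negIdx_negIdx, if_neg h1, refl_negIdx, addr_empty, addr_empty, if_pos hδ, root_negIdx,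
      map_neg]
    simp only [genLevel]
    by_cases h2 : δ = theta b
    · subst h2
      rw [act_refl_self, if_neg (by rw [isPos_negIdx, not_not]; exact hδ), coroot'_root_self]
      simp
      norm_num
    · rw [coroot'_root_eq_pairingIn, if_neg h2]
      have hht := coroot_height_act_refl b (coroot'_root_eq_pairingIn (P := P) (theta b) δ)
      have h3 : 0 < b.flip.height δ := (isPos_flip_iff b δ).2 hδ
      have h4 := height_theta_le b δ
      rcases pairingIn_theta b hδ h2 with h | h
      · rw [h] at hht ⊢
        have : b.IsPos (act (refl P (theta b)) δ) := by
          rw [← isPos_flip_iff, RootPairing.Base.isPos_iff]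
          omega
        rw [if_pos this]
        simp
      · rw [h] at hht ⊢
        have : ¬ b.IsPos (act (refl P (theta b)) δ) := by
          rw [← isPos_flip_iff, RootPairing.Base.isPos_iff]
          omega
        rw [if_neg this]
        simp

variable [LinearOrder I] [Fintype I]

/-- A `λ`-chain of roots has the properties of a gallery. -/
theorem IsLambdaChain.isGallery {b : P.Base} {lam : V} (hlam : IsDominantWeight b lam)
    {β : I → ι} (hβ : IsLambdaChain b lam β) : IsGallery b lam β := by
  classical
  obtain ⟨hpos, t, himg, -, hroot⟩ := hβ
  set r : I → ι := fun a => genRoot b (t a) with hr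
  set k : I → ℤ := fun a => genLevel b (t a) with hk
  set U : ℕ → P.weylGroup := fun m => ordProd (fun a => refl P (r a)) (cut Finset.univ m) with hU
  set A : ℕ → (V ≃ᵃ[ℝ] V) :=
    fun m => ordProd (fun a => affRefl P (r a) (k a)) (cut Finset.univ m) with hA
  have hroot' : ∀ i, β i = act (U (rank i)) (r i) := by
    intro i
    rw [hroot i, hU]
    simp only [cut_rank]
    rfl
  have hUsucc : ∀ i, U (rank i + 1) = U (rank i) * refl P (r i) := fun i =>
    ordProd_cut_succ_of_mem _ (Finset.mem_univ i)
  have hAsucc : ∀ i, A (rank i + 1) = A (rank i) * affRefl P (r i) (k i) := fun i =>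
    ordProd_cut_succ_of_mem _ (Finset.mem_univ i)
  have hdiff : ∀ m δ x, P.coroot' (act (U m) δ) (A m x)
      = P.coroot' (act (U m) δ) (A m 0) + P.coroot' δ x := by
    intro m δ x
    have := coroot'_ordProd_sub (P := P) r k δ x 0 (cut Finset.univ m)
    rw [map_zero (P.coroot' δ), sub_zero] at this
    simp only [hU, hA]
    linarith
  have haddr : ∀ i δ, (addr b β (cut Finset.univ (rank i + 1)) (act (U (rank i)) δ) : ℝ)
      = addr b β (cut Finset.univ (rank i)) (act (U (rank i)) δ)
        - (if δ = r i then 1 else 0) + (if δ = negIdx P (r i) then 1 else 0) := by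
    intro i δ
    rw [cut_succ_of_mem (Finset.mem_univ i), addr_insert (by simp [mem_cut]) (hpos i), hroot' i,
      ← act_negIdx]
    simp only [act_inj]
    push_cast
    rfl
  have hact2 : ∀ i δ, act (U (rank i + 1)) δ = act (U (rank i)) (act (refl P (r i)) δ) := by
    intro i δ
    rw [hUsucc, act_mul]
  -- the vertex `A m 0` of the alcove with number `m` determines the address of this alcove
  have hvertex : ∀ m ≤ Fintype.card I, ∀ δ, P.coroot' (act (U m) δ) (A m 0)
      = addr b β (cut Finset.univ m) (act (U m) δ) - addr b β ∅ δ := by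
    intro m
    induction m with
    | zero =>
      intro _ δ
      simp only [hU, hA, cut_zero, ordProd_empty, act_one, sub_self]
      exact map_zero _
    | succ m ih =>
      intro hm δ
      obtain ⟨i, rfl⟩ := exists_rank_eq (I := I) (m := m) (by omega)
      have h1 := addr_act_genRoot b β (t i) δ
      have h2 := haddr i (act (refl P (r i)) δ)
      have h3 := ih (by omega) (act (refl P (r i)) δ)
      have h4 : A (rank i + 1) 0 = A (rank i) (affRefl P (r i) (k i) 0) := by rw [hAsucc]; rfl
      have h5 : affRefl P (r i) (k i) 0 = (k i : ℝ) • P.root (r i) := by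
        rw [affRefl_apply, map_zero]
        simp
      have h6 : P.coroot' (act (refl P (r i)) δ) (P.root (r i)) = -P.coroot' δ (P.root (r i)) := by
        rw [act_refl, coroot'_reflectionPerm_apply, coroot'_root_self]
        ring
      have h7 : act (refl P (r i)) δ = r i ↔ δ = negIdx P (r i) := by
        rw [← act_inj (w := refl P (r i)), ← act_mul, refl_mul_self, act_one, act_refl_self]
      have h8 : act (refl P (r i)) δ = negIdx P (r i) ↔ δ = r i := by
        rw [← act_refl_self, act_inj]
      simp only [h7, h8] at h2
      rw [hact2, h4, hdiff, h3, h5, map_smul, smul_eq_mul, h6, h2]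
      change _ - _ - (k i : ℝ) * P.coroot' δ (P.root (r i)) = _ at h1
      linarith
  have hlevel : ∀ i, (addr b β (cut Finset.univ (rank i)) (β i) : ℝ) = -lEmpty β i := by
    intro i
    rw [addr_of_isPos (hpos i), cnt_cut_rank]
    push_cast
    rfl
  refine ⟨hpos, fun i δ => ?_, fun δ hδ => ?_⟩
  · obtain ⟨δ, rfl⟩ : ∃ ε, act (U (rank i)) ε = δ := ⟨act (U (rank i))⁻¹ δ, act_act_inv _ δ⟩
    have hi := (rank_lt_card i).le
    have h1 := addr_act_genRoot b β (t i) δ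
    have h2 := hvertex _ hi δ
    have h3 := hvertex _ hi (act (refl P (r i)) δ)
    have h4 := hvertex _ hi (r i)
    rw [← hroot', hlevel, ← genLevel_eq] at h4
    have h5 : act (refl P (β i)) (act (U (rank i)) δ) = act (U (rank i)) (act (refl P (r i)) δ) := by
      rw [← act_mul, ← act_mul, hroot', refl_act_mul]
    have h6 : P.coroot' (act (refl P (β i)) (act (U (rank i)) δ)) (A (rank i) 0)
        = P.coroot' (act (U (rank i)) δ) (A (rank i) 0)
          - P.coroot' (β i) (A (rank i) 0) * P.coroot' δ (P.root (r i)) := by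
      rw [act_refl, coroot'_reflectionPerm_apply]
      congr 2
      rw [hroot', coroot'_act_root_act]
    have h7 : P.coroot' (act (U (rank i)) δ) (P.root (β i)) = P.coroot' δ (P.root (r i)) := by
      rw [hroot', coroot'_act_root_act]
    rw [h5] at h6
    rw [haddr, h5, h7]
    rw [h3, h2, h4] at h6
    nlinarith
  · -- the image of a point of `A_∘` has an address given by the walls, and lies in `A_∘ - λ`
    obtain ⟨x, hx⟩ := fundAlcove_nonempty b
    have hword : affWord b t = A (Fintype.card I) := by
      rw [affWord, hA]
      simp only [cut_of_card_le _ le_rfl]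
      exact ordProd_congr fun a _ => affGen_eq b (t a)
    obtain ⟨y, hy, hxy⟩ : affWord b t x ∈ (fun x => x - lam) '' fundAlcove b := by
      rw [← himg]
      exact ⟨x, hx, rfl⟩
    have h1 := hvertex _ le_rfl (act (U (Fintype.card I))⁻¹ δ)
    have h2 := hdiff (Fintype.card I) (act (U (Fintype.card I))⁻¹ δ) x
    rw [act_act_inv, cut_of_card_le _ le_rfl, addr_of_isPos hδ] at h1
    rw [act_act_inv, ← hword, ← hxy, map_sub] at h2
    have h3 := hy δ hδ
    obtain ⟨z, hz⟩ := hlam.1 δ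
    rw [addr_empty] at h1
    rw [hword] at h2
    rw [hz] at h2 ⊢
    push_cast at h1
    have h4 : (cnt β Finset.univ δ : ℤ) = z := by
      by_cases h5 : b.IsPos (act (U (Fintype.card I))⁻¹ δ)
      · have h6 := hx _ h5
        rw [if_pos h5] at h1
        have h7 : ((cnt β Finset.univ δ : ℤ) : ℝ) < z + 1 := by push_cast; linarith
        have h8 : (z : ℝ) < (cnt β Finset.univ δ : ℤ) + 1 := by push_cast; linarith
        have h7' : (cnt β Finset.univ δ : ℤ) < z + 1 := by exact_mod_cast h7
        have h8' : z < (cnt β Finset.univ δ : ℤ) + 1 := by exact_mod_cast h8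
        omega
      · have h6 := hx _ ((isPos_negIdx b _).2 h5)
        rw [coroot'_negIdx] at h6
        rw [if_neg h5] at h1
        have h7 : ((cnt β Finset.univ δ : ℤ) : ℝ) < z + 1 := by push_cast; linarith
        have h8 : (z : ℝ) < (cnt β Finset.univ δ : ℤ) + 1 := by push_cast; linarith
        have h7' : (cnt β Finset.univ δ : ℤ) < z + 1 := by exact_mod_cast h7
        have h8' : z < (cnt β Finset.univ δ : ℤ) + 1 := by exact_mod_cast h8
        omega
    exact_mod_cast h4

end LambdaChain

end

/-! ### The reversed gallery -/

section

variable {ι V N : Type*} [AddCommGroup V] [Module ℝ V] [AddCommGroup N] [Module ℝ N]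
  {P : RootPairing ι ℝ V N} {q n : ℕ}

theorem rank_inl_lt (a : Fin q) : rank (Sum.inlₗ a : Fin q ⊕ₗ Fin n) < q := by
  have h : (Finset.univ.filter (· < (Sum.inlₗ a : Fin q ⊕ₗ Fin n)))
      ⊂ (Finset.univ : Finset (Fin q)).image Sum.inlₗ := by
    rw [Finset.ssubset_iff_of_subset]
    · exact ⟨Sum.inlₗ a, by simp, by simp⟩
    · intro x hx
      rw [Finset.mem_filter] at hx
      rcases x with x | x
      · exact Finset.mem_image_of_mem _ (Finset.mem_univ _)
      · exact absurd hx.2 Sum.Lex.not_inr_lt_inl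
  have h1 := Finset.card_lt_card h
  have h2 := Finset.card_image_le (s := (Finset.univ : Finset (Fin q)))
    (f := (Sum.inlₗ : Fin q → Fin q ⊕ₗ Fin n))
  rw [Finset.card_univ, Fintype.card_fin] at h2
  exact h1.trans_le h2

theorem le_rank_inr (j : Fin n) : q ≤ rank (Sum.inrₗ j : Fin q ⊕ₗ Fin n) := by
  have h : (Finset.univ : Finset (Fin q)).image Sum.inlₗ
      ⊆ (Finset.univ.filter (· < (Sum.inrₗ j : Fin q ⊕ₗ Fin n))) := by
    intro x hx
    rw [Finset.mem_image] at hx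
    obtain ⟨a, -, rfl⟩ := hx
    rw [Finset.mem_filter]
    exact ⟨Finset.mem_univ _, Sum.Lex.inl_lt_inr _ _⟩
  have h1 := Finset.card_le_card h
  rw [Finset.card_image_of_injective (f := (Sum.inlₗ : Fin q → Fin q ⊕ₗ Fin n)) _
    (fun _ _ h => Sum.inl_injective h), Finset.card_univ,
    Fintype.card_fin] at h1
  exact h1

theorem forall_lex {p : Fin q ⊕ₗ Fin n → Prop} (h1 : ∀ a, p (Sum.inlₗ a))
    (h2 : ∀ j, p (Sum.inrₗ j)) (i : Fin q ⊕ₗ Fin n) : p i := by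
  rcases i with a | j
  · exact h1 a
  · exact h2 j

theorem rank_lt_iff_exists_inl {i : Fin q ⊕ₗ Fin n} :
    rank i < q ↔ ∃ a : Fin q, i = Sum.inlₗ a := by
  induction i using forall_lex with
  | h1 a => exact iff_of_true (rank_inl_lt a) ⟨a, rfl⟩
  | h2 j =>
    refine iff_of_false (not_lt.2 (le_rank_inr j)) ?_
    rintro ⟨a, ha⟩
    exact absurd ha Sum.inr_ne_inl

open scoped Classical in
theorem cnt_eq_sum (β : Fin q ⊕ₗ Fin n → ι) (s : Finset (Fin q ⊕ₗ Fin n)) (δ : ι) :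
    cnt β s δ = (∑ a : Fin q, if Sum.inlₗ a ∈ s ∧ β (Sum.inlₗ a) = δ then 1 else 0)
      + ∑ j : Fin n, if Sum.inrₗ j ∈ s ∧ β (Sum.inrₗ j) = δ then 1 else 0 := by
  have h : s.filter (fun i => β i = δ) = Finset.univ.filter fun i => i ∈ s ∧ β i = δ := by
    ext i
    simp
  rw [cnt, h, Finset.card_filter]
  exact Fintype.sum_sum_type _

variable [Finite ι] [P.IsRootSystem]

theorem revChain_inl (b : P.Base) (lam : V) (β : Fin q ⊕ₗ Fin n → ι) (a : Fin q) :
    revChain b lam β (Sum.inlₗ a) = β (Sum.inlₗ a) := rfl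

theorem revChain_inr (b : P.Base) (lam : V) (β : Fin q ⊕ₗ Fin n → ι) (j : Fin n) :
    revChain b lam β (Sum.inrₗ j) = act (w0Stab b lam) (β (Sum.inrₗ j.rev)) := rfl

variable [P.IsCrystallographic] [P.IsReduced]
  {b : P.Base} {lam : V} {β : Fin q ⊕ₗ Fin n → ι}

theorem cnt_le_total {I : Type*} (β : I → ι) [Fintype I] (s : Finset I) (δ : ι) :
    cnt β s δ ≤ cnt β Finset.univ δ := by
  classical
  exact Finset.card_le_card (Finset.filter_subset_filter _ (Finset.subset_univ s))

theorem IsGallery.cnt_eq_zero {I : Type*} [LinearOrder I] [Fintype I] {β : I → ι}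
    (hβ : IsGallery b lam β) (s : Finset I) {δ : ι} (h : b.IsPos δ → P.coroot' δ lam = 0) :
    cnt β s δ = 0 := by
  classical
  by_cases hδ : b.IsPos δ
  · have h1 := hβ.total δ hδ
    rw [h hδ] at h1
    have h2 := cnt_le_total β s δ
    have h3 : cnt β Finset.univ δ = 0 := by exact_mod_cast h1
    omega
  · rw [cnt, Finset.card_eq_zero, Finset.filter_eq_empty_iff]
    intro i _ hi
    exact hδ (hi ▸ hβ.isPos i)

theorem IsGallery.coroot'_ne_zero {I : Type*} [LinearOrder I] [Fintype I] {β : I → ι}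
    (hβ : IsGallery b lam β) (i : I) : P.coroot' (β i) lam ≠ 0 := by
  classical
  intro h
  have h1 := hβ.cnt_eq_zero Finset.univ (δ := β i) fun _ => h
  rw [cnt, Finset.card_eq_zero, Finset.filter_eq_empty_iff] at h1
  exact h1 (Finset.mem_univ i) rfl

/-- Each positive root that is not orthogonal to `λ` occurs once in the initial segment. -/
theorem IsGallery.cnt_initial (hβ : IsGallery b lam β)
    (hI : ∀ i, lEmpty β i = 0 ↔ ∃ a : Fin q, i = Sum.inlₗ a) {δ : ι} (hδ : b.IsPos δ)
    (h0 : P.coroot' δ lam ≠ 0) : cnt β (cut Finset.univ q) δ = 1 := by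
  classical
  have hne : (Finset.univ.filter fun i => β i = δ).Nonempty := by
    rw [Finset.nonempty_iff_ne_empty]
    intro h
    apply h0
    rw [← hβ.total δ hδ, cnt]
    simp only [Nat.cast_eq_zero, Finset.card_eq_zero]
    convert h
  set x := (Finset.univ.filter fun i => β i = δ).min' hne with hx
  have hxm := Finset.min'_mem _ hne
  rw [← hx, Finset.mem_filter] at hxm
  have hx0 : lEmpty β x = 0 := by
    rw [lEmpty, Finset.card_eq_zero, Finset.filter_eq_empty_iff]
    rintro y - ⟨h1, h2⟩
    have := Finset.min'_le (Finset.univ.filter fun i => β i = δ) y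
      (Finset.mem_filter.2 ⟨Finset.mem_univ _, h2.trans hxm.2⟩)
    exact absurd h1 (not_lt.2 (hx ▸ this))
  rw [cnt, Finset.card_eq_one]
  refine ⟨x, Finset.eq_singleton_iff_unique_mem.2 ⟨?_, fun y hy => ?_⟩⟩
  · rw [Finset.mem_filter, mem_cut, rank_lt_iff_exists_inl]
    exact ⟨⟨Finset.mem_univ _, (hI x).1 hx0⟩, hxm.2⟩
  · rw [Finset.mem_filter, mem_cut, rank_lt_iff_exists_inl] at hy
    have hy0 := (hI y).2 hy.1.2
    rw [lEmpty, Finset.card_eq_zero, Finset.filter_eq_empty_iff] at hy0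
    have h1 : ¬ x < y := fun h => hy0 (Finset.mem_univ x) ⟨h, hxm.2.trans hy.2.symm⟩
    have h2 := Finset.min'_le (Finset.univ.filter fun i => β i = δ) y
      (Finset.mem_filter.2 ⟨Finset.mem_univ _, hy.2⟩)
    exact le_antisymm (not_lt.1 h1) (hx ▸ h2)

theorem act_w0Stab_eq_iff (hlam : IsDominantWeight b lam) {i j : ι} :
    act (w0Stab b lam) i = j ↔ i = act (w0Stab b lam) j := by
  rw [← act_inj (w := w0Stab b lam), act_w0Stab_act hlam]

theorem cnt_initial_eq_sum (β : Fin q ⊕ₗ Fin n → ι) (δ : ι) : cnt β (cut Finset.univ q) δ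
    = open scoped Classical in ∑ a : Fin q, if β (Sum.inlₗ a) = δ then 1 else 0 := by
  classical
  rw [cnt_eq_sum]
  simp only [mem_cut, Finset.mem_univ, true_and, rank_inl_lt, not_lt.2 (le_rank_inr _), false_and,
    if_false, Finset.sum_const_zero, add_zero]

theorem inl_mem_cut_inr (a : Fin q) (j : Fin n) (m : ℕ)
    (hm : rank (Sum.inrₗ j : Fin q ⊕ₗ Fin n) ≤ m) :
    (Sum.inlₗ a : Fin q ⊕ₗ Fin n) ∈ cut Finset.univ m := by
  rw [mem_cut]
  exact ⟨Finset.mem_univ _, (rank_lt_iff.2 (Sum.Lex.inl_lt_inr a j)).trans_le hm⟩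

theorem inr_mem_cut (j j' : Fin n) :
    (Sum.inrₗ j : Fin q ⊕ₗ Fin n) ∈ cut Finset.univ (rank (Sum.inrₗ j' : Fin q ⊕ₗ Fin n))
      ↔ j < j' := by
  rw [mem_cut, rank_lt_iff]
  simp

theorem inr_mem_cut_succ (j j' : Fin n) :
    (Sum.inrₗ j : Fin q ⊕ₗ Fin n) ∈ cut Finset.univ (rank (Sum.inrₗ j' : Fin q ⊕ₗ Fin n) + 1)
      ↔ j ≤ j' := by
  rw [mem_cut, Nat.lt_succ_iff, rank_strictMono.le_iff_le]
  simp

theorem cnt_revChain (hlam : IsDominantWeight b lam) (j : Fin n) (δ : ι) :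
    cnt (revChain b lam β) (cut Finset.univ (rank (Sum.inrₗ j : Fin q ⊕ₗ Fin n))) δ
      + cnt β (cut Finset.univ (rank (Sum.inrₗ j.rev : Fin q ⊕ₗ Fin n) + 1))
        (act (w0Stab b lam) δ)
    = cnt β (cut Finset.univ q) δ + cnt β Finset.univ (act (w0Stab b lam) δ) := by
  classical
  have hinl : ∀ a, (Sum.inlₗ a : Fin q ⊕ₗ Fin n)
      ∈ cut Finset.univ (rank (Sum.inrₗ j : Fin q ⊕ₗ Fin n)) :=
    fun a => inl_mem_cut_inr a j _ le_rfl
  have hinl' : ∀ a, (Sum.inlₗ a : Fin q ⊕ₗ Fin n)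
      ∈ cut Finset.univ (rank (Sum.inrₗ j.rev : Fin q ⊕ₗ Fin n) + 1) :=
    fun a => inl_mem_cut_inr a j.rev _ (Nat.le_succ _)
  rw [cnt_initial_eq_sum, cnt_eq_sum, cnt_eq_sum, cnt_eq_sum]
  simp only [inr_mem_cut, inr_mem_cut_succ, hinl, hinl', true_and, revChain_inl, revChain_inr,
    Finset.mem_univ, act_w0Stab_eq_iff hlam]
  rw [← Equiv.sum_comp Fin.revPerm fun j' : Fin n => if j' < j ∧
    β (Sum.inrₗ j'.rev) = act (w0Stab b lam) δ then 1 else 0]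
  simp only [Fin.revPerm_apply, Fin.rev_rev]
  have : (∑ j' : Fin n, if β (Sum.inrₗ j') = act (w0Stab b lam) δ then 1 else 0)
      = (∑ j' : Fin n, if j'.rev < j ∧ β (Sum.inrₗ j') = act (w0Stab b lam) δ then 1 else 0)
        + ∑ j' : Fin n, if j' ≤ j.rev ∧ β (Sum.inrₗ j') = act (w0Stab b lam) δ then 1 else 0 := by
    rw [← Finset.sum_add_distrib]
    refine Finset.sum_congr rfl fun j' _ => ?_
    have h1 : j'.rev < j ↔ ¬ j' ≤ j.rev := by
      rw [not_le, Fin.rev_lt_iff]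
    simp only [h1]
    split_ifs <;> first | rfl | (exfalso; tauto)
  rw [this]
  omega

theorem cnt_revChain_succ (hlam : IsDominantWeight b lam) (j : Fin n) (δ : ι) :
    cnt (revChain b lam β) (cut Finset.univ (rank (Sum.inrₗ j : Fin q ⊕ₗ Fin n) + 1)) δ
      + cnt β (cut Finset.univ (rank (Sum.inrₗ j.rev : Fin q ⊕ₗ Fin n)))
        (act (w0Stab b lam) δ)
    = cnt β (cut Finset.univ q) δ + cnt β Finset.univ (act (w0Stab b lam) δ) := by
  classical
  have h := cnt_revChain (β := β) hlam j δ
  have h1 : cnt (revChain b lam β) (cut Finset.univ (rank (Sum.inrₗ j : Fin q ⊕ₗ Fin n) + 1)) δ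
      = cnt (revChain b lam β) (cut Finset.univ (rank (Sum.inrₗ j : Fin q ⊕ₗ Fin n))) δ
        + if revChain b lam β (Sum.inrₗ j) = δ then 1 else 0 := by
    rw [cut_succ_of_mem (Finset.mem_univ _), cnt_insert _ (by simp [mem_cut])]
  have h2 : cnt β (cut Finset.univ (rank (Sum.inrₗ j.rev : Fin q ⊕ₗ Fin n) + 1))
        (act (w0Stab b lam) δ)
      = cnt β (cut Finset.univ (rank (Sum.inrₗ j.rev : Fin q ⊕ₗ Fin n))) (act (w0Stab b lam) δ)
        + if β (Sum.inrₗ j.rev) = act (w0Stab b lam) δ then 1 else 0 := by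
    rw [cut_succ_of_mem (Finset.mem_univ _), cnt_insert _ (by simp [mem_cut])]
  rw [revChain_inr, act_w0Stab_eq_iff hlam] at h1
  omega

theorem cnt_revChain_univ (hlam : IsDominantWeight b lam) (δ : ι) :
    cnt (revChain b lam β) Finset.univ δ + cnt β (cut Finset.univ q) (act (w0Stab b lam) δ)
    = cnt β (cut Finset.univ q) δ + cnt β Finset.univ (act (w0Stab b lam) δ) := by
  classical
  rw [cnt_initial_eq_sum, cnt_initial_eq_sum, cnt_eq_sum, cnt_eq_sum]
  simp only [true_and, revChain_inl, revChain_inr, Finset.mem_univ, act_w0Stab_eq_iff hlam]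
  rw [← Equiv.sum_comp Fin.revPerm fun j' : Fin n => if
    β (Sum.inrₗ j'.rev) = act (w0Stab b lam) δ then 1 else 0]
  simp only [Fin.revPerm_apply, Fin.rev_rev]
  omega

theorem cnt_revChain_initial {m : ℕ} (hm : m ≤ q) (δ : ι) :
    cnt (revChain b lam β) (cut Finset.univ m) δ = cnt β (cut Finset.univ m) δ := by
  classical
  unfold cnt
  congr 1
  refine Finset.filter_congr fun i hi => ?_
  rw [mem_cut] at hi
  obtain ⟨a, rfl⟩ := rank_lt_iff_exists_inl.1 (hi.2.trans_le hm)
  rw [revChain_inl]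

/-- The address of an alcove of the reversed gallery, in terms of the alcove of the original
gallery whose image under `x ↦ -w_∘^λ(x + λ)` it is. -/
theorem IsGallery.addr_revChain_of_cnt (hlam : IsDominantWeight b lam) (hβ : IsGallery b lam β)
    (hI : ∀ i, lEmpty β i = 0 ↔ ∃ a : Fin q, i = Sum.inlₗ a) {s s' : Finset (Fin q ⊕ₗ Fin n)}
    (h : ∀ δ, cnt (revChain b lam β) s δ + cnt β s' (act (w0Stab b lam) δ)
      = cnt β (cut Finset.univ q) δ + cnt β Finset.univ (act (w0Stab b lam) δ)) (δ : ι) :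
    (addr b (revChain b lam β) s δ : ℝ)
      = -1 - P.coroot' δ lam - addr b β s' (act (w0Stab b lam) δ) := by
  wlog hδ : b.IsPos δ generalizing δ
  · have h1 := this (negIdx P δ) ((isPos_negIdx b δ).2 hδ)
    rw [addr_negIdx, act_negIdx, addr_negIdx, coroot'_negIdx] at h1
    push_cast at h1
    linarith
  have h1 := h δ
  rw [addr_of_isPos hδ]
  by_cases h0 : P.coroot' δ lam = 0
  · have h2 : ¬ b.IsPos (act (w0Stab b lam) δ) := not_isPos_act_w0Stab hδ h0
    rw [hβ.cnt_eq_zero _ fun _ => h0, hβ.cnt_eq_zero Finset.univ fun h => absurd h h2] at h1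
    rw [addr_of_not_isPos h2, hβ.cnt_eq_zero (δ := negIdx P (act (w0Stab b lam) δ)) s' fun _ => by
      rw [coroot'_negIdx, coroot'_act_w0Stab, h0, neg_zero]]
    have h3 : cnt (revChain b lam β) s δ = 0 := by omega
    rw [h3, h0]
    norm_num
  · have h2 : b.IsPos (act (w0Stab b lam) δ) := (isPos_act_w0Stab_iff hlam).2 (iff_of_true hδ h0)
    have h3 := hβ.total _ h2
    rw [coroot'_act_w0Stab] at h3
    rw [hβ.cnt_initial hI hδ h0] at h1
    have h4 : (cnt (revChain b lam β) s δ : ℝ) + cnt β s' (act (w0Stab b lam) δ)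
      = 1 + cnt β Finset.univ (act (w0Stab b lam) δ) := by exact_mod_cast h1
    rw [addr_of_isPos h2, ← h3]
    push_cast
    linarith

theorem lEmpty_revChain_inl (a : Fin q) :
    lEmpty (revChain b lam β) (Sum.inlₗ a) = lEmpty β (Sum.inlₗ a) := by
  rw [← cnt_cut_rank, ← cnt_cut_rank, revChain_inl, cnt_revChain_initial (rank_inl_lt a).le]

theorem IsGallery.lEmpty_revChain_inr (hlam : IsDominantWeight b lam) (hβ : IsGallery b lam β)
    (hI : ∀ i, lEmpty β i = 0 ↔ ∃ a : Fin q, i = Sum.inlₗ a) (j : Fin n) :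
    (lEmpty (revChain b lam β) (Sum.inrₗ j) : ℝ)
      = P.coroot' (β (Sum.inrₗ j.rev)) lam - lEmpty β (Sum.inrₗ j.rev) := by
  classical
  have h := cnt_revChain (β := β) hlam j (revChain b lam β (Sum.inrₗ j))
  rw [cnt_cut_rank, revChain_inr, act_w0Stab_act hlam, cut_succ_of_mem (Finset.mem_univ _),
    cnt_insert _ (by simp [mem_cut]), cnt_cut_rank, if_pos rfl] at h
  have h0 := hβ.coroot'_ne_zero (Sum.inrₗ j.rev)
  rw [hβ.cnt_initial hI ((isPos_act_w0Stab_iff hlam).2 (iff_of_true (hβ.isPos _) h0))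
    (by rwa [coroot'_act_w0Stab])] at h
  rw [← hβ.total _ (hβ.isPos _)]
  have h2 : (lEmpty (revChain b lam β) (Sum.inrₗ j) : ℝ) + (lEmpty β (Sum.inrₗ j.rev) + 1)
    = 1 + cnt β Finset.univ (β (Sum.inrₗ j.rev)) := by exact_mod_cast h
  linarith

theorem IsGallery.isGallery_revChain (hlam : IsDominantWeight b lam) (hβ : IsGallery b lam β)
    (hI : ∀ i, lEmpty β i = 0 ↔ ∃ a : Fin q, i = Sum.inlₗ a) :
    IsGallery b lam (revChain b lam β) := by
  refine ⟨fun i => ?_, fun i δ => ?_, fun δ hδ => ?_⟩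
  · induction i using forall_lex with
    | h1 a => exact hβ.isPos _
    | h2 j => exact (isPos_act_w0Stab_iff hlam).2 (iff_of_true (hβ.isPos _) (hβ.coroot'_ne_zero _))
  · induction i using forall_lex with
    | h1 a =>
      have h := hβ.step (Sum.inlₗ a) δ
      have h1 : ∀ m ≤ q, ∀ ε, addr b (revChain b lam β) (cut Finset.univ m) ε
          = addr b β (cut Finset.univ m) ε := by
        intro m hm ε
        simp only [addr, cnt_revChain_initial hm]
      rw [h1 _ (rank_inl_lt a).le, h1 _ (rank_inl_lt a), revChain_inl, lEmpty_revChain_inl]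
      exact h
    | h2 j =>
      have h := hβ.step (Sum.inrₗ j.rev) (act (refl P (β (Sum.inrₗ j.rev))) (act (w0Stab b lam) δ))
      rw [← act_mul (refl P _) (refl P _), refl_mul_self, act_one] at h
      have h1 : act (refl P (β (Sum.inrₗ j.rev))) (act (w0Stab b lam) δ)
          = act (w0Stab b lam) (act (refl P (revChain b lam β (Sum.inrₗ j))) δ) := by
        rw [← act_mul, ← act_mul, revChain_inr, refl_act, w0Stab_inv hlam, ← mul_assoc,
          ← mul_assoc, w0Stab_mul_self hlam, one_mul]
      have h2 : P.coroot' (act (refl P (β (Sum.inrₗ j.rev))) (act (w0Stab b lam) δ))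
          (P.root (β (Sum.inrₗ j.rev))) = -P.coroot' δ (P.root (revChain b lam β (Sum.inrₗ j))) := by
        rw [revChain_inr, act_refl, coroot'_reflectionPerm_apply, coroot'_root_self,
          ← coroot'_act_root_act (w0Stab b lam) δ, act_w0Stab_act hlam]
        ring
      have h3 : P.coroot' (act (refl P (revChain b lam β (Sum.inrₗ j))) δ) lam
          = P.coroot' δ lam - P.coroot' (β (Sum.inrₗ j.rev)) lam
            * P.coroot' δ (P.root (revChain b lam β (Sum.inrₗ j))) := by
        rw [act_refl, coroot'_reflectionPerm_apply, revChain_inr, coroot'_act_w0Stab]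
      rw [h2, h1] at h
      rw [hβ.addr_revChain_of_cnt hlam hI (cnt_revChain_succ hlam j),
        hβ.addr_revChain_of_cnt hlam hI (cnt_revChain hlam j), h,
        hβ.lEmpty_revChain_inr hlam hI, h3]
      ring
  · have h := cnt_revChain_univ (β := β) hlam δ
    by_cases h0 : P.coroot' δ lam = 0
    · have h2 : ¬ b.IsPos (act (w0Stab b lam) δ) := not_isPos_act_w0Stab hδ h0
      rw [hβ.cnt_eq_zero _ fun _ => h0, hβ.cnt_eq_zero Finset.univ fun h => absurd h h2] at h
      rw [h0]
      norm_cast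
      omega
    · have h2 : b.IsPos (act (w0Stab b lam) δ) := (isPos_act_w0Stab_iff hlam).2 (iff_of_true hδ h0)
      rw [hβ.cnt_initial hI hδ h0, hβ.cnt_initial hI h2 (by rwa [coroot'_act_w0Stab])] at h
      rw [← coroot'_act_w0Stab b lam, ← hβ.total _ h2]
      norm_cast
      omega

end

/-! ### Walks with signs -/

section

/-- The data of a folded gallery that matter for the operators `F_p` and `E_p`. The gallery
meets the hyperplanes orthogonal to `α_p` at the times in `X`, and at these times it is folded
if the time is in `D`, and crosses the hyperplane otherwise. `S` says that the gallery is heading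
for larger levels, and `B` records the position between the hyperplanes. -/
structure SignedWalk (n : ℕ) (S D X : ℕ → Prop) (B : ℕ → ℝ) : Prop where
  sign_zero : S 0
  pos_zero : B 0 = 0
  pos_stay : ∀ k < n, ¬ X k → B (k + 1) = B k
  sign_stay : ∀ k < n, ¬ X k → S k → S (k + 1)
  sign_cross : ∀ k < n, X k → ¬ D k → (S (k + 1) ↔ S k)
  pos_up : ∀ k < n, X k → ¬ D k → S k → B (k + 1) = B k + 1
  pos_down : ∀ k < n, X k → ¬ D k → ¬ S k → B (k + 1) = B k - 1
  sign_fold : ∀ k < n, X k → D k → S k ∧ ¬ S (k + 1)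
  pos_fold : ∀ k < n, X k → D k → B (k + 1) = B k

namespace SignedWalk

open scoped Classical in
/-- The level of the hyperplane that the walk meets at the given time. -/
noncomputable def lev (S : ℕ → Prop) (B : ℕ → ℝ) (k : ℕ) : ℝ := if S k then B k else B k - 1

theorem lev_of_pos {S : ℕ → Prop} {B : ℕ → ℝ} {k : ℕ} (h : S k) : lev S B k = B k := if_pos h

theorem lev_of_neg {S : ℕ → Prop} {B : ℕ → ℝ} {k : ℕ} (h : ¬ S k) : lev S B k = B k - 1 :=
  if_neg h

theorem lev_le (S : ℕ → Prop) (B : ℕ → ℝ) (k : ℕ) : lev S B k ≤ B k := by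
  unfold lev
  split_ifs <;> linarith

theorem le_lev (S : ℕ → Prop) (B : ℕ → ℝ) (k : ℕ) : B k - 1 ≤ lev S B k := by
  unfold lev
  split_ifs <;> linarith

variable {n : ℕ} {S D X : ℕ → Prop} {B : ℕ → ℝ} (h : SignedWalk n S D X B)
include h

theorem pos_eq {i j : ℕ} (hij : i ≤ j) (hj : j ≤ n) (hX : ∀ k, i ≤ k → k < j → ¬ X k) :
    B j = B i := by
  induction j, hij using Nat.le_induction with
  | base => rfl
  | succ j hij ih =>
    rw [h.pos_stay j (by omega) (hX j hij (by omega)),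
      ih (by omega) fun k h1 h2 => hX k h1 (by omega)]

theorem sign_of_sign {i j : ℕ} (hij : i ≤ j) (hj : j ≤ n) (hX : ∀ k, i ≤ k → k < j → ¬ X k)
    (hi : S i) : S j := by
  induction j, hij using Nat.le_induction with
  | base => exact hi
  | succ j hij ih =>
    exact h.sign_stay j (by omega) (hX j hij (by omega))
      (ih (by omega) fun k h1 h2 => hX k h1 (by omega))

/-- If the walk is heading down at a time `j`, then it met a hyperplane before, and the level
of the last one was at least the present position. -/
theorem exists_pred_of_neg {j : ℕ} (hj : j ≤ n) (hS : ¬ S j) :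
    ∃ k < j, X k ∧ B j ≤ lev S B k := by
  have hex : ∃ k, k < j ∧ X k := by
    by_contra hne
    push Not at hne
    exact hS (h.sign_of_sign (Nat.zero_le j) hj (fun k _ hk => hne k hk) h.sign_zero)
  obtain ⟨k, ⟨hkj, hk⟩, hmax⟩ : ∃ k, (k < j ∧ X k) ∧ ∀ k', (k' < j ∧ X k') → k' ≤ k := by
    classical
    obtain ⟨k0, hk0⟩ := hex
    exact ⟨Nat.findGreatest (fun k => k < j ∧ X k) j,
      Nat.findGreatest_spec (P := fun k => k < j ∧ X k) hk0.1.le hk0,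
      fun k' hk' => Nat.le_findGreatest hk'.1.le hk'⟩
  have hX : ∀ i, k + 1 ≤ i → i < j → ¬ X i := fun i h1 h2 h3 => by
    have := hmax i ⟨h2, h3⟩
    omega
  have hB := h.pos_eq hkj hj hX
  refine ⟨k, hkj, hk, ?_⟩
  by_cases hD : D k
  · rw [lev_of_pos (h.sign_fold k (by omega) hk hD).1, hB, h.pos_fold k (by omega) hk hD]
  · have h1 : ¬ S k := fun h1 => hS (h.sign_of_sign hkj hj hX
      ((h.sign_cross k (by omega) hk hD).2 h1))
    rw [lev_of_neg h1, hB, h.pos_down k (by omega) hk hD h1]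

omit h in
theorem exists_last {p : ℕ → Prop} {m : ℕ} (hex : ∃ k < m, p k) :
    ∃ k < m, p k ∧ ∀ k', k < k' → k' < m → ¬ p k' := by
  classical
  obtain ⟨k0, hk0, hk0'⟩ := hex
  have hs := Nat.findGreatest_spec (P := fun k => k < m ∧ p k) hk0.le ⟨hk0, hk0'⟩
  refine ⟨Nat.findGreatest (fun k => k < m ∧ p k) m, hs.1, hs.2, fun k' h1 h2 h3 => ?_⟩
  have := Nat.le_findGreatest (P := fun k => k < m ∧ p k) h2.le ⟨h2, h3⟩
  omega

omit h in
theorem exists_next {p : ℕ → Prop} {k n : ℕ} (hk : k < n) :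
    ∃ m, k < m ∧ m ≤ n ∧ (p m ∨ m = n) ∧ ∀ j, k < j → j < m → ¬ p j := by
  classical
  have hex : ∃ m, k < m ∧ (p m ∨ m = n) := ⟨n, hk, Or.inr rfl⟩
  refine ⟨Nat.find hex, (Nat.find_spec hex).1, Nat.find_min' hex ⟨hk, Or.inr rfl⟩,
    (Nat.find_spec hex).2, fun j h1 h2 h3 => ?_⟩
  exact Nat.find_min hex h2 ⟨h1, Or.inl h3⟩

/-- The first hyperplane that the walk meets has level `0`. -/
theorem exists_lev_zero : ∃ m ≤ n, (X m ∨ m = n) ∧ lev S B m = 0 := by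
  classical
  have hex : ∃ m, X m ∨ m = n := ⟨n, Or.inr rfl⟩
  have hm : Nat.find hex ≤ n := Nat.find_min' hex (Or.inr rfl)
  have hX : ∀ k, 0 ≤ k → k < Nat.find hex → ¬ X k := fun k _ h1 h2 =>
    Nat.find_min hex h1 (Or.inl h2)
  refine ⟨Nat.find hex, hm, Nat.find_spec hex, ?_⟩
  rw [lev_of_pos (h.sign_of_sign (Nat.zero_le _) hm hX h.sign_zero),
    h.pos_eq (Nat.zero_le _) hm hX, h.pos_zero]

/-- The walk around the time `m` at which it first attains its maximal level `M > 0`. -/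
theorem first_max {M : ℝ} (hM : 0 < M) (hX : ∀ j < n, X j → lev S B j ≤ M)
    (hn : lev S B n ≤ M) {m : ℕ} (hm : m ≤ n) (hmX : X m ∨ m = n) (hmM : lev S B m = M)
    (hfirst : ∀ j < m, X j → lev S B j ≠ M) :
    ∃ k < m, X k ∧ (∀ j, k < j → j < m → ¬ X j) ∧ ¬ D k ∧ (∀ j, k ≤ j → j ≤ m → S j) ∧
      (m < n → D m) := by
  have hex : ∃ k < m, X k := by
    by_contra hne
    push Not at hne
    have h1 := h.sign_of_sign (Nat.zero_le m) hm (fun k _ hk => hne k hk) h.sign_zero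
    have h2 := h.pos_eq (Nat.zero_le m) hm (fun k _ hk => hne k hk)
    rw [lev_of_pos h1, h2, h.pos_zero] at hmM
    exact hM.ne hmM
  obtain ⟨k, hkm, hk, hlast⟩ := exists_last hex
  have hkM : lev S B k < M := lt_of_le_of_ne (hX k (by omega) hk) (hfirst k hkm hk)
  have hB := h.pos_eq (i := k + 1) hkm hm fun j h1 h2 => hlast j (by omega) h2
  have hle := lev_le S B m
  have hD : ¬ D k := fun hD => by
    rw [lev_of_pos (h.sign_fold k (by omega) hk hD).1, ← h.pos_fold k (by omega) hk hD] at hkM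
    linarith
  have hS : S k := by
    by_contra hS
    rw [lev_of_neg hS, ← h.pos_down k (by omega) hk hD hS] at hkM
    linarith
  have hSk : S (k + 1) := (h.sign_cross k (by omega) hk hD).2 hS
  have hSj : ∀ j, k ≤ j → j ≤ m → S j := by
    intro j h1 h2
    rcases h1.eq_or_lt with rfl | h1
    · exact hS
    · exact h.sign_of_sign (i := k + 1) h1 (by omega) (fun i h3 h4 => hlast i (by omega) (by omega))
        hSk
  refine ⟨k, hkm, hk, hlast, hD, hSj, fun hmn => ?_⟩
  by_contra hDm
  have hmX' : X m := hmX.resolve_right (by omega)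
  have hSm := hSj m hkm.le le_rfl
  have hup := h.pos_up m hmn hmX' hDm hSm
  rw [lev_of_pos hSm] at hmM
  obtain ⟨m', h1, h2, h3, h4⟩ := exists_next (p := X) hmn
  have h5 := h.sign_of_sign (i := m + 1) h1 h2 (fun i h6 h7 => h4 i (by omega) h7)
    ((h.sign_cross m hmn hmX' hDm).2 hSm)
  have h6 := h.pos_eq (i := m + 1) h1 h2 (fun i h6 h7 => h4 i (by omega) h7)
  have h7 : lev S B m' ≤ M := by
    rcases h2.eq_or_lt with rfl | h2
    · exact hn
    · exact hX m' h2 (h3.resolve_right (by omega))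
  rw [lev_of_pos h5] at h7
  linarith

/-- The walk after the time `k` at which it last attains its maximal level. -/
theorem last_max {M : ℝ} (hX : ∀ j < n, X j → lev S B j ≤ M) {k : ℕ} (hk : k < n) (hkX : X k)
    (hkM : lev S B k = M) {m : ℕ} (hkm : k < m) (hm : m ≤ n)
    (hnext : ∀ j, k < j → j < m → ¬ X j) (hmM : lev S B m < M) :
    D k ∧ ∀ j, k < j → j ≤ m → ¬ S j := by
  have hX' : ∀ i, k + 1 ≤ i → i < m → ¬ X i := fun i h1 h2 => hnext i (by omega) h2
  have hB := h.pos_eq (i := k + 1) hkm hm hX'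
  have hge := le_lev S B m
  have hS : S k := by
    by_contra hS
    obtain ⟨k', h1, h2, h3⟩ := h.exists_pred_of_neg hk.le hS
    have h4 := hX k' (by omega) h2
    rw [lev_of_neg hS] at hkM
    linarith
  rw [lev_of_pos hS] at hkM
  have hD : D k := by
    by_contra hD
    have h1 := h.pos_up k hk hkX hD hS
    linarith
  have h1 := h.pos_fold k hk hkX hD
  refine ⟨hD, fun j hkj hjm hSj => ?_⟩
  have h2 := h.sign_of_sign hjm hm (fun i h3 h4 => hX' i (by omega) h4) hSj
  rw [lev_of_pos h2] at hmM
  linarith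

end SignedWalk

end

/-! ### Folded galleries as signed walks -/

section

variable {ι V N : Type*} [AddCommGroup V] [Module ℝ V] [AddCommGroup N] [Module ℝ N]
  {P : RootPairing ι ℝ V N} {I : Type*} [LinearOrder I]

theorem wOf_cut_succ_of_mem [Fintype I] (β : I → ι) {J : Finset I} {i : I} (hi : i ∈ J) :
    wOf P β (cut J (rank i + 1)) = wOf P β (cut J (rank i)) * refl P (β i) :=
  ordProd_cut_succ_of_mem _ hi

theorem wOf_cut_succ_of_notMem [Fintype I] (β : I → ι) {J : Finset I} {i : I} (hi : i ∉ J) :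
    wOf P β (cut J (rank i + 1)) = wOf P β (cut J (rank i)) :=
  ordProd_cut_succ_of_notMem _ hi

theorem wOf_cut_zero [Fintype I] (β : I → ι) (J : Finset I) : wOf P β (cut J 0) = 1 := by
  rw [cut_zero, wOf, ordProd_empty]

variable [Fintype I]

theorem foldedRoot_eq (β : I → ι) (J : Finset I) (i : I) :
    foldedRoot P β J i = act (wOf P β (cut J (rank i))) (β i) := by
  rw [foldedRoot, cut_rank]

theorem mem_idxSet {β : I → ι} {J : Finset I} {p : ι} {i : I} :
    i ∈ idxSet P β J p ↔ foldedRoot P β J i = p ∨ foldedRoot P β J i = negIdx P p := by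
  simp [idxSet]

theorem mem_idxSet_iff {β : I → ι} {J : Finset I} {p : ι} {i : I} :
    i ∈ idxSet P β J p ↔ act (wOf P β (cut J (rank i)))⁻¹ p = β i ∨
      act (wOf P β (cut J (rank i)))⁻¹ p = negIdx P (β i) := by
  rw [mem_idxSet, foldedRoot_eq]
  have h1 : ∀ (w : P.weylGroup) (j k : ι), act w j = k ↔ act w⁻¹ k = j := by
    intro w j k
    constructor
    · rintro rfl
      exact act_inv_act w j
    · rintro rfl
      exact act_act_inv w k
  refine or_congr (h1 _ _ _) ?_
  rw [h1, act_negIdx, ← negIdx_inj (P := P), negIdx_negIdx]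

theorem isAdmissible_iff {b : P.Base} {β : I → ι} (hpos : ∀ i, b.IsPos (β i)) {J : Finset I} :
    IsAdmissible b β J ↔ ∀ i ∈ J, len b (wOf P β (cut J (rank i + 1)))
      = len b (wOf P β (cut J (rank i))) + 1 := by
  refine forall₂_congr fun i hi => ?_
  rw [← cut_rank, ← cut_rank_succ, Covers]
  exact and_iff_right ⟨β i, hpos i, wOf_cut_succ_of_mem β hi⟩

/-- The gallery `γ(J)` is heading, after `m` steps, for larger levels of `-α_p`. -/
def sgn (b : P.Base) (β : I → ι) (J : Finset I) (p : ι) (m : ℕ) : Prop :=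
  b.IsPos (act (wOf P β (cut J m))⁻¹ p)

/-- The wall with number `m` of the gallery `γ(J)` is orthogonal to `α_p`. -/
def hits (P : RootPairing ι ℝ V N) (β : I → ι) (J : Finset I) (p : ι) (m : ℕ) : Prop :=
  ∃ i, rank i = m ∧ i ∈ idxSet P β J p

/-- The gallery `γ(J)` is folded at the wall with number `m`. -/
def folds (J : Finset I) (m : ℕ) : Prop := ∃ i, rank i = m ∧ i ∈ J

/-- After `m` steps, the coroot of `-α_p` takes on the alcove of the gallery `γ(J)` its values
between this number minus one and this number. -/
noncomputable def posn (b : P.Base) (β : I → ι) (J : Finset I) (p : ι) (m : ℕ) : ℝ :=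
  -(addr b β (cut Finset.univ m) (act (wOf P β (cut J m))⁻¹ p) : ℝ)
    - P.coroot' p (wHatOf P β (cut J m) 0)

theorem hits_rank {β : I → ι} {J : Finset I} {p : ι} {i : I} :
    hits P β J p (rank i) ↔ i ∈ idxSet P β J p :=
  ⟨fun ⟨_, h, h'⟩ => rank_inj.1 h ▸ h', fun h => ⟨i, rfl, h⟩⟩

theorem folds_rank {J : Finset I} {i : I} : folds J (rank i) ↔ i ∈ J :=
  ⟨fun ⟨_, h, h'⟩ => rank_inj.1 h ▸ h', fun h => ⟨i, rfl, h⟩⟩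

theorem coroot'_wHatOf (β : I → ι) (J : Finset I) (p : ι) (x : V) :
    P.coroot' p (wHatOf P β J x)
      = P.coroot' (act (wOf P β J)⁻¹ p) x + P.coroot' p (wHatOf P β J 0) := by
  have h := coroot'_ordProd_sub (P := P) β (fun a => -(lEmpty β a : ℤ)) (act (wOf P β J)⁻¹ p) x 0 J
  change P.coroot' (act (wOf P β J) _) (wHatOf P β J x)
    - P.coroot' (act (wOf P β J) _) (wHatOf P β J 0) = _ at h
  rw [act_act_inv, map_zero (P.coroot' _), sub_zero] at h
  linarith

variable [Finite ι] [P.IsRootSystem] [P.IsCrystallographic] [P.IsReduced]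
variable {b : P.Base} {lam : V} {β : I → ι} {J : Finset I} {p : ι}

theorem IsGallery.posn_succ_of_mem (hβ : IsGallery b lam β) {i : I} (hi : i ∈ J) :
    posn b β J p (rank i + 1) = posn b β J p (rank i) := by
  have h1 : wHatOf P β (cut J (rank i + 1)) 0
      = wHatOf P β (cut J (rank i)) (rHat P β i 0) := by
    rw [wHatOf, ordProd_cut_succ_of_mem _ hi]
    rfl
  have h2 : rHat P β i 0 = (-(lEmpty β i : ℝ)) • P.root (β i) := by
    rw [rHat, affRefl_apply, map_zero]
    simp
  unfold posn
  rw [h1, h2, coroot'_wHatOf, wOf_cut_succ_of_mem β hi, mul_inv_rev, refl_inv, act_mul, hβ.step,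
    ← act_mul (refl P _) (refl P _), refl_mul_self, act_one, act_refl,
    coroot'_reflectionPerm_apply, coroot'_root_self, map_smul, smul_eq_mul]
  ring

open scoped Classical in
theorem IsGallery.posn_succ_of_notMem (hβ : IsGallery b lam β) {i : I} (hi : i ∉ J) :
    posn b β J p (rank i + 1) = posn b β J p (rank i)
      + (if act (wOf P β (cut J (rank i)))⁻¹ p = β i then 1 else 0)
      - (if act (wOf P β (cut J (rank i)))⁻¹ p = negIdx P (β i) then 1 else 0) := by
  unfold posn
  rw [cut_succ_of_notMem hi, cut_succ_of_mem (Finset.mem_univ i),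
    addr_insert (by simp [mem_cut]) (hβ.isPos i)]
  push_cast
  ring

theorem IsGallery.act_inv_of_mem_idxSet (hβ : IsGallery b lam β) {i : I}
    (hi : i ∈ idxSet P β J p) :
    (sgn b β J p (rank i) ∧ act (wOf P β (cut J (rank i)))⁻¹ p = β i) ∨
      (¬ sgn b β J p (rank i) ∧ act (wOf P β (cut J (rank i)))⁻¹ p = negIdx P (β i)) := by
  rw [mem_idxSet_iff] at hi
  refine hi.imp (fun h => ⟨?_, h⟩) (fun h => ⟨?_, h⟩)
  · rw [sgn, h]
    exact hβ.isPos i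
  · rw [sgn, h, isPos_negIdx, not_not]
    exact hβ.isPos i

theorem IsGallery.sgn_of_fold (hβ : IsGallery b lam β) (hJ : IsAdmissible b β J)
    (hp : p ∈ b.support) {i : I} (hi : i ∈ idxSet P β J p) (hiJ : i ∈ J) :
    sgn b β J p (rank i) ∧ ¬ sgn b β J p (rank i + 1) := by
  rw [isAdmissible_iff hβ.isPos] at hJ
  have hlen := hJ i hiJ
  rw [wOf_cut_succ_of_mem β hiJ] at hlen
  have hr : wOf P β (cut J (rank i)) * refl P (β i) = refl P p * wOf P β (cut J (rank i)) := by
    rw [mem_idxSet, foldedRoot_eq] at hi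
    rw [← refl_act_mul]
    rcases hi with h | h
    · rw [h]
    · rw [h, refl_negIdx]
  rw [hr] at hlen
  have h1 : sgn b β J p (rank i) := by
    by_contra h
    have := len_refl_mul_of_not_isPos hp h
    omega
  refine ⟨h1, ?_⟩
  rw [sgn, wOf_cut_succ_of_mem β hiJ, hr, mul_inv_rev, refl_inv, act_mul, act_refl_self,
    isPos_act_negIdx, not_not]
  exact h1

theorem IsGallery.signedWalk (hβ : IsGallery b lam β) (hJ : IsAdmissible b β J)
    (hp : p ∈ b.support) {n : ℕ} (hn : n ≤ Fintype.card I) :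
    SignedWalk n (sgn b β J p) (folds J) (hits P β J p) (posn b β J p) := by
  have hpp : b.IsPos p := RootPairing.Base.isPos_of_mem_support hp
  refine ⟨?_, ?_, ?_, ?_, ?_, ?_, ?_, ?_, ?_⟩
  · rwa [sgn, wOf_cut_zero, inv_one, act_one]
  · rw [posn, wOf_cut_zero, inv_one, act_one, cut_zero, cut_zero, wHatOf, ordProd_empty,
      addr_of_isPos hpp, cnt_empty]
    change -((-((0 : ℕ) : ℤ) : ℤ) : ℝ) - P.coroot' p 0 = 0
    simp
  all_goals
    intro k hk hX
    obtain ⟨i, rfl⟩ := exists_rank_eq (I := I) (hk.trans_le hn)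
    rw [hits_rank] at hX
    try rw [folds_rank]
  · by_cases hi : i ∈ J
    · exact hβ.posn_succ_of_mem hi
    · rw [mem_idxSet_iff, not_or] at hX
      rw [hβ.posn_succ_of_notMem hi, if_neg hX.1, if_neg hX.2]
      ring
  · intro hS
    by_cases hi : i ∈ J
    · by_contra hS'
      have hlen := (isAdmissible_iff hβ.isPos).1 hJ i hi
      rw [sgn, wOf_cut_succ_of_mem β hi] at hS'
      rw [wOf_cut_succ_of_mem β hi] at hlen
      have h := act_eq_of_lifting hp (hβ.isPos i) hlen hS hS'
      exact hX (mem_idxSet.2 (Or.inl (by rw [foldedRoot_eq, h])))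
    · rwa [sgn, wOf_cut_succ_of_notMem β hi]
  · intro hi
    rw [sgn, sgn, wOf_cut_succ_of_notMem β hi]
  · intro hi hS
    rcases hβ.act_inv_of_mem_idxSet hX with ⟨-, h⟩ | ⟨h, -⟩
    · have h1 : β i ≠ negIdx P (β i) := by
        intro h1
        have h2 := hβ.isPos i
        rw [h1, isPos_negIdx] at h2
        exact h2 (hβ.isPos i)
      rw [hβ.posn_succ_of_notMem hi, if_pos h, if_neg (by rwa [h])]
      ring
    · exact absurd hS h
  · intro hi hS
    rcases hβ.act_inv_of_mem_idxSet hX with ⟨h, -⟩ | ⟨-, h⟩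
    · exact absurd h hS
    · have h1 : negIdx P (β i) ≠ β i := by
        intro h1
        have h2 := hβ.isPos i
        rw [← h1, isPos_negIdx] at h2
        exact h2 (hβ.isPos i)
      rw [hβ.posn_succ_of_notMem hi, if_pos h, if_neg (by rwa [h])]
      ring
  · exact hβ.sgn_of_fold hJ hp hX
  · exact hβ.posn_succ_of_mem

theorem IsGallery.level_eq (hβ : IsGallery b lam β) (hpp : b.IsPos p) {i : I}
    (hi : i ∈ idxSet P β J p) :
    level b β J i = SignedWalk.lev (sgn b β J p) (posn b β J p) (rank i) := by
  rw [level, absIdx_eq_of_eq_or b hpp (mem_idxSet.1 hi), ← cut_rank, coroot'_wHatOf, map_smul,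
    smul_eq_mul]
  rcases hβ.act_inv_of_mem_idxSet hi with ⟨hS, h⟩ | ⟨hS, h⟩
  · rw [SignedWalk.lev_of_pos hS, posn, h, addr_of_isPos (hβ.isPos i), cnt_cut_rank,
      coroot'_root_self]
    push_cast
    ring
  · rw [SignedWalk.lev_of_neg hS, posn, h, addr_negIdx, addr_of_isPos (hβ.isPos i), cnt_cut_rank,
      coroot'_negIdx, coroot'_root_self]
    push_cast
    ring

theorem IsGallery.levelInf_eq (hβ : IsGallery b lam β) :
    levelInf P β lam J p
      = SignedWalk.lev (sgn b β J p) (posn b β J p) (Fintype.card I) := by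
  have h1 : sgn b β J p (Fintype.card I) ↔ b.IsPos (act (wOf P β J)⁻¹ p) := by
    rw [sgn, cut_of_card_le _ le_rfl]
  rw [levelInf, weight, map_neg, coroot'_wHatOf, map_neg]
  by_cases hS : b.IsPos (act (wOf P β J)⁻¹ p)
  · rw [SignedWalk.lev_of_pos (h1.2 hS), posn, cut_of_card_le _ le_rfl, cut_of_card_le _ le_rfl,
      addr_of_isPos hS, ← hβ.total _ hS]
    push_cast
    ring
  · rw [SignedWalk.lev_of_neg (fun h => hS (h1.1 h)), posn, cut_of_card_le _ le_rfl,
      cut_of_card_le _ le_rfl, addr_of_not_isPos hS]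
    have h2 := hβ.total _ ((isPos_negIdx b _).2 hS)
    rw [coroot'_negIdx] at h2
    push_cast
    linarith

/-! ### Adding and removing a folding position -/

open scoped Classical in
/-- Adding the folding position `k` multiplies by `s_p` from the left what comes later. -/
theorem wOf_cut_insert {k : I} (hkJ : k ∉ J) (hk : k ∈ idxSet P β J p) {m : ℕ} (hm : rank k < m)
    (hmn : m ≤ Fintype.card I) :
    wOf P β (cut (insert k J) m) = refl P p * wOf P β (cut J m) := by
  induction m, hm using Nat.le_induction with
  | base =>
    have h1 : cut (insert k J) (rank k) = cut J (rank k) := by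
      ext x
      simp only [mem_cut, Finset.mem_insert]
      constructor
      · rintro ⟨rfl | h, h'⟩
        · exact absurd h' (lt_irrefl _)
        · exact ⟨h, h'⟩
      · exact fun h => ⟨Or.inr h.1, h.2⟩
    rw [wOf_cut_succ_of_mem β (Finset.mem_insert_self k J), wOf_cut_succ_of_notMem β hkJ, h1,
      ← refl_act_mul]
    rw [mem_idxSet, foldedRoot_eq] at hk
    rcases hk with h | h
    · rw [h]
    · rw [h, refl_negIdx]
  | succ m hm ih =>
    obtain ⟨i, rfl⟩ := exists_rank_eq (I := I) (m := m) (by omega)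
    have hik : i ≠ k := by
      rintro rfl
      omega
    by_cases hi : i ∈ J
    · rw [wOf_cut_succ_of_mem β (Finset.mem_insert_of_mem hi), wOf_cut_succ_of_mem β hi,
        ih (by omega), mul_assoc]
    · rw [wOf_cut_succ_of_notMem β (by simp [hi, hik]), wOf_cut_succ_of_notMem β hi,
        ih (by omega)]

open scoped Classical in
theorem cut_insert_of_le {k : I} {m : ℕ} (hm : m ≤ rank k) : cut (insert k J) m = cut J m := by
  ext x
  simp only [mem_cut, Finset.mem_insert]
  constructor
  · rintro ⟨rfl | h, h'⟩
    · omega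
    · exact ⟨h, h'⟩
  · exact fun h => ⟨Or.inr h.1, h.2⟩

open scoped Classical in
theorem idxSet_insert {k : I} (hkJ : k ∉ J) (hk : k ∈ idxSet P β J p) :
    idxSet P β (insert k J) p = idxSet P β J p := by
  ext i
  rw [mem_idxSet_iff, mem_idxSet_iff]
  by_cases h : rank k < rank i
  · rw [wOf_cut_insert hkJ hk h (rank_lt_card i).le, mul_inv_rev, refl_inv, act_mul,
      act_refl_self, act_negIdx, negIdx_inj, ← negIdx_inj (P := P), negIdx_negIdx]
    exact or_comm
  · rw [cut_insert_of_le (not_lt.1 h)]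

open scoped Classical in
/-- If the gallery `γ(J)` heads up from its wall `k` on, then it may also be folded there. -/
theorem IsGallery.isAdmissible_insert (hβ : IsGallery b lam β) (hJ : IsAdmissible b β J)
    (hp : p ∈ b.support) {k : I} (hkJ : k ∉ J) (hk : k ∈ idxSet P β J p)
    (hS : ∀ j, rank k ≤ j → j ≤ Fintype.card I → sgn b β J p j) :
    IsAdmissible b β (insert k J) := by
  rw [isAdmissible_iff hβ.isPos] at hJ ⊢
  have hlen : ∀ j, rank k < j → j ≤ Fintype.card I →
      len b (wOf P β (cut (insert k J) j)) = len b (wOf P β (cut J j)) + 1 := by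
    intro j h1 h2
    rw [wOf_cut_insert hkJ hk h1 h2]
    exact len_refl_mul_of_isPos hp (hS j h1.le h2)
  intro i hi
  rw [Finset.mem_insert] at hi
  have hi' := rank_lt_card i
  rcases lt_trichotomy (rank i) (rank k) with h | h | h
  · rw [cut_insert_of_le h, cut_insert_of_le h.le]
    refine hJ i (hi.resolve_left ?_)
    rintro rfl
    exact lt_irrefl _ h
  · rw [rank_inj] at h
    subst h
    rw [hlen _ (Nat.lt_succ_self _) hi', cut_insert_of_le le_rfl, wOf_cut_succ_of_notMem β hkJ]
  · rw [hlen _ (by omega) hi', hlen _ h hi'.le]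
    rw [hJ i (hi.resolve_left ?_)]
    rintro rfl
    exact lt_irrefl _ h

open scoped Classical in
/-- If the gallery `γ(J)` heads down everywhere after its folding `k`, then this folding may be
removed. -/
theorem IsGallery.isAdmissible_of_insert (hβ : IsGallery b lam β) {k : I} (hkJ : k ∉ J)
    (hJ : IsAdmissible b β (insert k J)) (hp : p ∈ b.support) (hk : k ∈ idxSet P β J p)
    (hS : ∀ j, rank k < j → j ≤ Fintype.card I → ¬ sgn b β (insert k J) p j) :
    IsAdmissible b β J := by
  rw [isAdmissible_iff hβ.isPos] at hJ ⊢
  have hlen : ∀ j, rank k < j → j ≤ Fintype.card I →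
      len b (wOf P β (cut J j)) + 1 = len b (wOf P β (cut (insert k J) j)) := by
    intro j h1 h2
    have h3 := wOf_cut_insert hkJ hk h1 h2
    have h4 := len_refl_mul_of_not_isPos hp (hS j h1 h2)
    rwa [h3, refl_mul_refl_mul, ← h3] at h4
  intro i hi
  have hi' := rank_lt_card i
  have hJi := hJ i (Finset.mem_insert_of_mem hi)
  rcases lt_trichotomy (rank i) (rank k) with h | h | h
  · rwa [cut_insert_of_le h, cut_insert_of_le h.le] at hJi
  · rw [rank_inj] at h
    exact absurd (h ▸ hi) hkJ
  · have h1 := hlen _ h hi'.le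
    have h2 := hlen (rank i + 1) (by omega) hi'
    omega

open scoped Classical in
/-- If the gallery `γ(J)` heads up between its wall `k` and its folding `m`, and if `k` and `m`
are orthogonal to `α_p`, then the folding may be moved from `m` to `k`. -/
theorem IsGallery.isAdmissible_insert_insert (hβ : IsGallery b lam β) {k m : I} (hkm : k < m)
    (hkJ : k ∉ J) (hmJ : m ∉ J) (hJ : IsAdmissible b β (insert m J)) (hp : p ∈ b.support)
    (hk : k ∈ idxSet P β J p) (hm : m ∈ idxSet P β J p)
    (hS : ∀ j, rank k ≤ j → j ≤ rank m → sgn b β J p j) :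
    IsAdmissible b β (insert k J) ∧ wOf P β (insert k J) = wOf P β (insert m J) := by
  have hkm' := rank_lt_iff.2 hkm
  have heq : ∀ j, rank m < j → j ≤ Fintype.card I →
      wOf P β (cut (insert k J) j) = wOf P β (cut (insert m J) j) := by
    intro j h1 h2
    rw [wOf_cut_insert hkJ hk (hkm'.trans h1) h2, wOf_cut_insert hmJ hm h1 h2]
  constructor
  swap
  · have := heq _ (rank_lt_card m) le_rfl
    rwa [cut_of_card_le _ le_rfl, cut_of_card_le _ le_rfl] at this
  rw [isAdmissible_iff hβ.isPos] at hJ ⊢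
  have hlen : ∀ j, rank k < j → j ≤ rank m →
      len b (wOf P β (cut (insert k J) j)) = len b (wOf P β (cut (insert m J) j)) + 1 := by
    intro j h1 h2
    rw [wOf_cut_insert hkJ hk h1 (h2.trans (rank_lt_card m).le), cut_insert_of_le h2]
    exact len_refl_mul_of_isPos hp (hS j h1.le h2)
  intro i hi
  rw [Finset.mem_insert] at hi
  have hi' := rank_lt_card i
  have him : rank i ≠ rank m := by
    intro h
    rw [rank_inj] at h
    subst h
    rcases hi with h | h
    · exact hkm.ne h.symm
    · exact hmJ h
  have hJi : i ≠ k → _ := fun h => hJ i (Finset.mem_insert_of_mem (hi.resolve_left h))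
  rcases lt_trichotomy (rank i) (rank k) with h | h | h
  · have := hJi (by rintro rfl; exact lt_irrefl _ h)
    rw [cut_insert_of_le (k := m) (by omega), cut_insert_of_le (k := m) (by omega)] at this
    rwa [cut_insert_of_le h, cut_insert_of_le h.le]
  · rw [rank_inj] at h
    subst h
    rw [hlen _ (Nat.lt_succ_self _) hkm', cut_insert_of_le le_rfl, cut_insert_of_le (k := m) hkm',
      wOf_cut_succ_of_notMem β hkJ]
  · have h1 := hJi (by rintro rfl; exact lt_irrefl _ h)
    rcases lt_or_gt_of_ne him with h2 | h2
    · rw [hlen _ (by omega) h2, hlen _ h h2.le, h1]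
    · rw [heq _ (by omega) hi', heq _ h2 hi'.le, h1]

end

/-! ### Saturated chains in the initial segment -/

section

variable {ι V N : Type*} [AddCommGroup V] [Module ℝ V] [AddCommGroup N] [Module ℝ N]
  {P : RootPairing ι ℝ V N}

section General

variable {I : Type*} [LinearOrder I] [Fintype I] {b : P.Base} {β : I → ι} {J : Finset I}

theorem IsAdmissible.len_wOf_cut (hpos : ∀ i, b.IsPos (β i)) (hJ : IsAdmissible b β J) {m : ℕ}
    (hm : m ≤ Fintype.card I) : len b (wOf P β (cut J m)) = (cut J m).card := by
  rw [isAdmissible_iff hpos] at hJ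
  induction m with
  | zero => rw [wOf_cut_zero, len_one, cut_zero, Finset.card_empty]
  | succ m ih =>
    obtain ⟨i, rfl⟩ := exists_rank_eq (I := I) (m := m) (by omega)
    by_cases hi : i ∈ J
    · rw [hJ i hi, ih (by omega), cut_succ_of_mem hi,
        Finset.card_insert_of_notMem (by simp [mem_cut])]
    · rw [cut_succ_of_notMem hi, ih (by omega)]

theorem IsAdmissible.len_wOf (hpos : ∀ i, b.IsPos (β i)) (hJ : IsAdmissible b β J) :
    len b (wOf P β J) = J.card := by
  have := hJ.len_wOf_cut hpos le_rfl
  rwa [cut_of_card_le _ le_rfl] at this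

variable [Finite ι] [P.IsRootSystem] [P.IsCrystallographic] [P.IsReduced] {lam : V}

/-- The partial products of an admissible subset are minimal in their cosets of `W_λ`. -/
theorem IsGallery.isMinCoset_wOf_cut (hlam : IsDominantWeight b lam) (hβ : IsGallery b lam β)
    (hJ : IsAdmissible b β J) {m : ℕ} (hm : m ≤ Fintype.card I) :
    IsMinCoset b lam (wOf P β (cut J m)) := by
  rw [isAdmissible_iff hβ.isPos] at hJ
  induction m with
  | zero =>
    rw [wOf_cut_zero]
    exact isMinCoset_one b lam
  | succ m ih =>
    obtain ⟨i, rfl⟩ := exists_rank_eq (I := I) (m := m) (by omega)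
    by_cases hi : i ∈ J
    · have h1 := hJ i hi
      rw [wOf_cut_succ_of_mem β hi] at h1 ⊢
      exact (ih (by omega)).mul_refl hlam (hβ.isPos i) h1 (hβ.coroot'_ne_zero i)
    · rw [wOf_cut_succ_of_notMem β hi]
      exact ih (by omega)

theorem IsGallery.isMinCoset_wOf (hlam : IsDominantWeight b lam) (hβ : IsGallery b lam β)
    (hJ : IsAdmissible b β J) : IsMinCoset b lam (wOf P β J) := by
  have := hβ.isMinCoset_wOf_cut hlam hJ le_rfl
  rwa [cut_of_card_le _ le_rfl] at this

variable {q : ℕ} (hq : ∀ i : I, rank i < q → lEmpty β i = 0)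
include hq

theorem wHatOf_cut_apply_zero {m : ℕ} (hm : m ≤ q) (hmn : m ≤ Fintype.card I) :
    wHatOf P β (cut J m) 0 = 0 := by
  induction m with
  | zero =>
    rw [cut_zero, wHatOf, ordProd_empty]
    rfl
  | succ m ih =>
    obtain ⟨i, rfl⟩ := exists_rank_eq (I := I) (m := m) (by omega)
    by_cases hi : i ∈ J
    · have h1 : wHatOf P β (cut J (rank i + 1)) 0
          = wHatOf P β (cut J (rank i)) (rHat P β i 0) := by
        rw [wHatOf, ordProd_cut_succ_of_mem _ hi]
        rfl
      have h2 : rHat P β i 0 = 0 := by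
        rw [rHat, affRefl_apply, hq i hm]
        simp
      rw [h1, h2, ih (by omega) (by omega)]
    · rw [cut_succ_of_notMem hi, ih (by omega) (by omega)]

/-- The walls of an initial segment without repetitions pass through the origin, and folding
there fixes the origin. Hence the levels of these walls are `0`. -/
theorem IsGallery.lev_initial (hβ : IsGallery b lam β) {p : ι} (hpp : b.IsPos p) {i : I}
    (hi : i ∈ idxSet P β J p) (hiq : rank i < q) :
    SignedWalk.lev (sgn b β J p) (posn b β J p) (rank i) = 0 := by
  rw [← hβ.level_eq hpp hi, level, ← cut_rank, hq i hiq]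
  simp [wHatOf_cut_apply_zero hq hiq.le (rank_lt_card i).le]

variable (hqn : q ≤ Fintype.card I)
  (hcnt : ∀ δ, b.IsPos δ → P.coroot' δ lam ≠ 0 → cnt β (cut Finset.univ q) δ = 1)
include hqn hcnt

theorem IsGallery.posn_initial_of_isPos {p : ι}
    (hS : b.IsPos (act (wOf P β (cut J q))⁻¹ p))
    (h0 : P.coroot' (act (wOf P β (cut J q))⁻¹ p) lam ≠ 0) : posn b β J p q = 1 := by
  rw [posn, wHatOf_cut_apply_zero hq le_rfl hqn, addr_of_isPos hS, hcnt _ hS h0, map_zero]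
  norm_num

theorem IsGallery.posn_initial_of_not_isPos {p : ι}
    (hS : ¬ b.IsPos (act (wOf P β (cut J q))⁻¹ p))
    (h0 : P.coroot' (act (wOf P β (cut J q))⁻¹ p) lam ≠ 0) : posn b β J p q = 0 := by
  rw [posn, wHatOf_cut_apply_zero hq le_rfl hqn, addr_of_not_isPos hS,
    hcnt _ ((isPos_negIdx b _).2 hS) (by rwa [coroot'_negIdx, neg_ne_zero]), map_zero]
  norm_num

/-- For every element `w` that is minimal in its coset of `W_λ` there is a unique saturated
chain in the Bruhat order from `1` to `w` whose labels follow the initial segment of the gallery.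

Let `s_p` decrease the length of `w`. In a chain that leads to `w` one may omit the last
reflection that is conjugate to `s_p`, and what is left leads to `s_p w`; conversely, a chain that
leads to `s_p w` may be extended in exactly one way. Hence the number of chains is the same for `w`
and for `s_p w`. -/
theorem IsGallery.existsUnique_initial (hβ : IsGallery b lam β)
    {w : P.weylGroup} (hw : IsMinCoset b lam w) :
    ∃! J : Finset I, (∀ i ∈ J, rank i < q) ∧ IsAdmissible b β J ∧ wOf P β J = w := by
  classical
  have hcutq : ∀ {J : Finset I}, (∀ i ∈ J, rank i < q) → ∀ m, q ≤ m → cut J m = J := by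
    intro J h m hm
    ext x
    rw [mem_cut]
    exact ⟨fun h => h.1, fun hx => ⟨hx, (h x hx).trans_le hm⟩⟩
  generalize hl : len b w = l
  induction l using Nat.strong_induction_on generalizing w with
  | _ l ih =>
    subst hl
    by_cases h1 : w = 1
    · subst h1
      refine ⟨∅, ⟨by simp, ?_, ?_⟩, ?_⟩
      · simp [IsAdmissible]
      · rw [wOf, ordProd_empty]
      · rintro J ⟨-, hJ, hwJ⟩
        have := hJ.len_wOf hβ.isPos
        rw [hwJ, len_one] at this
        exact Finset.card_eq_zero.1 this.symm
    obtain ⟨p, hp, hneg⟩ := exists_simple_of_ne_one b h1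
    have hpp : b.IsPos p := RootPairing.Base.isPos_of_mem_support hp
    set u := refl P p * w with hu
    have hlen := len_refl_mul_of_not_isPos hp hneg
    have humin : IsMinCoset b lam u := hw.refl_mul hp fun i hi _ h => hneg (by
      rw [← h, act_inv_act]
      exact hi)
    have hup : act u⁻¹ p = negIdx P (act w⁻¹ p) := by
      rw [hu, mul_inv_rev, refl_inv, act_mul, act_refl_self, act_negIdx]
    have huS : b.IsPos (act u⁻¹ p) := by
      rw [hup, isPos_negIdx]
      exact hneg
    have hu0 : P.coroot' (act u⁻¹ p) lam ≠ 0 := by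
      intro h0
      have h2 := hw _ huS h0
      rw [hup, act_negIdx, act_act_inv, isPos_negIdx] at h2
      exact h2 hpp
    have hw0 : P.coroot' (act w⁻¹ p) lam ≠ 0 := by
      rw [hup, coroot'_negIdx, neg_ne_zero] at hu0
      exact hu0
    obtain ⟨J₀, ⟨hJ₀q, hJ₀, hJ₀u⟩, huniq⟩ := ih (len b u) (by rw [hu]; omega) humin rfl
    have hlev : ∀ (J : Finset I), ∀ j < q, hits P β J p j →
        SignedWalk.lev (sgn b β J p) (posn b β J p) j = 0 := by
      rintro J j hj ⟨i, rfl, hi⟩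
      exact hβ.lev_initial hq hpp hi hj
    -- existence: fold at the last wall orthogonal to `α_p`
    obtain ⟨k, hk, hkX, hkq, hkJ₀, hkS⟩ : ∃ k : I, rank k < q ∧ k ∈ idxSet P β J₀ p ∧
        (∀ j, rank k < j → j < q → ¬ hits P β J₀ p j) ∧ k ∉ J₀ ∧
        ∀ j, rank k ≤ j → j ≤ q → sgn b β J₀ p j := by
      have hc := hcutq hJ₀q q le_rfl
      have hS : sgn b β J₀ p q := by rwa [sgn, hc, hJ₀u]
      have hB := IsGallery.posn_initial_of_isPos (J := J₀) (p := p) hq hqn hcnt hS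
        (by rwa [hc, hJ₀u])
      have hL : SignedWalk.lev (sgn b β J₀ p) (posn b β J₀ p) q = 1 := by
        rw [SignedWalk.lev_of_pos hS, hB]
      obtain ⟨k, h2, ⟨i, rfl, h3⟩, h4, h5, h6, -⟩ := (hβ.signedWalk hJ₀ hp hqn).first_max
        (M := 1) one_pos (fun j hj hX => by rw [hlev J₀ j hj hX]; norm_num) hL.le le_rfl
        (Or.inr rfl) hL (fun j hj hX => by rw [hlev J₀ j hj hX]; norm_num)
      rw [folds_rank] at h5
      exact ⟨i, h2, h3, h4, h5, h6⟩
    have hinsq : ∀ i ∈ insert k J₀, rank i < q := by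
      intro i hi
      rcases Finset.mem_insert.1 hi with rfl | hi
      · exact hk
      · exact hJ₀q i hi
    refine ⟨insert k J₀, ⟨hinsq, hβ.isAdmissible_insert hJ₀ hp hkJ₀ hkX fun j h2 h3 => ?_, ?_⟩, ?_⟩
    · rcases le_total j q with h4 | h4
      · exact hkS j h2 h4
      · have h5 := hkS q hk.le le_rfl
        rw [sgn, hcutq hJ₀q q le_rfl] at h5
        rwa [sgn, hcutq hJ₀q j h4]
    · have h2 := wOf_cut_insert hkJ₀ hkX hk hqn
      rwa [hcutq hinsq q le_rfl, hcutq hJ₀q q le_rfl, hJ₀u, hu, refl_mul_refl_mul] at h2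
    · -- uniqueness: remove the last wall orthogonal to `α_p`
      rintro J ⟨hJq, hJ, hJw⟩
      have hc := hcutq hJq q le_rfl
      have hS : ¬ sgn b β J p q := by rwa [sgn, hc, hJw]
      have hB := IsGallery.posn_initial_of_not_isPos (J := J) (p := p) hq hqn hcnt hS
        (by rwa [hc, hJw])
      have hW := hβ.signedWalk hJ hp hqn
      obtain ⟨k', h2, h3, -⟩ := hW.exists_pred_of_neg le_rfl hS
      obtain ⟨k', h2, h3, h4⟩ := SignedWalk.exists_last (p := hits P β J p) ⟨k', h2, h3⟩
      obtain ⟨h5, h6⟩ := hW.last_max (M := 0) (fun j hj hX => (hlev J j hj hX).le) h2 h3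
        (hlev J k' h2 h3) h2 le_rfl h4 (by
          rw [SignedWalk.lev_of_neg hS, hB]
          norm_num)
      obtain ⟨i, rfl, hi⟩ := h3
      rw [folds_rank] at h5
      have hiJ : i ∉ J.erase i := Finset.notMem_erase i J
      have hJi : insert i (J.erase i) = J := Finset.insert_erase h5
      have hiX : i ∈ idxSet P β (J.erase i) p := by
        rw [← hJi] at hi
        rw [mem_idxSet_iff] at hi ⊢
        rwa [cut_insert_of_le le_rfl] at hi
      have hJ' : IsAdmissible b β (J.erase i) := by
        refine hβ.isAdmissible_of_insert hiJ (by rwa [hJi]) hp hiX fun j h7 h8 => ?_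
        rw [hJi]
        rcases le_total j q with h9 | h9
        · exact h6 j h7 h9
        · have h10 := h6 q h2 le_rfl
          rw [sgn, hcutq hJq q le_rfl] at h10
          rwa [sgn, hcutq hJq j h9]
      have hw' : wOf P β (J.erase i) = u := by
        have h7 := wOf_cut_insert hiJ hiX (rank_lt_card i) le_rfl
        rw [hJi, cut_of_card_le _ le_rfl, cut_of_card_le _ le_rfl, hJw] at h7
        rw [hu, h7, refl_mul_refl_mul]
      have hJ₀' := huniq _ ⟨fun j hj => hJq j (Finset.mem_of_mem_erase hj), hJ', hw'⟩
      have hidx : idxSet P β J p = idxSet P β J₀ p := by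
        rw [← hJi, idxSet_insert hiJ hiX, hJ₀']
      have hik : i = k := by
        rcases lt_trichotomy (rank i) (rank k) with h7 | h7 | h7
        · exact absurd ⟨k, rfl, hidx ▸ hkX⟩ (h4 _ h7 hk)
        · exact rank_inj.1 h7
        · exact absurd ⟨i, rfl, hidx ▸ hi⟩ (hkq _ h7 h2)
      rw [← hJi, hJ₀', hik]

end General

end

/-! ### The reversed subset -/

section

variable {ι V N : Type*} [AddCommGroup V] [Module ℝ V] [AddCommGroup N] [Module ℝ N]
  {P : RootPairing ι ℝ V N} {q n : ℕ}

theorem card_lex : Fintype.card (Fin q ⊕ₗ Fin n) = q + n := by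
  change Fintype.card (Fin q ⊕ Fin n) = q + n
  simp

theorem rank_inr (j : Fin n) : rank (Sum.inrₗ j : Fin q ⊕ₗ Fin n) = q + j := by
  classical
  have h : rank (Sum.inrₗ j : Fin q ⊕ₗ Fin n)
      = (∑ a : Fin q, if (Sum.inlₗ a : Fin q ⊕ₗ Fin n) < Sum.inrₗ j then 1 else 0)
        + ∑ j' : Fin n, if (Sum.inrₗ j' : Fin q ⊕ₗ Fin n) < Sum.inrₗ j then 1 else 0 := by
    rw [rank, Finset.card_filter]
    exact Fintype.sum_sum_type _
  rw [h]
  simp only [Sum.Lex.inl_lt_inr, if_true, Sum.Lex.inr_lt_inr_iff]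
  rw [← Finset.card_filter]
  simp [Finset.filter_gt_eq_Iio]

theorem inl_mem_barSet {K : Finset (Fin q)} {a : Fin q} :
    (Sum.inlₗ a : Fin q ⊕ₗ Fin n) ∈ barSet K ↔ a ∈ K := by
  classical
  rw [barSet, Finset.mem_image]
  exact ⟨fun ⟨x, hx, h⟩ => Sum.inl_injective h ▸ hx, fun h => ⟨a, h, rfl⟩⟩

theorem inr_notMem_barSet {K : Finset (Fin q)} {j : Fin n} :
    (Sum.inrₗ j : Fin q ⊕ₗ Fin n) ∉ barSet K := by
  classical
  rw [barSet, Finset.mem_image]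
  rintro ⟨x, -, h⟩
  exact Sum.inl_ne_inr h

theorem rank_lt_of_mem_barSet {K : Finset (Fin q)} :
    ∀ i ∈ (barSet K : Finset (Fin q ⊕ₗ Fin n)), rank i < q := by
  intro i
  induction i using forall_lex with
  | h1 a => exact fun _ => rank_inl_lt a
  | h2 j => exact fun h => absurd h inr_notMem_barSet

theorem exists_barSet_eq {J : Finset (Fin q ⊕ₗ Fin n)} (hJ : ∀ i ∈ J, rank i < q) :
    ∃ K, barSet K = J := by
  classical
  refine ⟨Finset.univ.filter fun a => Sum.inlₗ a ∈ J, ?_⟩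
  ext i
  induction i using forall_lex with
  | h1 a => rw [inl_mem_barSet, Finset.mem_filter, and_iff_right (Finset.mem_univ a)]
  | h2 j =>
    exact iff_of_false inr_notMem_barSet fun h => absurd (hJ _ h) (not_lt.2 (le_rank_inr j))

theorem barSet_injective {K K' : Finset (Fin q)}
    (h : (barSet K : Finset (Fin q ⊕ₗ Fin n)) = barSet K') : K = K' := by
  ext a
  rw [← inl_mem_barSet (n := n), h, inl_mem_barSet]

section RevSet

variable [Finite ι] [P.IsRootSystem] {b : P.Base} {lam : V} {β : Fin q ⊕ₗ Fin n → ι}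
  {J : Finset (Fin q ⊕ₗ Fin n)}

theorem inl_mem_revSet {a : Fin q} :
    Sum.inlₗ a ∈ revSet b lam β J ↔ a ∈ revInitial b lam β J := by
  classical
  rw [revSet, Finset.mem_union, inl_mem_barSet, or_iff_left]
  rw [Finset.mem_image]
  rintro ⟨x, -, h⟩
  exact Sum.inr_ne_inl h

theorem inr_mem_revSet {j : Fin n} : Sum.inrₗ j ∈ revSet b lam β J ↔ Sum.inrₗ j.rev ∈ J := by
  classical
  rw [revSet, Finset.mem_union, or_iff_right inr_notMem_barSet, Finset.mem_image]
  constructor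
  · rintro ⟨x, hx, h⟩
    rw [Sum.inr_injective h] at hx
    exact (Finset.mem_filter.1 hx).2
  · exact fun h => ⟨j, Finset.mem_filter.2 ⟨Finset.mem_univ _, h⟩, rfl⟩

theorem cut_revSet {m : ℕ} (hm : m ≤ q) :
    cut (revSet b lam β J) m = cut (barSet (revInitial b lam β J)) m := by
  ext i
  rw [mem_cut, mem_cut]
  induction i using forall_lex with
  | h1 a => rw [inl_mem_revSet, inl_mem_barSet]
  | h2 j =>
    have := le_rank_inr (q := q) j
    exact iff_of_false (fun h => by omega) (fun h => by omega)

theorem cut_barSet {K : Finset (Fin q)} {m : ℕ} (hm : q ≤ m) :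
    cut (barSet K : Finset (Fin q ⊕ₗ Fin n)) m = barSet K := by
  ext i
  rw [mem_cut]
  exact and_iff_left_of_imp fun h => (rank_lt_of_mem_barSet i h).trans_le hm

end RevSet

variable [Finite ι] [P.IsRootSystem] [P.IsCrystallographic] [P.IsReduced]
  {b : P.Base} {lam : V} {β : Fin q ⊕ₗ Fin n → ι} {J : Finset (Fin q ⊕ₗ Fin n)}

theorem lEmpty_revChain_eq_zero (hI : ∀ i, lEmpty β i = 0 ↔ ∃ a : Fin q, i = Sum.inlₗ a)
    (i : Fin q ⊕ₗ Fin n) (hi : rank i < q) : lEmpty (revChain b lam β) i = 0 := by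
  obtain ⟨a, rfl⟩ := rank_lt_iff_exists_inl.1 hi
  rw [lEmpty_revChain_inl]
  exact (hI _).2 ⟨a, rfl⟩

theorem IsGallery.existsUnique_isRevInitial (hlam : IsDominantWeight b lam)
    (hβ : IsGallery b lam β) (hI : ∀ i, lEmpty β i = 0 ↔ ∃ a : Fin q, i = Sum.inlₗ a)
    (hJ : IsAdmissible b β J) : ∃! K, IsRevInitial b lam β J K := by
  have hw := (hβ.isMinCoset_wOf hlam hJ).w0_mul_mul_w0Stab hlam
  obtain ⟨J', ⟨h1, h2, h3⟩, h4⟩ := (hβ.isGallery_revChain hlam hI).existsUnique_initial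
    (lEmpty_revChain_eq_zero hI) (by rw [card_lex]; omega)
    (fun δ hδ h0 => by rw [cnt_revChain_initial le_rfl, hβ.cnt_initial hI hδ h0]) hw
  obtain ⟨K, rfl⟩ := exists_barSet_eq h1
  exact ⟨K, ⟨h2, h3⟩, fun K' hK' => barSet_injective (n := n)
    (h4 _ ⟨rank_lt_of_mem_barSet, hK'.1, hK'.2⟩)⟩

theorem IsGallery.isRevInitial_revInitial (hlam : IsDominantWeight b lam)
    (hβ : IsGallery b lam β) (hI : ∀ i, lEmpty β i = 0 ↔ ∃ a : Fin q, i = Sum.inlₗ a)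
    (hJ : IsAdmissible b β J) : IsRevInitial b lam β J (revInitial b lam β J) :=
  Classical.epsilon_spec (hβ.existsUnique_isRevInitial hlam hI hJ).exists

/-- The part of the gallery `γ(J^rev)` outside of the initial segment is the reverse of the
corresponding part of `γ(J)`. -/
theorem wOf_cut_revSet (hlam : IsDominantWeight b lam)
    (hK : IsRevInitial b lam β J (revInitial b lam β J)) {m : ℕ} (hm : m ≤ n) :
    wOf P (revChain b lam β) (cut (revSet b lam β J) (q + m))
      = w0 b * wOf P β (cut J (q + n - m)) * w0Stab b lam := by
  induction m with
  | zero =>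
    rw [add_zero, cut_revSet le_rfl, cut_barSet le_rfl, hK.2, Nat.sub_zero,
      cut_of_card_le J card_lex.le]
  | succ m ih =>
    have ih := ih (by omega)
    let j : Fin n := ⟨m, by omega⟩
    have h1 : q + m = rank (Sum.inrₗ j : Fin q ⊕ₗ Fin n) := (rank_inr j).symm
    have h2 : q + n - (m + 1) = rank (Sum.inrₗ j.rev : Fin q ⊕ₗ Fin n) := by
      rw [rank_inr, Fin.val_rev]
      change _ = q + (n - (m + 1))
      omega
    have h3 : q + n - m = q + n - (m + 1) + 1 := by omega
    rw [h3] at ih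
    rw [← add_assoc, h2]
    rw [h2, h1] at ih
    rw [h1]
    by_cases hj : Sum.inrₗ j.rev ∈ J
    · rw [wOf_cut_succ_of_mem β hj] at ih
      rw [wOf_cut_succ_of_mem _ (inr_mem_revSet.2 hj), ih, revChain_inr, refl_act,
        w0Stab_inv hlam]
      simp only [mul_assoc]
      rw [← mul_assoc (w0Stab b lam) (w0Stab b lam), w0Stab_mul_self hlam, one_mul,
        ← mul_assoc (refl P _) (refl P _), refl_mul_self, one_mul]
    · rw [wOf_cut_succ_of_notMem β hj] at ih
      rw [wOf_cut_succ_of_notMem _ (fun h => hj (inr_mem_revSet.1 h)), ih]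

theorem wOf_cut_rank_revSet (hlam : IsDominantWeight b lam)
    (hK : IsRevInitial b lam β J (revInitial b lam β J)) (j : Fin n) :
    wOf P (revChain b lam β) (cut (revSet b lam β J) (rank (Sum.inrₗ j : Fin q ⊕ₗ Fin n)))
      = w0 b * wOf P β (cut J (rank (Sum.inrₗ j.rev : Fin q ⊕ₗ Fin n) + 1)) * w0Stab b lam := by
  have h : rank (Sum.inrₗ j.rev : Fin q ⊕ₗ Fin n) + 1 = q + n - j := by
    rw [rank_inr, Fin.val_rev]
    omega
  rw [h, rank_inr, wOf_cut_revSet hlam hK j.2.le]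

theorem wOf_cut_rank_succ_revSet (hlam : IsDominantWeight b lam)
    (hK : IsRevInitial b lam β J (revInitial b lam β J)) (j : Fin n) :
    wOf P (revChain b lam β) (cut (revSet b lam β J) (rank (Sum.inrₗ j : Fin q ⊕ₗ Fin n) + 1))
      = w0 b * wOf P β (cut J (rank (Sum.inrₗ j.rev : Fin q ⊕ₗ Fin n))) * w0Stab b lam := by
  have h : rank (Sum.inrₗ j.rev : Fin q ⊕ₗ Fin n) = q + n - (j + 1) := by
    rw [rank_inr, Fin.val_rev]
    omega
  rw [h, rank_inr, add_assoc, wOf_cut_revSet hlam hK j.2]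

theorem IsGallery.isAdmissible_revSet (hlam : IsDominantWeight b lam)
    (hβ : IsGallery b lam β) (hI : ∀ i, lEmpty β i = 0 ↔ ∃ a : Fin q, i = Sum.inlₗ a)
    (hJ : IsAdmissible b β J) : IsAdmissible b (revChain b lam β) (revSet b lam β J) := by
  have hK := hβ.isRevInitial_revInitial hlam hI hJ
  have hpos := (hβ.isGallery_revChain hlam hI).isPos
  rw [isAdmissible_iff hpos]
  intro i
  induction i using forall_lex with
  | h1 a =>
    intro h
    have h1 := rank_inl_lt (n := n) a
    have h2 := (isAdmissible_iff hpos).1 hK.1 (Sum.inlₗ a) (inl_mem_barSet.2 (inl_mem_revSet.1 h))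
    rwa [cut_revSet h1, cut_revSet h1.le]
  | h2 j =>
    intro h
    have h1 := (isAdmissible_iff hβ.isPos).1 hJ _ (inr_mem_revSet.1 h)
    have h2 : rank (Sum.inrₗ j.rev : Fin q ⊕ₗ Fin n) + 1 ≤ _ := rank_lt_card _
    -- `x ↦ w_∘ x w_∘^λ` reverses the length on the elements that are minimal in their cosets
    have h3 := (hβ.isMinCoset_wOf_cut hlam hJ h2).len_w0_mul_mul_w0Stab hlam
    have h4 := (hβ.isMinCoset_wOf_cut hlam hJ (Nat.le_of_succ_le h2)).len_w0_mul_mul_w0Stab hlam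
    rw [wOf_cut_rank_revSet hlam hK, wOf_cut_rank_succ_revSet hlam hK]
    omega

/-! ### Levels in the reversed gallery -/

theorem inr_mem_idxSet_revSet (hlam : IsDominantWeight b lam)
    (hK : IsRevInitial b lam β J (revInitial b lam β J)) {p : ι} {j : Fin n} :
    Sum.inrₗ j ∈ idxSet P (revChain b lam β) (revSet b lam β J) (star b p)
      ↔ Sum.inrₗ j.rev ∈ idxSet P β J p := by
  have h : foldedRoot P (revChain b lam β) (revSet b lam β J) (Sum.inrₗ j)
      = act (w0 b) (act (wOf P β (cut J (rank (Sum.inrₗ j.rev : Fin q ⊕ₗ Fin n) + 1)))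
        (β (Sum.inrₗ j.rev))) := by
    rw [foldedRoot_eq, wOf_cut_rank_revSet hlam hK, revChain_inr, act_mul, act_mul,
      act_w0Stab_act hlam]
  rw [mem_idxSet, mem_idxSet, h, star, negIdx_negIdx, ← act_negIdx, act_inj, act_inj,
    foldedRoot_eq]
  by_cases hj : Sum.inrₗ j.rev ∈ J
  · rw [wOf_cut_succ_of_mem β hj, act_mul, act_refl_self, act_negIdx]
    refine or_congr negIdx_inj ?_
    rw [← negIdx_inj (P := P), negIdx_negIdx]
  · rw [wOf_cut_succ_of_notMem β hj]
    exact or_comm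

/-- The alcoves of the gallery `γ(J^rev)` outside of the initial segment are the images of
those of `γ(J)` under the map `z ↦ -w_∘(z + μ(J))`. -/
theorem IsGallery.coroot'_wHatOf_cut_revSet (hlam : IsDominantWeight b lam)
    (hβ : IsGallery b lam β) (hI : ∀ i, lEmpty β i = 0 ↔ ∃ a : Fin q, i = Sum.inlₗ a)
    (hK : IsRevInitial b lam β J (revInitial b lam β J)) (p : ι) {m : ℕ} (hm : m ≤ n) (x : V) :
    P.coroot' (star b p) (wHatOf P (revChain b lam β) (cut (revSet b lam β J) (q + m)) x)
      = P.coroot' p (wHatOf P β (cut J (q + n - m)) (-(w0Stab b lam • (x + lam))))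
        + levelInf P β lam J p := by
  induction m generalizing x with
  | zero =>
    have h0 : P.coroot' (star b p)
        (wHatOf P (revChain b lam β) (barSet (revInitial b lam β J)) 0) = 0 := by
      rw [← cut_barSet le_rfl, wHatOf_cut_apply_zero (lEmpty_revChain_eq_zero hI) le_rfl
        (by rw [card_lex]; omega), map_zero]
    have h1 : act (wOf P (revChain b lam β) (barSet (revInitial b lam β J)))⁻¹ (star b p)
        = negIdx P (act (w0Stab b lam) (act (wOf P β J)⁻¹ p)) := by
      rw [hK.2, star, act_negIdx, mul_inv_rev, mul_inv_rev, act_mul, act_mul, act_inv_act,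
        w0Stab_inv hlam]
    have h2 := coroot'_act_w0Stab b lam (act (wOf P β J)⁻¹ p)
    rw [add_zero, cut_revSet le_rfl, cut_barSet le_rfl, Nat.sub_zero,
      cut_of_card_le J card_lex.le, coroot'_wHatOf, h0, h1, coroot'_negIdx, levelInf, weight,
      map_neg (P.coroot' _), coroot'_wHatOf, coroot'_wHatOf (x := -lam), map_neg (P.coroot' _),
      map_neg (P.coroot' _), coroot'_smul, w0Stab_inv hlam, map_add, h2]
    ring
  | succ m ih =>
    have ih := ih (by omega)
    let j : Fin n := ⟨m, by omega⟩
    have h1 : q + m = rank (Sum.inrₗ j : Fin q ⊕ₗ Fin n) := (rank_inr j).symm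
    have h2 : q + n - (m + 1) = rank (Sum.inrₗ j.rev : Fin q ⊕ₗ Fin n) := by
      rw [rank_inr, Fin.val_rev]
      change _ = q + (n - (m + 1))
      omega
    have h3 : q + n - m = q + n - (m + 1) + 1 := by omega
    rw [h3] at ih
    rw [← add_assoc, h2]
    rw [h2, h1] at ih
    rw [h1]
    by_cases hj : Sum.inrₗ j.rev ∈ J
    · have h4 : ∀ y, wHatOf P β (cut J (rank (Sum.inrₗ j.rev : Fin q ⊕ₗ Fin n) + 1)) y
          = wHatOf P β (cut J (rank (Sum.inrₗ j.rev : Fin q ⊕ₗ Fin n)))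
            (rHat P β (Sum.inrₗ j.rev) y) := by
        intro y
        rw [wHatOf, ordProd_cut_succ_of_mem _ hj]
        rfl
      have h5 : wHatOf P (revChain b lam β)
            (cut (revSet b lam β J) (rank (Sum.inrₗ j : Fin q ⊕ₗ Fin n) + 1)) x
          = wHatOf P (revChain b lam β)
            (cut (revSet b lam β J) (rank (Sum.inrₗ j : Fin q ⊕ₗ Fin n)))
            (rHat P (revChain b lam β) (Sum.inrₗ j) x) := by
        rw [wHatOf, ordProd_cut_succ_of_mem _ (inr_mem_revSet.2 hj)]
        rfl
      have h6 : rHat P β (Sum.inrₗ j.rev)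
          (-(w0Stab b lam • (rHat P (revChain b lam β) (Sum.inrₗ j) x + lam)))
          = -(w0Stab b lam • (x + lam)) := by
        have h7 : w0Stab b lam • P.root (act (w0Stab b lam) (β (Sum.inrₗ j.rev)))
            = P.root (β (Sum.inrₗ j.rev)) := by
          rw [← root_act, act_w0Stab_act hlam]
        have h8 : w0Stab b lam • (rHat P (revChain b lam β) (Sum.inrₗ j) x + lam)
            = w0Stab b lam • (x + lam)
              - (P.coroot' (act (w0Stab b lam) (β (Sum.inrₗ j.rev))) x
                + P.coroot' (β (Sum.inrₗ j.rev)) lam - lEmpty β (Sum.inrₗ j.rev))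
                • P.root (β (Sum.inrₗ j.rev)) := by
          rw [rHat, affRefl_apply, revChain_inr, Int.cast_neg, Int.cast_natCast,
            hβ.lEmpty_revChain_inr hlam hI, smul_add, smul_add, smul_sub, smul_comm, h7]
          generalize w0Stab b lam • x = u
          generalize w0Stab b lam • lam = v
          module
        rw [h8, rHat, affRefl_apply, map_neg, map_sub, coroot'_smul, w0Stab_inv hlam, map_add,
          map_smul, coroot'_root_self, coroot'_act_w0Stab, smul_eq_mul, Int.cast_neg,
          Int.cast_natCast]
        generalize w0Stab b lam • (x + lam) = u
        module
      rw [h5, ih, h4, h6]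
    · rw [cut_succ_of_notMem hj] at ih
      rw [cut_succ_of_notMem (fun h => hj (inr_mem_revSet.1 h)), ih]

/-- The weight of `J^rev` is `w_∘(μ(J))`. -/
theorem IsGallery.levelInf_revSet (hlam : IsDominantWeight b lam)
    (hβ : IsGallery b lam β) (hI : ∀ i, lEmpty β i = 0 ↔ ∃ a : Fin q, i = Sum.inlₗ a)
    (hK : IsRevInitial b lam β J (revInitial b lam β J)) (p : ι) :
    levelInf P (revChain b lam β) lam (revSet b lam β J) (star b p) = -levelInf P β lam J p := by
  have h := hβ.coroot'_wHatOf_cut_revSet hlam hI hK p le_rfl (-lam)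
  rw [cut_of_card_le (m := q + n) _ card_lex.le, neg_add_cancel, smul_zero, neg_zero,
    Nat.add_sub_cancel,
    wHatOf_cut_apply_zero (q := q) (fun i hi => (hI i).2 (rank_lt_iff_exists_inl.1 hi)) le_rfl
      (by rw [card_lex]; omega), map_zero, zero_add] at h
  rw [levelInf, weight, map_neg, h]

theorem IsGallery.level_revSet (hlam : IsDominantWeight b lam)
    (hβ : IsGallery b lam β) (hI : ∀ i, lEmpty β i = 0 ↔ ∃ a : Fin q, i = Sum.inlₗ a)
    (hK : IsRevInitial b lam β J (revInitial b lam β J)) {p : ι} (hp : p ∈ b.support) {j : Fin n}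
    (hj : Sum.inrₗ j.rev ∈ idxSet P β J p) :
    level b (revChain b lam β) (revSet b lam β J) (Sum.inrₗ j)
      = level b β J (Sum.inrₗ j.rev) - levelInf P β lam J p := by
  have hpp : b.IsPos p := RootPairing.Base.isPos_of_mem_support hp
  have hj' := (inr_mem_idxSet_revSet hlam hK).2 hj
  have h0 : rank (Sum.inrₗ j.rev : Fin q ⊕ₗ Fin n) + 1 = q + n - j := by
    rw [rank_inr, Fin.val_rev]
    omega
  rw [level, level, absIdx_eq_of_eq_or b (isPos_star b hp) (mem_idxSet.1 hj'),
    absIdx_eq_of_eq_or b hpp (mem_idxSet.1 hj), ← cut_rank, ← cut_rank, rank_inr,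
    hβ.coroot'_wHatOf_cut_revSet hlam hI hK p j.2.le, ← h0]
  -- the map `x ↦ -w_∘^λ(x + λ)` leads to a point of the wall `H_{β, -l}`
  have key : ∀ y, P.coroot' (β (Sum.inrₗ j.rev)) y = -lEmpty β (Sum.inrₗ j.rev) →
      P.coroot' p (wHatOf P β (cut J (rank (Sum.inrₗ j.rev : Fin q ⊕ₗ Fin n) + 1)) y)
      = P.coroot' p (wHatOf P β (cut J (rank (Sum.inrₗ j.rev : Fin q ⊕ₗ Fin n)))
        (-((lEmpty β (Sum.inrₗ j.rev) : ℝ) / 2) • P.root (β (Sum.inrₗ j.rev)))) := by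
    intro y hy
    have h1 : wHatOf P β (cut J (rank (Sum.inrₗ j.rev : Fin q ⊕ₗ Fin n) + 1)) y
        = wHatOf P β (cut J (rank (Sum.inrₗ j.rev : Fin q ⊕ₗ Fin n))) y := by
      by_cases hjJ : Sum.inrₗ j.rev ∈ J
      · have h2 : rHat P β (Sum.inrₗ j.rev) y = y := by
          rw [rHat, affRefl_apply, hy]
          simp
        conv_rhs => rw [← h2]
        rw [wHatOf, ordProd_cut_succ_of_mem _ hjJ]
        rfl
      · rw [cut_succ_of_notMem hjJ]
    rw [h1, coroot'_wHatOf, coroot'_wHatOf (x := _ • _)]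
    congr 1
    rcases mem_idxSet_iff.1 hj with h | h
    · rw [h, hy, map_smul, coroot'_root_self, smul_eq_mul]
      ring
    · rw [h, coroot'_negIdx, coroot'_negIdx, hy, map_smul, coroot'_root_self, smul_eq_mul]
      ring
  rw [key, levelInf]
  · ring
  rw [map_neg, coroot'_smul, w0Stab_inv hlam, map_add, coroot'_act_w0Stab, revChain_inr, map_smul,
    coroot'_root_self, smul_eq_mul, hβ.lEmpty_revChain_inr hlam hI]
  ring

end

/-! ### The maximal level and the operator `F_p` -/

section

variable {ι V N : Type*} [AddCommGroup V] [Module ℝ V] [AddCommGroup N] [Module ℝ N]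
  {P : RootPairing ι ℝ V N}

section General

variable {I : Type*} [LinearOrder I] [Fintype I] {b : P.Base} {lam : V} {β : I → ι}
  {J : Finset I} {p : ι}

theorem levelInf_le_maxLevel : levelInf P β lam J p ≤ maxLevel b β lam J p :=
  Finset.le_max' _ _ (Finset.mem_insert_self _ _)

theorem level_le_maxLevel {i : I} (hi : i ∈ idxSet P β J p) :
    level b β J i ≤ maxLevel b β lam J p :=
  Finset.le_max' _ _ (Finset.mem_insert_of_mem (Finset.mem_image_of_mem _ hi))

theorem maxLevel_eq_or (b : P.Base) (β : I → ι) (lam : V) (J : Finset I) (p : ι) :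
    maxLevel b β lam J p = levelInf P β lam J p
      ∨ ∃ i ∈ idxSet P β J p, level b β J i = maxLevel b β lam J p := by
  have h : maxLevel b β lam J p ∈ _ := Finset.max'_mem _ (Finset.insert_nonempty _ _)
  rwa [Finset.mem_insert, Finset.mem_image] at h

theorem mem_topSet {i : I} : i ∈ topSet b β lam J p ↔
    i ∈ idxSet P β J p ∧ level b β J i = maxLevel b β lam J p :=
  Finset.mem_filter

theorem mem_opF {i : I} : i ∈ opF b β lam p J ↔
    (i ∈ J ∧ ¬ IsMF b β lam p J i) ∨ IsKF b β lam p J i := by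
  simp [opF]

theorem mem_opE {i : I} : i ∈ opE b β lam p J ↔
    (i ∈ J ∧ ¬ IsKE b β lam p J i) ∨ IsME b β lam p J i := by
  simp [opE]

open scoped Classical in
theorem mem_idxSet_insert_self {k : I} :
    k ∈ idxSet P β (insert k J) p ↔ k ∈ idxSet P β J p := by
  rw [mem_idxSet_iff, mem_idxSet_iff, cut_insert_of_le le_rfl]

variable [Finite ι] [P.IsRootSystem] [P.IsCrystallographic] [P.IsReduced]

theorem IsGallery.lev_le_maxLevel (hβ : IsGallery b lam β) (hpp : b.IsPos p) {m : ℕ}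
    (hm : hits P β J p m) :
    SignedWalk.lev (sgn b β J p) (posn b β J p) m ≤ maxLevel b β lam J p := by
  obtain ⟨i, rfl, hi⟩ := hm
  rw [← hβ.level_eq hpp hi]
  exact level_le_maxLevel hi

theorem IsGallery.maxLevel_nonneg (hβ : IsGallery b lam β) (hJ : IsAdmissible b β J)
    (hp : p ∈ b.support) : 0 ≤ maxLevel b β lam J p := by
  obtain ⟨m, -, hX, h0⟩ := (hβ.signedWalk hJ hp le_rfl).exists_lev_zero
  rcases hX with hX | rfl
  · rw [← h0]
    exact hβ.lev_le_maxLevel (RootPairing.Base.isPos_of_mem_support hp) hX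
  · rw [← hβ.levelInf_eq (p := p)] at h0
    exact h0 ▸ levelInf_le_maxLevel

open scoped Classical in
/-- If the maximal level is attained by a wall, then `F_p` moves a folding position from the
first such wall to its predecessor, and this does not change `w(J)`. -/
theorem IsGallery.opF_of_isMF (hβ : IsGallery b lam β) (hJ : IsAdmissible b β J)
    (hp : p ∈ b.support) (hM : FDefined b β lam p J) {m : I} (hm : IsMF b β lam p J m) :
    IsAdmissible b β (opF b β lam p J) ∧ wOf P β (opF b β lam p J) = wOf P β J := by
  have hpp : b.IsPos p := RootPairing.Base.isPos_of_mem_support hp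
  obtain ⟨hmX, hmM⟩ := mem_topSet.1 hm.1
  obtain ⟨k', hkm, ⟨k, rfl, hkX⟩, hnext, hkJ, hS, hmJ⟩ :=
    (hβ.signedWalk hJ hp le_rfl).first_max hM (fun _ _ => hβ.lev_le_maxLevel hpp)
      (hβ.levelInf_eq (p := p) ▸ levelInf_le_maxLevel) (rank_lt_card m).le
      (Or.inl (hits_rank.2 hmX)) (hβ.level_eq hpp hmX ▸ hmM) (by
        rintro j hj ⟨i, rfl, hi⟩ h
        rw [← hβ.level_eq hpp hi] at h
        exact absurd (rank_lt_iff.1 hj) (not_lt.2 (hm.2 (mem_topSet.2 ⟨hi, h⟩))))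
  rw [folds_rank] at hkJ
  have hmJ := folds_rank.1 (hmJ (rank_lt_card m))
  rw [rank_lt_iff] at hkm
  have hMF : ∀ i, IsMF b β lam p J i ↔ i = m :=
    fun i => ⟨fun h => h.unique hm, fun h => h ▸ hm⟩
  have hKF : ∀ i, IsKF b β lam p J i ↔ i = k := by
    have hk : IsKF b β lam p J k := by
      refine ⟨⟨hkX, fun i hi => (hMF i).1 hi ▸ hkm⟩, fun i hi => ?_⟩
      by_contra h
      exact hnext (rank i) (rank_lt_iff.2 (not_le.1 h)) (rank_lt_iff.2 (hi.2 m hm))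
        (hits_rank.2 hi.1)
    exact fun i => ⟨fun h => h.unique hk, fun h => h ▸ hk⟩
  have hJm : insert m (J.erase m) = J := Finset.insert_erase hmJ
  have hop : opF b β lam p J = insert k (J.erase m) := by
    ext i
    rw [mem_opF, hMF, hKF, Finset.mem_insert, Finset.mem_erase]
    tauto
  have hmJ' : m ∉ J.erase m := Finset.notMem_erase m J
  have hmX' : m ∈ idxSet P β (J.erase m) p := by
    rwa [← mem_idxSet_insert_self, hJm]
  have hX : idxSet P β (J.erase m) p = idxSet P β J p := by
    rw [← idxSet_insert hmJ' hmX', hJm]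
  rw [hop]
  have h := hβ.isAdmissible_insert_insert hkm (fun h => hkJ (Finset.mem_of_mem_erase h)) hmJ'
    (by rwa [hJm]) hp (hX ▸ hkX) hmX' (fun j h1 h2 => by
      rw [sgn, ← cut_insert_of_le h2, hJm]
      exact hS j h1 h2)
  rwa [hJm] at h

open scoped Classical in
/-- If the maximal level is not attained by a wall, then `F_p` adds the last wall orthogonal to
`α_p` as a folding position. -/
theorem IsGallery.opF_of_not_isMF (hβ : IsGallery b lam β) (hJ : IsAdmissible b β J)
    (hp : p ∈ b.support) (hM : FDefined b β lam p J) (hm : ∀ m, ¬ IsMF b β lam p J m) :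
    IsAdmissible b β (opF b β lam p J) ∧
      wOf P β (opF b β lam p J) = refl P p * wOf P β J := by
  have hpp : b.IsPos p := RootPairing.Base.isPos_of_mem_support hp
  have htop : ∀ i ∈ idxSet P β J p, level b β J i ≠ maxLevel b β lam J p := by
    intro i hi h
    have hne : (topSet b β lam J p).Nonempty := ⟨i, mem_topSet.2 ⟨hi, h⟩⟩
    exact hm _ ((topSet b β lam J p).isLeast_min' hne)
  have hInf : maxLevel b β lam J p = levelInf P β lam J p :=
    (maxLevel_eq_or b β lam J p).resolve_right fun ⟨i, hi, h⟩ => htop i hi h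
  obtain ⟨k', -, ⟨k, rfl, hkX⟩, hnext, hkJ, hS, -⟩ :=
    (hβ.signedWalk hJ hp le_rfl).first_max hM (fun _ _ => hβ.lev_le_maxLevel hpp)
      (hβ.levelInf_eq (p := p) ▸ levelInf_le_maxLevel) le_rfl (Or.inr rfl)
      (by rw [hInf, hβ.levelInf_eq]) (by
        rintro j - ⟨i, rfl, hi⟩ h
        rw [← hβ.level_eq hpp hi] at h
        exact htop i hi h)
  rw [folds_rank] at hkJ
  have hKF : ∀ i, IsKF b β lam p J i ↔ i = k := by
    have hk : IsKF b β lam p J k := by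
      refine ⟨⟨hkX, fun i hi => absurd hi (hm i)⟩, fun i hi => ?_⟩
      by_contra h
      exact hnext (rank i) (rank_lt_iff.2 (not_le.1 h)) (rank_lt_card i) (hits_rank.2 hi.1)
    exact fun i => ⟨fun h => h.unique hk, fun h => h ▸ hk⟩
  have hop : opF b β lam p J = insert k J := by
    ext i
    rw [mem_opF, hKF, Finset.mem_insert]
    have := hm i
    tauto
  rw [hop]
  refine ⟨hβ.isAdmissible_insert hJ hp hkJ hkX hS, ?_⟩
  have h := wOf_cut_insert hkJ hkX (rank_lt_card k) le_rfl
  rwa [cut_of_card_le _ le_rfl, cut_of_card_le _ le_rfl] at h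

end General

/-! ### Reversal exchanges the root operators -/

variable {q n : ℕ} [Finite ι] [P.IsRootSystem] [P.IsCrystallographic] [P.IsReduced]
  {b : P.Base} {lam : V} {β : Fin q ⊕ₗ Fin n → ι} {J : Finset (Fin q ⊕ₗ Fin n)} {p : ι}

theorem IsGallery.level_inl (hβ : IsGallery b lam β)
    (hq : ∀ i, rank i < q → lEmpty β i = 0) (hp : p ∈ b.support) {a : Fin q}
    (ha : Sum.inlₗ a ∈ idxSet P β J p) : level b β J (Sum.inlₗ a) = 0 := by
  have hpp : b.IsPos p := RootPairing.Base.isPos_of_mem_support hp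
  rw [hβ.level_eq hpp ha]
  exact hβ.lev_initial hq hpp ha (rank_inl_lt a)

theorem inr_rev_le_inr_rev {i j : Fin n} : (Sum.inrₗ i.rev : Fin q ⊕ₗ Fin n) ≤ Sum.inrₗ j.rev
    ↔ (Sum.inrₗ j : Fin q ⊕ₗ Fin n) ≤ Sum.inrₗ i := by
  rw [Sum.Lex.inr_le_inr_iff, Sum.Lex.inr_le_inr_iff, Fin.rev_le_rev]

theorem inr_rev_lt_inr_rev {i j : Fin n} : (Sum.inrₗ i.rev : Fin q ⊕ₗ Fin n) < Sum.inrₗ j.rev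
    ↔ (Sum.inrₗ j : Fin q ⊕ₗ Fin n) < Sum.inrₗ i := by
  rw [Sum.Lex.inr_lt_inr_iff, Sum.Lex.inr_lt_inr_iff, Fin.rev_lt_rev]

section Rev

variable (hlam : IsDominantWeight b lam) (hβ : IsGallery b lam β)
  (hI : ∀ i, lEmpty β i = 0 ↔ ∃ a : Fin q, i = Sum.inlₗ a) (hJ : IsAdmissible b β J)
  (hp : p ∈ b.support)
include hlam hβ hI hJ hp

omit hJ in
theorem IsGallery.level_revSet_inl {a : Fin q}
    (ha : Sum.inlₗ a ∈ idxSet P (revChain b lam β) (revSet b lam β J) (star b p)) :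
    level b (revChain b lam β) (revSet b lam β J) (Sum.inlₗ a) = 0 := by
  exact (hβ.isGallery_revChain hlam hI).level_inl (lEmpty_revChain_eq_zero hI)
    (star_mem_support b hp) ha

/-- The walls outside of the initial segment have levels at most `M(J, p) - ⟨μ(J), α_p^∨⟩` since
levels are shifted, and those of the initial segment have level `0`. -/
theorem IsGallery.maxLevel_revSet_le :
    maxLevel b (revChain b lam β) lam (revSet b lam β J) (star b p)
      ≤ maxLevel b β lam J p - levelInf P β lam J p := by
  have hK := hβ.isRevInitial_revInitial hlam hI hJ
  rcases maxLevel_eq_or b (revChain b lam β) lam (revSet b lam β J) (star b p)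
    with h | ⟨i, hi, h⟩
  · rw [h, hβ.levelInf_revSet hlam hI hK]
    have := hβ.maxLevel_nonneg hJ hp
    linarith
  rw [← h]
  induction i using forall_lex with
  | h1 a =>
    rw [hβ.level_revSet_inl hlam hI hp hi, sub_nonneg]
    exact levelInf_le_maxLevel
  | h2 j =>
    have hj := (inr_mem_idxSet_revSet hlam hK).1 hi
    rw [hβ.level_revSet hlam hI hK hp hj]
    exact sub_le_sub_right (level_le_maxLevel hj) _

theorem IsGallery.eDefined_revSet_iff :
    EDefined b (revChain b lam β) lam (star b p) (revSet b lam β J) ↔ FDefined b β lam p J := by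
  have hK := hβ.isRevInitial_revInitial hlam hI hJ
  change levelInf P (revChain b lam β) lam (revSet b lam β J) (star b p) < _ ↔ _
  rw [hβ.levelInf_revSet hlam hI hK]
  constructor
  · intro h
    have h1 := hβ.maxLevel_revSet_le hlam hI hJ hp
    rw [FDefined]
    linarith
  · intro h
    change 0 < _ at h
    rcases maxLevel_eq_or b β lam J p with h1 | ⟨i, hi, h1⟩
    · have h2 := (hβ.isGallery_revChain hlam hI).maxLevel_nonneg
        (hβ.isAdmissible_revSet hlam hI hJ) (star_mem_support b hp)
      linarith
    · induction i using forall_lex with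
      | h1 a =>
        rw [hβ.level_inl (fun i hi => (hI i).2 (rank_lt_iff_exists_inl.1 hi)) hp hi] at h1
        exact absurd h1 h.ne
      | h2 j =>
        rw [← j.rev_rev] at hi h1
        have h2 := level_le_maxLevel (lam := lam) (b := b) ((inr_mem_idxSet_revSet hlam hK).2 hi)
        rw [hβ.level_revSet hlam hI hK hp hi] at h2
        linarith

variable (hM : FDefined b β lam p J)
include hM

theorem IsGallery.maxLevel_revSet :
    maxLevel b (revChain b lam β) lam (revSet b lam β J) (star b p)
      = maxLevel b β lam J p - levelInf P β lam J p := by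
  have hK := hβ.isRevInitial_revInitial hlam hI hJ
  change 0 < _ at hM
  refine le_antisymm (hβ.maxLevel_revSet_le hlam hI hJ hp) ?_
  rcases maxLevel_eq_or b β lam J p with h1 | ⟨i, hi, h1⟩
  · have h2 := (hβ.isGallery_revChain hlam hI).maxLevel_nonneg
      (hβ.isAdmissible_revSet hlam hI hJ) (star_mem_support b hp)
    linarith
  · induction i using forall_lex with
    | h1 a =>
      rw [hβ.level_inl (fun i hi => (hI i).2 (rank_lt_iff_exists_inl.1 hi)) hp hi] at h1
      exact absurd h1 hM.ne
    | h2 j =>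
      rw [← j.rev_rev] at hi h1
      have h2 := level_le_maxLevel (lam := lam) (b := b) ((inr_mem_idxSet_revSet hlam hK).2 hi)
      rwa [hβ.level_revSet hlam hI hK hp hi, h1] at h2

omit hlam hJ in
theorem IsGallery.inl_notMem_topSet {a : Fin q} : Sum.inlₗ a ∉ topSet b β lam J p := by
  intro h
  obtain ⟨h1, h2⟩ := mem_topSet.1 h
  rw [hβ.level_inl (fun i hi => (hI i).2 (rank_lt_iff_exists_inl.1 hi)) hp h1] at h2
  exact hM.ne h2

theorem IsGallery.inr_mem_topSet_revSet {j : Fin n} :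
    Sum.inrₗ j ∈ topSet b (revChain b lam β) lam (revSet b lam β J) (star b p)
      ↔ Sum.inrₗ j.rev ∈ topSet b β lam J p := by
  have hK := hβ.isRevInitial_revInitial hlam hI hJ
  rw [mem_topSet, mem_topSet, inr_mem_idxSet_revSet hlam hK]
  refine and_congr_right fun hj => ?_
  rw [hβ.level_revSet hlam hI hK hp hj, hβ.maxLevel_revSet hlam hI hJ hp hM, sub_left_inj]

theorem IsGallery.isKE_revSet_iff {j : Fin n} :
    IsKE b (revChain b lam β) lam (star b p) (revSet b lam β J) (Sum.inrₗ j)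
      ↔ IsMF b β lam p J (Sum.inrₗ j.rev) := by
  have htop : ∀ {j : Fin n}, _ := fun {j} => hβ.inr_mem_topSet_revSet hlam hI hJ hp hM (j := j)
  constructor
  · refine fun h => ⟨htop.1 h.1, fun y hy => ?_⟩
    induction y using forall_lex with
    | h1 a => exact absurd hy (hβ.inl_notMem_topSet hI hp hM)
    | h2 i =>
      rw [← i.rev_rev] at hy ⊢
      exact inr_rev_le_inr_rev.2 (h.2 (htop.2 hy))
  · refine fun h => ⟨htop.2 h.1, fun y hy => ?_⟩
    induction y using forall_lex with
    | h1 a => exact (Sum.Lex.inl_lt_inr _ _).le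
    | h2 i => exact inr_rev_le_inr_rev.1 (h.2 (htop.1 hy))

theorem IsGallery.exists_isKE_revSet :
    ∃ k, IsKE b (revChain b lam β) lam (star b p) (revSet b lam β J) k := by
  rcases maxLevel_eq_or b (revChain b lam β) lam (revSet b lam β J) (star b p)
    with h | ⟨i, hi, h⟩
  · have h1 := (hβ.eDefined_revSet_iff hlam hI hJ hp).2 hM
    rw [EDefined, h] at h1
    exact absurd h1 (lt_irrefl _)
  · have hne : (topSet b (revChain b lam β) lam (revSet b lam β J) (star b p)).Nonempty :=
      ⟨i, mem_topSet.2 ⟨hi, h⟩⟩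
    exact ⟨_, Finset.isGreatest_max' _ hne⟩

/-- All walls of the initial segment have the same level, hence none of them comes after the
last wall of maximal level. -/
theorem IsGallery.exists_isKE_inl_le {a : Fin q}
    (ha : Sum.inlₗ a ∈ idxSet P (revChain b lam β) (revSet b lam β J) (star b p)) :
    ∃ k, IsKE b (revChain b lam β) lam (star b p) (revSet b lam β J) k ∧ Sum.inlₗ a ≤ k := by
  obtain ⟨k, hk⟩ := hβ.exists_isKE_revSet hlam hI hJ hp hM
  refine ⟨k, hk, ?_⟩
  induction k using forall_lex with
  | h1 c =>
    obtain ⟨h1, h2⟩ := mem_topSet.1 hk.1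
    rw [hβ.level_revSet_inl hlam hI hp h1] at h2
    exact hk.2 (mem_topSet.2 ⟨ha, by rw [hβ.level_revSet_inl hlam hI hp ha, h2]⟩)
  | h2 j => exact (Sum.Lex.inl_lt_inr _ _).le

theorem IsGallery.not_isME_revSet_inl {a : Fin q} :
    ¬ IsME b (revChain b lam β) lam (star b p) (revSet b lam β J) (Sum.inlₗ a) := by
  intro h
  obtain ⟨k, hk, hak⟩ := hβ.exists_isKE_inl_le hlam hI hJ hp hM h.1.1
  exact absurd (h.1.2 k hk) (not_lt.2 hak)

theorem IsGallery.isME_revSet_iff {j : Fin n} :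
    IsME b (revChain b lam β) lam (star b p) (revSet b lam β J) (Sum.inrₗ j)
      ↔ IsKF b β lam p J (Sum.inrₗ j.rev) := by
  have hK := hβ.isRevInitial_revInitial hlam hI hJ
  have hKE : ∀ {j : Fin n}, _ := fun {j} => hβ.isKE_revSet_iff hlam hI hJ hp hM (j := j)
  have hset : ∀ i : Fin n, (Sum.inrₗ i ∈ {m | m ∈ idxSet P (revChain b lam β) (revSet b lam β J)
        (star b p) ∧ ∀ k, IsKE b (revChain b lam β) lam (star b p) (revSet b lam β J) k → k < m})
      ↔ Sum.inrₗ i.rev ∈ {k | k ∈ idxSet P β J p ∧ ∀ m, IsMF b β lam p J m → k < m} := by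
    intro i
    refine and_congr (inr_mem_idxSet_revSet hlam hK) ⟨fun h m hm => ?_, fun h k hk => ?_⟩
    · induction m using forall_lex with
      | h1 a => exact absurd hm.1 (hβ.inl_notMem_topSet hI hp hM)
      | h2 m =>
        rw [← m.rev_rev] at hm ⊢
        exact inr_rev_lt_inr_rev.2 (h _ (hKE.2 hm))
    · induction k using forall_lex with
      | h1 a => exact Sum.Lex.inl_lt_inr _ _
      | h2 k => exact inr_rev_lt_inr_rev.1 (h _ (hKE.1 hk))
  constructor
  · refine fun h => ⟨(hset j).1 h.1, fun y hy => ?_⟩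
    induction y using forall_lex with
    | h1 a => exact (Sum.Lex.inl_lt_inr _ _).le
    | h2 i =>
      rw [← i.rev_rev] at hy ⊢
      exact inr_rev_le_inr_rev.2 (h.2 ((hset _).2 hy))
  · refine fun h => ⟨(hset j).2 h.1, fun y hy => ?_⟩
    induction y using forall_lex with
    | h1 a =>
      obtain ⟨k, hk, hak⟩ := hβ.exists_isKE_inl_le hlam hI hJ hp hM hy.1
      exact absurd (hy.2 k hk) (not_lt.2 hak)
    | h2 i => exact inr_rev_le_inr_rev.1 (h.2 ((hset i).1 hy))

open scoped Classical in
/-- If the last wall of maximal level of `γ(J^rev)` lies in the initial segment, then the gallery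
is folded there and heads down up to the end of this segment. Hence the folding may be removed
from the initial segment. -/
theorem IsGallery.isAdmissible_barSet_erase {c : Fin q}
    (hc : IsKE b (revChain b lam β) lam (star b p) (revSet b lam β J) (Sum.inlₗ c)) :
    IsAdmissible b (revChain b lam β) (barSet ((revInitial b lam β J).erase c)) ∧
      wOf P (revChain b lam β) (barSet ((revInitial b lam β J).erase c))
        = refl P (star b p) * wOf P (revChain b lam β) (barSet (revInitial b lam β J)) := by
  have hK := hβ.isRevInitial_revInitial hlam hI hJ
  have hβ' := hβ.isGallery_revChain hlam hI
  have hp' := star_mem_support b hp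
  have hpp' := isPos_star b hp
  obtain ⟨hcX, hcM⟩ := mem_topSet.1 hc.1
  obtain ⟨m, hcm, hm, hmX, hnext⟩ := SignedWalk.exists_next
    (p := hits P (revChain b lam β) (revSet b lam β J) (star b p))
    (rank_lt_card (Sum.inlₗ c : Fin q ⊕ₗ Fin n))
  have hmlt : SignedWalk.lev (sgn b (revChain b lam β) (revSet b lam β J) (star b p))
      (posn b (revChain b lam β) (revSet b lam β J) (star b p)) m
      < maxLevel b (revChain b lam β) lam (revSet b lam β J) (star b p) := by
    rcases hmX with ⟨i, rfl, hi⟩ | rfl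
    · rw [← hβ'.level_eq hpp' hi]
      refine lt_of_le_of_ne (level_le_maxLevel hi) fun h => ?_
      exact absurd (rank_lt_iff.1 hcm) (not_lt.2 (hc.2 (mem_topSet.2 ⟨hi, h⟩)))
    · rw [← hβ'.levelInf_eq]
      exact (hβ.eDefined_revSet_iff hlam hI hJ hp).2 hM
  -- the next wall orthogonal to `α_{p*}` does not belong to the initial segment
  have hqm : q ≤ m := by
    rcases hmX with ⟨i, rfl, hi⟩ | rfl
    · induction i using forall_lex with
      | h1 a =>
        obtain ⟨k, hk, hak⟩ := hβ.exists_isKE_inl_le hlam hI hJ hp hM hi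
        rw [hk.unique hc] at hak
        exact absurd (rank_lt_iff.1 hcm) (not_lt.2 hak)
      | h2 j => exact le_rank_inr j
    · rw [card_lex]
      exact Nat.le_add_right q n
  obtain ⟨hD, hS⟩ := (hβ'.signedWalk (hβ.isAdmissible_revSet hlam hI hJ) hp' le_rfl).last_max
    (fun _ _ => hβ'.lev_le_maxLevel hpp') (rank_lt_card _) (hits_rank.2 hcX)
    (hβ'.level_eq hpp' hcX ▸ hcM) hcm hm hnext hmlt
  have hcK : c ∈ revInitial b lam β J := inl_mem_revSet.1 (folds_rank.1 hD)
  have hins : ∀ {d : DecidableEq (Fin q ⊕ₗ Fin n)},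
      @insert _ _ (@Finset.instInsert _ d) (Sum.inlₗ c) (barSet ((revInitial b lam β J).erase c))
      = (barSet (revInitial b lam β J) : Finset (Fin q ⊕ₗ Fin n)) := by
    intro d
    ext i
    induction i using forall_lex with
    | h1 a =>
      rw [Finset.mem_insert, inl_mem_barSet, inl_mem_barSet, Finset.mem_erase]
      by_cases hac : a = c
      · rw [hac]
        exact iff_of_true (Or.inl rfl) hcK
      · exact (or_iff_right fun h => hac (Sum.inl_injective h)).trans (and_iff_right hac)
    | h2 j =>
      rw [Finset.mem_insert]
      exact (or_iff_right fun h => Sum.inr_ne_inl h).trans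
        (iff_of_false inr_notMem_barSet inr_notMem_barSet)
  have hcK' : (Sum.inlₗ c : Fin q ⊕ₗ Fin n) ∉ barSet ((revInitial b lam β J).erase c) := by
    rw [inl_mem_barSet]
    exact Finset.notMem_erase _ _
  have hcX' : Sum.inlₗ c
      ∈ idxSet P (revChain b lam β) (barSet ((revInitial b lam β J).erase c)) (star b p) := by
    rw [← mem_idxSet_insert_self, hins, mem_idxSet_iff, ← cut_revSet (rank_inl_lt c).le,
      ← mem_idxSet_iff]
    exact hcX
  constructor
  · refine hβ'.isAdmissible_of_insert hcK' (by rw [hins]; exact hK.1) hp' hcX' fun j h1 _ => ?_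
    rw [hins, sgn]
    rcases le_total j q with h2 | h2
    · rw [← cut_revSet h2]
      exact hS j h1 (h2.trans hqm)
    · rw [cut_barSet h2, ← cut_barSet le_rfl, ← cut_revSet le_rfl]
      exact hS q (rank_inl_lt c) hqm
  · have h := wOf_cut_insert hcK' hcX' (rank_lt_card _) le_rfl
    rw [hins, cut_of_card_le _ le_rfl, cut_of_card_le _ le_rfl] at h
    rw [h, refl_mul_refl_mul]

theorem IsGallery.isAdmissible_opF : IsAdmissible b β (opF b β lam p J) := by
  by_cases hm : ∃ m, IsMF b β lam p J m
  · obtain ⟨m, hm⟩ := hm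
    exact (hβ.opF_of_isMF hJ hp hM hm).1
  · exact (hβ.opF_of_not_isMF hJ hp hM (not_exists.1 hm)).1

/-- The initial part of `F_p(J)^rev` arises from that of `J^rev` by removing the last wall of
maximal level of `γ(J^rev)`, if this wall lies in the initial segment. -/
theorem IsGallery.mem_revInitial_opF {a : Fin q} : a ∈ revInitial b lam β (opF b β lam p J) ↔
    a ∈ revInitial b lam β J ∧
      ¬ IsKE b (revChain b lam β) lam (star b p) (revSet b lam β J) (Sum.inlₗ a) := by
  classical
  have hK := hβ.isRevInitial_revInitial hlam hI hJ
  have hJF := hβ.isAdmissible_opF hlam hI hJ hp hM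
  have huniq : ∀ K, IsRevInitial b lam β (opF b β lam p J) K →
      revInitial b lam β (opF b β lam p J) = K := fun K h =>
    (hβ.existsUnique_isRevInitial hlam hI hJF).unique
      (hβ.isRevInitial_revInitial hlam hI hJF) h
  obtain ⟨k, hk⟩ := hβ.exists_isKE_revSet hlam hI hJ hp hM
  induction k using forall_lex with
  | h1 c =>
    have hm : ∀ m, ¬ IsMF b β lam p J m := by
      intro m hm
      induction m using forall_lex with
      | h1 a => exact hβ.inl_notMem_topSet hI hp hM hm.1
      | h2 m =>
        rw [← m.rev_rev, ← hβ.isKE_revSet_iff hlam hI hJ hp hM] at hm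
        exact Sum.inr_ne_inl (hm.unique hk)
    have h1 := hβ.isAdmissible_barSet_erase hlam hI hJ hp hM hk
    rw [huniq ((revInitial b lam β J).erase c) ⟨h1.1, ?_⟩, Finset.mem_erase, and_comm]
    · refine and_congr_right fun _ => not_congr ?_
      constructor
      · rintro rfl
        exact hk
      · exact fun h => Sum.inl_injective (h.unique hk)
    · rw [h1.2, hK.2, (hβ.opF_of_not_isMF hJ hp hM hm).2, star, refl_negIdx, ← mul_assoc,
        ← mul_assoc, refl_act_mul, ← mul_assoc]
  | h2 j =>
    have hm := (hβ.isKE_revSet_iff hlam hI hJ hp hM).1 hk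
    rw [huniq (revInitial b lam β J) ⟨hK.1, by rw [(hβ.opF_of_isMF hJ hp hM hm).2, hK.2]⟩]
    exact (and_iff_left fun h => Sum.inl_ne_inr (h.unique hk)).symm

theorem IsGallery.revSet_opF : revSet b lam β (opF b β lam p J)
    = opE b (revChain b lam β) lam (star b p) (revSet b lam β J) := by
  ext i
  induction i using forall_lex with
  | h1 a =>
    rw [inl_mem_revSet, hβ.mem_revInitial_opF hlam hI hJ hp hM, mem_opE, inl_mem_revSet,
      or_iff_left (hβ.not_isME_revSet_inl hlam hI hJ hp hM)]
  | h2 j =>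
    rw [inr_mem_revSet, mem_opF, mem_opE, inr_mem_revSet, hβ.isKE_revSet_iff hlam hI hJ hp hM,
      hβ.isME_revSet_iff hlam hI hJ hp hM]

end Rev

end

end AlcoveModel

theorem mainTheorem5 {ι V N : Type*} [Finite ι] [AddCommGroup V] [Module ℝ V]
    [AddCommGroup N] [Module ℝ N] (P : RootPairing ι ℝ V N) [P.IsRootSystem]
    [P.IsCrystallographic] [P.IsReduced] [P.IsIrreducible] (b : P.Base)
    (lam : V) (hlam : AlcoveModel.IsDominantWeight b lam)
    {q n : ℕ} (β : Fin q ⊕ₗ Fin n → ι) (hβ : AlcoveModel.IsLambdaChain b lam β)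
    (hI : ∀ i, AlcoveModel.lEmpty β i = 0 ↔ ∃ a : Fin q, i = Sum.inlₗ a)
    (p : ι) (hp : p ∈ b.support) :
    AlcoveModel.star b p ∈ b.support ∧
    ∀ J : Finset (Fin q ⊕ₗ Fin n), AlcoveModel.IsAdmissible b β J →
      (∃! K : Finset (Fin q), AlcoveModel.IsRevInitial b lam β J K) ∧
      AlcoveModel.IsAdmissible b (AlcoveModel.revChain b lam β)
        (AlcoveModel.revSet b lam β J) ∧
      (AlcoveModel.FDefined b β lam p J ↔
        AlcoveModel.EDefined b (AlcoveModel.revChain b lam β) lam (AlcoveModel.star b p)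
          (AlcoveModel.revSet b lam β J)) ∧
      (AlcoveModel.FDefined b β lam p J →
        AlcoveModel.IsAdmissible b β (AlcoveModel.opF b β lam p J) ∧
        AlcoveModel.revSet b lam β (AlcoveModel.opF b β lam p J) =
          AlcoveModel.opE b (AlcoveModel.revChain b lam β) lam (AlcoveModel.star b p)
            (AlcoveModel.revSet b lam β J)) := by
  have hΓ := hβ.isGallery hlam
  refine ⟨AlcoveModel.star_mem_support b hp, fun J hJ => ⟨?_, ?_, ?_, fun hM => ⟨?_, ?_⟩⟩⟩
  · exact hΓ.existsUnique_isRevInitial hlam hI hJ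
  · exact hΓ.isAdmissible_revSet hlam hI hJ
  · exact (hΓ.eDefined_revSet_iff hlam hI hJ hp).symm
  · exact hΓ.isAdmissible_opF hlam hI hJ hp hM
  · exact hΓ.revSet_opF hlam hI hJ hp hM
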